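/- Let $M$ be a smooth (Hausdorff) $d$-dimensional manifold with a smooth torsion-free linear connection $\nabla$, with Christoffel symbols $\Gamma_{ij}^k$ and curvature $R(\partial_i,\partial_j)\partial_k=R_{ijk}^l\partial_l$. Let $E\to M$ be the jet bundle with fibre $\mathbb{R}[[y^1,\dots,y^d]]$ and transition functions induced from those of $TM$, and let $\Omega^q(M,E)$ be the smooth $E$-valued $q$-forms. Put $$\delta=\sum_i dx^i\,\partial_{y^i},\qquad \nabla'=\sum_i dx^i\Big(\partial_{x^i}-\sum_{j,k}\Gamma_{ij}^k y^j\partial_{y^k}\Big),\qquad R^{\nabla'}=-\tfrac12 R_{ijk}^l\,dx^i\wedge dx^j\,y^k\partial_{y^l},$$ and $\delta^{-1}\omega=\frac1{p+q}\sum_j y^j\,i(\partial_{x^j})\omega$ for a $q$-form $\omega$ of degree $p$ in $y$ with $p+q>0$ ($\delta^{-1}\omega=0$ if $p=q=0$). The operators $\delta$, $\nabla'$ and $\delta^{-1}$ act likewise on forms with values in the fibrewise formal vector fields $X^k(x;y)\partial_{y^k}$, where $\nabla'$ is extended as a derivation for the fibrewise bracket; for a 1-form $A$ of this kind, $\frac12[A,A](X,Y):=[A(X),A(Y)]$.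 The Grothendieck connection $D^G$ on $E$ is $D^G_Xs(x;y)=\frac{d}{dt}\big|_{t=0}s\big(x(t);\exp_{x(t)}^{-1}(\exp_x y)\big)$ for any curve $x(t)$ with velocity $X$ at $x=x(0)$; that is, if $\phi(x,y)$ is the Taylor expansion of $\exp_x y$ at $y=0$, $$D^G_{\partial_{x^i}}=\partial_{x^i}-\sum_{j,k}\Big(\Big(\frac{\partial\phi}{\partial y}\Big)^{-1}\Big)^k_j\frac{\partial\phi^j}{\partial x^i}\,\partial_{y^k},$$ extended as usual to $\Omega(M,E)$. Dolgushev's Fedosov differential is $D_F=\nabla'-\delta+A_F$, where $A_F$ is the 1-form with values in fibrewise vector fields obtained, by induction on the degree in $y$, from $$A=\delta^{-1}R^{\nabla'}+\delta^{-1}\big(\nabla'A+\tfrac12[A,A]\big).\qquad(*)$$ Then the following hold. 1. There is exactly one smooth 1-form $A=\sum dx^iA_i^k(x;y)\,\partial_{y^k}$ on $M$ with values in fibrewise vector fields such that $D^G=-\delta+\nabla'+A$. 2. The components $A_i^k$ are universal no-loop polynomials in the covariant derivatives of the curvature: in each degree in $y$, $A_i^k$ is a finite linear combination of concatenations $$(\nabla_{\cdots}R)^{j_1}_{i\cdot\cdot}\,(\nabla_{\cdots}R)^{j_2}_{j_1\cdot\cdot}\cdots(\nabla_{\cdots}R)^{k}_{j_{s-1}\cdot\cdot}\;y^\cdot\cdots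 y^\cdot\qquad(s\ge1),$$ where $i,j_1,\dots,j_{s-1}$ are in the first lower slot of the curvature and all other lower indices are contracted with $y$, with real coefficients that depend neither on $M$, nor on its dimension, nor on $\nabla$. 3. $\delta^{-1}A=0$. 4. $-\delta+\nabla'+A$ is flat, i.e. has square $0$ on $\Omega(M,E)$, and $\delta A=R^{\nabla'}+\nabla'A+\frac12[A,A]$. More generally, for every smooth 1-form $A'$ with values in fibrewise vector fields, $(-\delta+\nabla'+A')^2=0$ if and only if $\delta A'=R^{\nabla'}+\nabla'A'+\frac12[A',A']$. 5. $A$ is the only smooth 1-form $A'$ with values in fibrewise vector fields with $\delta^{-1}A'=0$ and $\delta A'=R^{\nabla'}+\nabla'A'+\frac12[A',A']$. 6. $A_F$ is the unique smooth solution of $(*)$, $A_F=A$, and consequently $D_F=D^G$ on $\Omega(M,E)$. -/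

import Mathlib

open scoped Manifold ContDiff

noncomputable section

namespace FedosovGrothendieck

/-- The model space `ℝᵈ`. -/
abbrev Model (d : ℕ) : Type := EuclideanSpace ℝ (Fin d)

/-- The typical fibre `ℝ[[y¹, …, yᵈ]]` of the jet bundle `E`. -/
abbrev Pow (d : ℕ) : Type := MvPowerSeries (Fin d) ℝ

/-- The `i`-th standard basis vector of `ℝᵈ`. -/
def stdVec (d : ℕ) (i : Fin d) : Model d := EuclideanSpace.single i 1

/-! ### Formal power series depending on a point -/

section Formal

variable {d : ℕ}

/-- `∂/∂xⁱ` of a family of formal power series, taken coefficient by coefficient. -/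
def pdx (i : Fin d) (f : Model d → Pow d) (u : Model d) : Pow d :=
  fun α => fderiv ℝ (fun v => MvPowerSeries.coeff α (f v)) u (stdVec d i)

/-- `∂/∂yᵏ` of a formal power series. -/
def pdy (k : Fin d) (f : Pow d) : Pow d := MvPowerSeries.pderiv ℝ k f

/-- Multiplication of the part of degree `p` in `y` by `1 / (p + q)`, for every `p`. -/
def scaleInv (q : ℕ) (f : Pow d) : Pow d :=
  fun α => MvPowerSeries.coeff α f / ((α.degree : ℝ) + q)

/-- The linear substitution `f(y) ↦ f(J y)`. -/
def linSubst (J : Fin d → Fin d → ℝ) (f : Pow d) : Pow d :=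
  MvPowerSeries.subst
    (fun k => ∑ i, MvPowerSeries.C (J k i) * (MvPowerSeries.X i : Pow d)) f

/-- The value at `y` of the homogeneous part of degree `n`. -/
def homEval (n : ℕ) (f : Pow d) (y : Model d) : ℝ :=
  ∑ α ∈ (Finset.univ : Finset (Fin d)).finsuppAntidiag n,
    MvPowerSeries.coeff α f * ∏ i, y i ^ α i

/-- `f` is the Taylor series at `0` of the function `F`, tested along all rays: the part of degree
`n` of `f`, evaluated at `y`, is `(1 / n!) dⁿ/dtⁿ F(t y)` at `t = 0`. This determines `f`. -/
def IsTaylorSeries (F : Model d → ℝ) (f : Pow d) : Prop :=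
  ∀ y : Model d, ContDiffAt ℝ ∞ (fun t : ℝ => F (t • y)) 0 ∧
    ∀ n : ℕ, iteratedDeriv n (fun t : ℝ => F (t • y)) 0 / (n.factorial : ℝ) = homEval n f y

open Classical in
/-- The Taylor series at `0` of a function (`0` if there is none). -/
def taylorSeries (F : Model d → ℝ) : Pow d :=
  if h : ∃ f, IsTaylorSeries F f then h.choose else 0

/-- The Lie bracket `[X, Y]ᵏ = Xˡ ∂_{yˡ} Yᵏ - Yˡ ∂_{yˡ} Xᵏ` of formal vector fields
`X = Xᵏ ∂_{yᵏ}`, `Y = Yᵏ ∂_{yᵏ}` in the fibre. -/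
def vbracket (X Y : Fin d → Pow d) (k : Fin d) : Pow d :=
  ∑ l, (X l * pdy l (Y k) - Y l * pdy l (X k))

end Formal

/-! ### Local formulas in a coordinate domain

`Γ u i j k` is the Christoffel symbol `Γ_{ij}^k(u)`. A `q`-form with values in `E` is given by its
components `η u I = η_u(∂_{I 0}, …, ∂_{I (q-1)})`, a `1`-form `A = dxⁱ Aᵢᵏ(x; y) ∂_{yᵏ}` with values
in fibrewise vector fields by `A u i k`, and a `2`-form `B` with values in fibrewise vector fields
by `B u i j k`, the `k`-th component of `B_u(∂ᵢ, ∂ⱼ)`. -/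

section Local

variable {d : ℕ}

/-- Christoffel symbols on (a part of) `ℝᵈ`. -/
abbrev Chris (d : ℕ) : Type := Model d → Fin d → Fin d → Fin d → ℝ

/-- Components of a `q`-form with values in `E`. -/
abbrev LForm (d q : ℕ) : Type := Model d → (Fin q → Fin d) → Pow d

/-- Components of a `1`-form with values in fibrewise vector fields. -/
abbrev LV1 (d : ℕ) : Type := Model d → Fin d → Fin d → Pow d

/-- Components of a `2`-form with values in fibrewise vector fields. -/
abbrev LV2 (d : ℕ) : Type := Model d → Fin d → Fin d → Fin d → Pow d

/-- The operator `∑ᵢ dxⁱ ∧ Pᵢ` on forms. -/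
def wedgeOp (P : Fin d → (Model d → Pow d) → Model d → Pow d) {q : ℕ} (η : LForm d q) :
    LForm d (q + 1) :=
  fun u I => ∑ a : Fin (q + 1), (-1 : ℝ) ^ (a : ℕ) • P (I a) (fun v => η v (a.removeNth I)) u

/-- `δ = dxⁱ ∂_{yⁱ}` on forms with values in `E`. -/
def deltaForm {q : ℕ} (η : LForm d q) : LForm d (q + 1) :=
  wedgeOp (fun i f u => pdy i (f u)) η

/-- `∇' = dxⁱ (∂_{xⁱ} - Γ_{ij}^k yʲ ∂_{yᵏ})` on forms with values in `E`. -/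
def nablaForm (Γ : Chris d) {q : ℕ} (η : LForm d q) : LForm d (q + 1) :=
  wedgeOp (fun i f u => pdx i f u -
    ∑ j, ∑ k, MvPowerSeries.C (Γ u i j k) * MvPowerSeries.X j * pdy k (f u)) η

/-- The action of `A = dxⁱ Aᵢᵏ ∂_{yᵏ}` on forms with values in `E`. -/
def actForm (A : LV1 d) {q : ℕ} (η : LForm d q) : LForm d (q + 1) :=
  wedgeOp (fun i f u => ∑ k, A u i k * pdy k (f u)) η

/-- `(δA)ᵢⱼ = ∂_{yⁱ} Aⱼ - ∂_{yʲ} Aᵢ`. -/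
def deltaV (A : LV1 d) : LV2 d :=
  fun u i j k => pdy i (A u j k) - pdy j (A u i k)

/-- The linear fibrewise vector field `-Γ_{ij}^k yʲ ∂_{yᵏ}`. -/
def conV (Γ : Chris d) (u : Model d) (i : Fin d) (k : Fin d) : Pow d :=
  -∑ j, MvPowerSeries.C (Γ u i j k) * MvPowerSeries.X j

/-- `(∇'A)ᵢⱼ = ∇'ᵢ Aⱼ - ∇'ⱼ Aᵢ`, where `∇'ᵢ X = ∂_{xⁱ} X + [-Γ_{ij}^k yʲ ∂_{yᵏ}, X]`. -/
def nablaV (Γ : Chris d) (A : LV1 d) : LV2 d :=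
  fun u i j k =>
    (pdx i (fun v => A v j k) u + vbracket (conV Γ u i) (A u j) k) -
      (pdx j (fun v => A v i k) u + vbracket (conV Γ u j) (A u i) k)

/-- `½[A, A]`, the `2`-form `(X, Y) ↦ [A(X), A(Y)]`. -/
def halfBracket (A : LV1 d) : LV2 d :=
  fun u i j => vbracket (A u i) (A u j)

/-- The components `R_{ijk}^l` of the curvature, `R(∂ᵢ, ∂ⱼ) ∂ₖ = R_{ijk}^l ∂_l`. -/
def riem (Γ : Chris d) (u : Model d) (i j k l : Fin d) : ℝ :=
  fderiv ℝ (fun v => Γ v j k l) u (stdVec d i) - fderiv ℝ (fun v => Γ v i k l) u (stdVec d j) +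
    ∑ m, (Γ u i m l * Γ u j k m - Γ u j m l * Γ u i k m)

/-- `R^{∇'} = -½ R_{ijk}^l dxⁱ ∧ dxʲ yᵏ ∂_{yˡ}`. -/
def curvV (Γ : Chris d) : LV2 d :=
  fun u i j l => -∑ k, MvPowerSeries.C (riem Γ u i j k l) * MvPowerSeries.X k

/-- `δ⁻¹` on `1`-forms: `i(∂ᵢ)` followed by multiplication by `yⁱ`, the part of degree `p` in `y`
of the form being divided by `p + 1`. -/
def deltaInvV1 (A : LV1 d) (u : Model d) (k : Fin d) : Pow d :=
  ∑ i, MvPowerSeries.X i * scaleInv 1 (A u i k)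

/-- `δ⁻¹` on `2`-forms: `i(∂ⱼ)` followed by multiplication by `yʲ`, the part of degree `p` in `y`
of the form being divided by `p + 2`. -/
def deltaInvV2 (B : LV2 d) : LV1 d :=
  fun u i k => ∑ j, MvPowerSeries.X j * scaleInv 2 (B u j i k)

/-- The right-hand side `δ⁻¹R^{∇'} + δ⁻¹(∇'A + ½[A, A])` of Fedosov's recursion. -/
def fedosovStep (Γ : Chris d) (A : LV1 d) : LV1 d :=
  deltaInvV2 (curvV Γ) + deltaInvV2 (nablaV Γ A + halfBracket A)

/-- The `1`-form obtained from Fedosov's recursion by induction on the degree in `y`: the part of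
degree `N` is read off after `N` steps, from where on it no longer changes. -/
def fedosovLocal (Γ : Chris d) : LV1 d :=
  fun u i k α => MvPowerSeries.coeff α (((fedosovStep Γ)^[α.degree] 0) u i k)

/-- Covariant derivative of a tensor with `n` lower indices and one upper index; the new index
comes first. -/
def covTensor (Γ : Chris d) {n : ℕ} (T : Model d → (Fin n → Fin d) → Fin d → ℝ) :
    Model d → (Fin (n + 1) → Fin d) → Fin d → ℝ :=
  fun u I l =>
    fderiv ℝ (fun v => T v (Fin.tail I) l) u (stdVec d (I 0)) +
      ∑ m, Γ u (I 0) m l * T u (Fin.tail I) m -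
      ∑ a : Fin n, ∑ m, Γ u (I 0) (Fin.tail I a) m * T u (Function.update (Fin.tail I) a m) l

/-- The iterated covariant derivative `∇ᵐR`; the `m` derivative indices come first, then the three
lower indices of the curvature. -/
def covRiem (Γ : Chris d) : (m : ℕ) → Model d → (Fin (3 + m) → Fin d) → Fin d → ℝ
  | 0 => fun u I l => riem Γ u (I 0) (I 1) (I 2) l
  | m + 1 => covTensor Γ (covRiem Γ m)

/-- The first lower index of the curvature in `∇ᵐR`. -/
def riemSlot (m : ℕ) : Fin (3 + m) := ⟨m, by omega⟩

/-- `(∇ᵐR)_{i··}^k y^· ⋯ y^·` as a matrix in `i`, `k`: the first lower index of the curvature is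
`i`, its other two lower indices and all `m` derivative indices are contracted with `y`. -/
def chainFactor (Γ : Chris d) (u : Model d) (m : ℕ) : Matrix (Fin d) (Fin d) (Pow d) :=
  fun i k => ∑ J : Fin (3 + m) → Fin d,
    if J (riemSlot m) = i then
      MvPowerSeries.C (covRiem Γ m u J k) *
        ∏ a ∈ Finset.univ.erase (riemSlot m), (MvPowerSeries.X (J a) : Pow d)
    else 0

/-- The no-loop concatenation
`(∇^{m₁}R)_{i··}^{j₁} (∇^{m₂}R)_{j₁··}^{j₂} ⋯ (∇^{mₛ}R)_{jₛ₋₁··}^k y^· ⋯ y^·`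
attached to the list `[m₁, …, mₛ]`. -/
def chain (Γ : Chris d) (u : Model d) (l : List ℕ) : Matrix (Fin d) (Fin d) (Pow d) :=
  (l.map (chainFactor Γ u)).prod

/-- The Jacobian `(∂φʲ/∂yᵏ)_{jk}` of `φ(x, y)`. -/
def jacY (φ : Model d → Fin d → Pow d) (u : Model d) : Matrix (Fin d) (Fin d) (Pow d) :=
  Matrix.of fun j k => pdy k (φ u j)

/-- The velocity at `t = 0` of `exp_{x(t)}⁻¹ ∘ exp_x`, as a formal series in `y`, along a curve with
`x(0) = u` and `x'(0) = ∂ᵢ`: differentiating `φ(x(t), ψ_t(y)) = φ(x, y)` at `t = 0` gives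
`ψ' = -(∂φ/∂y)⁻¹ ∂φ/∂xⁱ`. -/
def jetVelocity (φ : Model d → Fin d → Pow d) (u : Model d) (i k : Fin d) : Pow d :=
  -∑ j, (jacY φ u)⁻¹ k j * pdx i (fun v => φ v j) u

/-- The exterior extension of `D_{∂ᵢ} s = d/dt s(x(t); exp_{x(t)}⁻¹(exp_x y))`, for `φ` the Taylor
expansion in `y` of `exp_x(y)`. -/
def grothendieckLocal (φ : Model d → Fin d → Pow d) {q : ℕ} (η : LForm d q) : LForm d (q + 1) :=
  wedgeOp (fun i f u => pdx i f u + ∑ k, jetVelocity φ u i k * pdy k (f u)) η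

end Local

/-! ### Manifolds

The charts used are the preferred charts `chartAt p`, `p : M`. An object on `M` is a family of local
expressions, one in each of these charts, obeying the appropriate transformation law. Only the
values on the target of each chart have a meaning. -/

section Manifold

variable {d : ℕ} {M : Type*} [TopologicalSpace M] [ChartedSpace (Model d) M]
  [IsManifold (𝓡 d) ∞ M]

/-- The chart around `p`. -/
abbrev ch (d : ℕ) {M : Type*} [TopologicalSpace M] [ChartedSpace (Model d) M] (p : M) :
    OpenPartialHomeomorph M (Model d) :=
  chartAt (Model d) p

/-- The coordinate vector field `∂ᵢ` of the chart around `p`. -/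
def coordField (d : ℕ) {M : Type*} [TopologicalSpace M] [ChartedSpace (Model d) M]
    [IsManifold (𝓡 d) ∞ M] (p : M) (i : Fin d) (x : M) : TangentSpace (𝓡 d) x :=
  (trivializationAt (Model d) (TangentSpace (𝓡 d)) p).localFrame
    (EuclideanSpace.basisFun (Fin d) ℝ).toBasis i x

/-- The Christoffel symbols in the chart around `p`: `∇_{∂ᵢ} ∂ⱼ = Γ_{ij}^k ∂ₖ`. -/
def christoffel (cov : CovariantDerivative (𝓡 d) (Model d) (TangentSpace (𝓡 d) : M → Type _))
    (p : M) : Chris d :=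
  fun u i j k =>
    (trivializationAt (Model d) (TangentSpace (𝓡 d)) p).localFrameCoeff (𝓡 d)
      (EuclideanSpace.basisFun (Fin d) ℝ).toBasis k ((ch d p).symm u)
      (cov (coordField d p j) ((ch d p).symm u) (coordField d p i ((ch d p).symm u)))

/-- The Jacobian `∂x'ᵏ/∂xⁱ` at `x` of the change from the chart around `p` (coordinates `xⁱ`) to the
chart around `p'` (coordinates `x'ᵏ`). -/
def jac (d : ℕ) {M : Type*} [TopologicalSpace M] [ChartedSpace (Model d) M]
    [IsManifold (𝓡 d) ∞ M] (p p' x : M) (k i : Fin d) : ℝ :=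
  (tangentCoordChange (𝓡 d) p p' x (stdVec d i)) k

/-- `γ` is a geodesic on `[0, 1]`: continuous, and in every chart
`γ''ᵏ = -Γ_{rs}^k γ'ʳ γ'ˢ`. -/
def IsGeodesic (cov : CovariantDerivative (𝓡 d) (Model d) (TangentSpace (𝓡 d) : M → Type _))
    (γ : ℝ → M) : Prop :=
  ContinuousOn γ (Set.Icc 0 1) ∧
    ∀ p : M, ∃ w : ℝ → Model d, ∀ t ∈ Set.Icc (0 : ℝ) 1, γ t ∈ (ch d p).source →
      HasDerivWithinAt (fun τ => ch d p (γ τ)) (w t) (Set.Icc 0 1) t ∧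
      ∀ k, HasDerivWithinAt (fun τ => w τ k)
        (-∑ r, ∑ s, christoffel cov p (ch d p (γ t)) r s k * w t r * w t s) (Set.Icc 0 1) t

open Classical in
/-- The exponential map: `exp_x(y) = γ(1)` for the geodesic `γ` on `[0, 1]` with `γ(0) = x` and
`γ'(0) = y ∈ T_xM` (and the value `x` if there is none). -/
def expMap (cov : CovariantDerivative (𝓡 d) (Model d) (TangentSpace (𝓡 d) : M → Type _))
    (x : M) (y : TangentSpace (𝓡 d) x) : M :=
  if h : ∃ γ : ℝ → M, IsGeodesic cov γ ∧ γ 0 = x ∧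
      HasDerivWithinAt (fun τ => ch d x (γ τ)) (y : Model d) (Set.Icc 0 1) 0
  then h.choose 1 else x

/-- The Taylor expansion `φ(x, y)` at `y = 0` of `exp_x(y)`, in the chart around `p`, where
`x` has coordinates `u` and `y` stands for the tangent vector `yⁱ ∂ᵢ` at `x`. -/
def expJet (cov : CovariantDerivative (𝓡 d) (Model d) (TangentSpace (𝓡 d) : M → Type _))
    (p : M) (u : Model d) (k : Fin d) : Pow d :=
  taylorSeries fun y : Model d =>
    ch d p (expMap cov ((ch d p).symm u)
      (∑ i, y i • coordField d p i ((ch d p).symm u))) k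

/-- `E`-valued forms, as families of local expressions. -/
abbrev FormFam (M : Type*) (d q : ℕ) : Type _ := M → LForm d q

/-- `1`-forms with values in fibrewise vector fields, as families of local expressions. -/
abbrev V1Fam (M : Type*) (d : ℕ) : Type _ := M → LV1 d

/-- `η` is an element of `Ω^q(M, E)`: smooth and alternating components, which transform as
covariant tensors whose values are functions of `y ∈ T_xM`. -/
structure IsEForm {q : ℕ} (η : FormFam M d q) : Prop where
  smooth : ∀ (p : M) (I : Fin q → Fin d) (α : Fin d →₀ ℕ),
    ContDiffOn ℝ ∞ (fun u => MvPowerSeries.coeff α (η p u I)) (ch d p).target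
  alternating : ∀ (p : M), ∀ u ∈ (ch d p).target, ∀ (I : Fin q → Fin d)
    (σ : Equiv.Perm (Fin q)), η p u (I ∘ σ) = ((Equiv.Perm.sign σ : ℤ) : ℝ) • η p u I
  transform : ∀ p p' x : M, x ∈ (ch d p).source → x ∈ (ch d p').source →
    ∀ I : Fin q → Fin d, η p (ch d p x) I =
      ∑ K : Fin q → Fin d, (∏ a, jac d p p' x (K a) (I a)) •
        linSubst (jac d p p' x) (η p' (ch d p' x) K)

/-- `A` is a smooth `1`-form on `M` with values in the fibrewise formal vector fields on `E`. -/
structure IsV1Form (A : V1Fam M d) : Prop where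
  smooth : ∀ (p : M) (i k : Fin d) (α : Fin d →₀ ℕ),
    ContDiffOn ℝ ∞ (fun u => MvPowerSeries.coeff α (A p u i k)) (ch d p).target
  transform : ∀ p p' x : M, x ∈ (ch d p).source → x ∈ (ch d p').source →
    ∀ i l : Fin d, ∑ k, jac d p p' x l k • A p (ch d p x) i k =
      ∑ a, jac d p p' x a i • linSubst (jac d p p' x) (A p' (ch d p' x) a l)

/-- Equality of two objects on `M`: their local expressions agree on the target of each chart. -/
def SameOn {β : Type*} (s t : M → Model d → β) : Prop :=
  ∀ p : M, ∀ u ∈ (ch d p).target, s p u = t p u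

/-- The Grothendieck connection `D^G` on `Ω(M, E)`. -/
def grothendieckD
    (cov : CovariantDerivative (𝓡 d) (Model d) (TangentSpace (𝓡 d) : M → Type _))
    {q : ℕ} (η : FormFam M d q) : FormFam M d (q + 1) :=
  fun p => grothendieckLocal (expJet cov p) (η p)

/-- The operator `-δ + ∇' + A` on `Ω(M, E)`. -/
def connD (cov : CovariantDerivative (𝓡 d) (Model d) (TangentSpace (𝓡 d) : M → Type _))
    (A : V1Fam M d) {q : ℕ} (η : FormFam M d q) : FormFam M d (q + 1) :=
  fun p => -deltaForm (η p) + nablaForm (christoffel cov p) (η p) + actForm (A p) (η p)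

/-- `-δ + ∇' + A` is flat: its square vanishes on `Ω(M, E)`. -/
def IsFlat (cov : CovariantDerivative (𝓡 d) (Model d) (TangentSpace (𝓡 d) : M → Type _))
    (A : V1Fam M d) : Prop :=
  ∀ (q : ℕ) (η : FormFam M d q), IsEForm η →
    SameOn (connD cov A (connD cov A η)) (0 : FormFam M d (q + 2))

/-- `δA = R^{∇'} + ∇'A + ½[A, A]`. -/
def FlatnessEq (cov : CovariantDerivative (𝓡 d) (Model d) (TangentSpace (𝓡 d) : M → Type _))
    (A : V1Fam M d) : Prop :=
  SameOn (fun p => deltaV (A p)) (fun p =>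
    curvV (christoffel cov p) + nablaV (christoffel cov p) (A p) + halfBracket (A p))

/-- `δ⁻¹A = 0`. -/
def DeltaInvZero (A : V1Fam M d) : Prop :=
  SameOn (fun p => deltaInvV1 (A p)) (fun _ _ _ => 0)

/-- Fedosov's equation `A = δ⁻¹R^{∇'} + δ⁻¹(∇'A + ½[A, A])`. -/
def FedosovEq (cov : CovariantDerivative (𝓡 d) (Model d) (TangentSpace (𝓡 d) : M → Type _))
    (A : V1Fam M d) : Prop :=
  SameOn A (fun p => fedosovStep (christoffel cov p) (A p))

/-- The `1`-form of Dolgushev's construction, obtained from Fedosov's equation by induction on the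
degree in `y`. -/
def fedosovForm
    (cov : CovariantDerivative (𝓡 d) (Model d) (TangentSpace (𝓡 d) : M → Type _)) : V1Fam M d :=
  fun p => fedosovLocal (christoffel cov p)

/-- Dolgushev's Fedosov differential `D_F = ∇' - δ + A` on `Ω(M, E)`. -/
def fedosovD (cov : CovariantDerivative (𝓡 d) (Model d) (TangentSpace (𝓡 d) : M → Type _))
    {q : ℕ} (η : FormFam M d q) : FormFam M d (q + 1) :=
  connD cov (fedosovForm cov) η

/-- The components of `A` are the universal no-loop polynomials with coefficients `c`: the part of
degree `N` in `y` of `Aᵢᵏ` is that of the finite linear combination, with coefficients `c N`, of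
concatenations of covariant derivatives of the curvature. -/
def IsUniversalNoLoop (c : ℕ → (List ℕ →₀ ℝ))
    (cov : CovariantDerivative (𝓡 d) (Model d) (TangentSpace (𝓡 d) : M → Type _))
    (A : V1Fam M d) : Prop :=
  ∀ p : M, ∀ u ∈ (ch d p).target, ∀ (i k : Fin d) (α : Fin d →₀ ℕ),
    MvPowerSeries.coeff α (A p u i k) =
      (c α.degree).sum fun l r => r * MvPowerSeries.coeff α (chain (christoffel cov p) u l i k)

end Manifold

end FedosovGrothendieck

end

noncomputable section

namespace FedosovGrothendieck

open TopologicalSpace (Opens)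

/-! ### Homogeneous parts of formal power series -/

section Graded

open MvPowerSeries

variable {d : ℕ}

/-! In a chart, the smooth families of formal power series in y form a commutative ring `Fam U` with
commuting derivations ∂/∂xⁱ and ∂/∂yᵏ. Almost everything is an identity in such a ring, and is
proved for an abstract one (`JetAlg`, `JetConn`). Write E for the Euler operator yᵏ ∂_{yᵏ} and Z for
the geodesic spray.

Fedosov side. The condition δ⁻¹A = 0 means yⁱ Aᵢᵏ = 0. Under it, contracting R + ∇'A + ½[A, A] with
y turns the bracket into a product of matrices, and (*) becomes a matrix Riccati equation (E + 1)A =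
R_y + ∇_y A + A² (`JetConn.contract_flat`, `SmoothConn.step_of_radial`). Here R_y is the curvature
with two indices contracted with y, and ∇_y is the covariant derivative along Z. Each degree of the
right side involves only lower degrees of A, so there is exactly one solution. Since ∇_y is a
derivation of the matrix algebra that sends the contracted ∇ᵐR to the contracted ∇ᵐ⁺¹R (`covZ_mul`,
`factor_succ`), every degree of the solution is a combination of matrix products, with coefficients
obeying a purely numerical recursion (`noLoopCoeff`). These are the chains without loops.

Grothendieck side. The formal exponential map φ = ∑ Zⁿx / n! satisfies Zφ = Eφ. The fields Dᵢ =
∂_{xⁱ} - (∂φ/∂y)⁻¹ ∂φ/∂xⁱ · ∂_y kill φ. As the y-Jacobian of φ is invertible, a vertical field that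
kills φ is zero. Applied to the commutators of the Dᵢ this gives flatness (`flat_of_kill`); applied
to yⁱDᵢ - (Z - E) it gives δ⁻¹A = 0 (`radial_of_kill`). Applying δ⁻¹ to the flatness equation gives
(*), so this A is Fedosov's (`conForm_apply`).

The link with geometry has three parts. First, φ is the Taylor expansion of the true exponential
map, because along a geodesic c the derivative of g(c, c') is (Zg)(c, c') (`hasDerivAt_homEval`,
`isTaylorSeries_phi`, `expJet_eq`). Second, the local forms transform correctly because each
ingredient of the recursion is natural under changes of coordinates (`Z_pull`, `Rel.jacobi`,
`rel_noLoop`). Third, an operator -δ + ∇' + A determines A and its curvature by its values on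
sections that equal yᵏ near a point (`exists_coordSection`, `sameOn_of_connD`, `isFlat_iff`). -/

/-- The part of degree `n` in `y` of `f` vanishes. -/
def VanAt (n : ℕ) (f : Pow d) : Prop :=
  ∀ α : Fin d →₀ ℕ, α.degree = n → coeff α f = 0

namespace VanAt

variable {n : ℕ} {f g : Pow d}

theorem zero (n : ℕ) : VanAt n (0 : Pow d) := fun _ _ => by simp

theorem add (hf : VanAt n f) (hg : VanAt n g) : VanAt n (f + g) := fun α h => by
  simp [hf α h, hg α h]

theorem neg (hf : VanAt n f) : VanAt n (-f) := fun α h => by simp [hf α h]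

theorem sub (hf : VanAt n f) (hg : VanAt n g) : VanAt n (f - g) := fun α h => by
  simp [hf α h, hg α h]

theorem smul (r : ℝ) (hf : VanAt n f) : VanAt n (r • f) := fun α h => by
  simp [hf α h]

theorem sum {ι : Type*} {s : Finset ι} {F : ι → Pow d} (h : ∀ i ∈ s, VanAt n (F i)) :
    VanAt n (∑ i ∈ s, F i) := fun α hα => by
  rw [map_sum]
  exact Finset.sum_eq_zero fun i hi => h i hi α hα

/-- The Cauchy product pairs degrees a and b with a + b = n. The criterion in this shape serves both
homogeneous factors and factors without constant term. -/
theorem mul (h : ∀ a b, a + b = n → VanAt a f ∨ VanAt b g) : VanAt n (f * g) := fun α hα => by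
  classical
  rw [coeff_mul]
  refine Finset.sum_eq_zero fun p hp => ?_
  have hp' : p.1.degree + p.2.degree = n := by
    rw [← hα, ← Finset.HasAntidiagonal.mem_antidiagonal.mp hp, map_add]
  rcases h _ _ hp' with h | h
  · rw [h _ rfl, zero_mul]
  · rw [h _ rfl, mul_zero]

theorem X {a : ℕ} (j : Fin d) (ha : a ≠ 1) : VanAt a (MvPowerSeries.X j : Pow d) := fun α h => by
  classical
  rw [coeff_X, if_neg]
  rintro rfl
  exact ha (by rw [← h]; simp)

theorem C {a : ℕ} (r : ℝ) (ha : a ≠ 0) : VanAt a (MvPowerSeries.C r : Pow d) := fun α h => by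
  classical
  rw [coeff_C, if_neg]
  rintro rfl
  exact ha (by rw [← h]; simp)

theorem X_mul (j : Fin d) (hf : VanAt n f) : VanAt (n + 1) (MvPowerSeries.X j * f) :=
  mul fun a b h => by
    by_cases ha : a = 1
    · right
      have : b = n := by omega
      exact this ▸ hf
    · exact Or.inl (X j ha)

theorem X_mul_zero (j : Fin d) : VanAt 0 (MvPowerSeries.X j * f) :=
  mul fun a b h => Or.inl (X j (by omega))

theorem C_mul (r : ℝ) (hf : VanAt n f) : VanAt n (MvPowerSeries.C r * f) :=
  mul fun a b h => by
    by_cases ha : a = 0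
    · right
      have : b = n := by omega
      exact this ▸ hf
    · exact Or.inl (C r ha)

theorem pdy (k : Fin d) (hf : VanAt (n + 1) f) : VanAt n (pdy k f) := fun α h => by
  rw [FedosovGrothendieck.pdy, coeff_pderiv, hf _ (by simp [h]), zero_mul]

theorem eq_zero (h : ∀ n, VanAt n f) : f = 0 := by
  ext α
  simpa using h _ α rfl

end VanAt

theorem coeff_scaleInv (q : ℕ) (f : Pow d) (α : Fin d →₀ ℕ) :
    coeff α (scaleInv q f) = coeff α f / ((α.degree : ℝ) + q) := rfl

theorem coeff_X_mul_of_ne (j : Fin d) (f : Pow d) (α : Fin d →₀ ℕ) (h : α j ≠ 0) :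
    coeff α (X j * f) = coeff (α - Finsupp.single j 1) f := by
  have : α = Finsupp.single j 1 + (α - Finsupp.single j 1) := by
    ext k
    by_cases hk : j = k
    · subst hk
      simp
      omega
    · simp [hk]
  rw [X]
  conv_lhs => rw [this]
  rw [coeff_add_monomial_mul, one_mul]

theorem coeff_X_mul_of_eq (j : Fin d) (f : Pow d) (α : Fin d →₀ ℕ) (h : α j = 0) :
    coeff α (X j * f) = 0 := by
  classical
  rw [X, coeff_monomial_mul, if_neg]
  intro hle
  have := hle j
  simp [h] at this

/-- Multiplication by yʲ raises the degree by one, so the weight can be applied after it with q in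
place of q + 1. In this way the weight of δ⁻¹ on 2-forms becomes division by one plus the final
degree. -/
theorem X_mul_scaleInv (j : Fin d) (q : ℕ) (f : Pow d) :
    X j * scaleInv (q + 1) f = scaleInv q (X j * f) := by
  ext α
  rw [coeff_scaleInv]
  by_cases h : α j = 0
  · rw [coeff_X_mul_of_eq _ _ _ h, coeff_X_mul_of_eq _ _ _ h, zero_div]
  · rw [coeff_X_mul_of_ne _ _ _ h, coeff_X_mul_of_ne _ _ _ h, coeff_scaleInv]
    congr 1
    have h1 : (α - Finsupp.single j 1).degree + 1 = α.degree := by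
      have : α = (α - Finsupp.single j 1) + Finsupp.single j 1 := by
        ext k
        by_cases hk : j = k
        · subst hk
          simp
          omega
        · simp [hk]
      conv_rhs => rw [this]
      rw [map_add]
      simp
    rw [← h1]
    push_cast
    ring

/-- The Euler operator multiplies the part of degree `n` by `n`. -/
theorem coeff_euler (f : Pow d) (α : Fin d →₀ ℕ) :
    coeff α (∑ j, X j * pdy j f) = (α.degree : ℝ) * coeff α f := by
  rw [map_sum]
  have : ∀ j ∈ Finset.univ, coeff α (X j * pdy j f) = (α j : ℝ) * coeff α f := by
    intro j _
    by_cases h : α j = 0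
    · rw [coeff_X_mul_of_eq _ _ _ h, h]
      simp
    · rw [coeff_X_mul_of_ne _ _ _ h, pdy, coeff_pderiv]
      have h1 : α - Finsupp.single j 1 + Finsupp.single j 1 = α := by
        ext k
        by_cases hk : j = k
        · subst hk
          simp
          omega
        · simp [hk]
      rw [h1, mul_comm]
      congr 1
      have : (α - Finsupp.single j 1 : Fin d →₀ ℕ) j + 1 = α j := by simp; omega
      exact_mod_cast this
  rw [Finset.sum_congr rfl this, ← Finset.sum_mul]
  congr 1
  rw [Finsupp.degree_eq_sum]
  push_cast
  rfl

theorem pdy_comm (k l : Fin d) (f : Pow d) : pdy k (pdy l f) = pdy l (pdy k f) := by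
  ext α
  simp only [pdy, coeff_pderiv]
  rw [add_right_comm]
  by_cases h : k = l
  · subst h; ring
  · simp [h, Ne.symm h]
    ring

end Graded

/-! ### The ring of smooth families of formal power series -/

section Families

variable {d : ℕ}

/-- The coefficients of `f` are smooth functions on `U`. -/
def SmoothFamOn (U : Set (Model d)) (f : Model d → Pow d) : Prop :=
  ∀ α, ContDiffOn ℝ ∞ (fun u => MvPowerSeries.coeff α (f u)) U

namespace SmoothFamOn

variable {U : Set (Model d)} {f g : Model d → Pow d}

theorem congr (hf : SmoothFamOn U f) (h : ∀ u ∈ U, g u = f u) : SmoothFamOn U g := fun α =>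
  (hf α).congr fun u hu => by rw [h u hu]

theorem add (hf : SmoothFamOn U f) (hg : SmoothFamOn U g) : SmoothFamOn U (fun u => f u + g u) :=
  fun α => by
    simp only [map_add]
    exact (hf α).add (hg α)

theorem mul (hf : SmoothFamOn U f) (hg : SmoothFamOn U g) : SmoothFamOn U (fun u => f u * g u) :=
  fun α => by
    classical
    simp only [MvPowerSeries.coeff_mul]
    exact ContDiffOn.sum fun p _ => (hf _).mul (hg _)

theorem const (a : Pow d) : SmoothFamOn U (fun _ => a) := fun _ => contDiffOn_const

theorem C {h : Model d → ℝ} (hh : ContDiffOn ℝ ∞ h U) :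
    SmoothFamOn U (fun u => MvPowerSeries.C (h u)) := fun α => by
  classical
  simp only [MvPowerSeries.coeff_C]
  split_ifs
  · exact hh
  · exact contDiffOn_const

theorem pdy (k : Fin d) (hf : SmoothFamOn U f) : SmoothFamOn U (fun u => pdy k (f u)) := fun α => by
  simp only [FedosovGrothendieck.pdy, MvPowerSeries.coeff_pderiv]
  exact (hf _).mul contDiffOn_const

theorem scaleInv (q : ℕ) (hf : SmoothFamOn U f) : SmoothFamOn U (fun u => scaleInv q (f u)) :=
  fun α => by
    simp only [coeff_scaleInv]
    exact (hf _).div_const _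

theorem pdx (hU : IsOpen U) (i : Fin d) (hf : SmoothFamOn U f) : SmoothFamOn U (pdx i f) :=
  fun α => ((hf α).fderiv_of_isOpen hU (m := ∞) (by simp)).clm_apply contDiffOn_const

/-- Each coefficient of an inverse is a polynomial in coefficients of f, in coefficients of the
inverse of smaller degree and in the reciprocal of the constant term, so smoothness follows by
induction on the degree. -/
theorem inv (hf : SmoothFamOn U f) (h1 : ∀ u ∈ U, MvPowerSeries.constantCoeff (f u) ≠ 0) :
    SmoothFamOn U (fun u => (f u)⁻¹) := by
  classical
  have h0 : ContDiffOn ℝ ∞ (fun u => (MvPowerSeries.constantCoeff (f u))⁻¹) U := by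
    refine ContDiffOn.inv ?_ h1
    simpa using hf 0
  suffices ∀ n : ℕ, ∀ α : Fin d →₀ ℕ, α.degree < n →
      ContDiffOn ℝ ∞ (fun u => MvPowerSeries.coeff α (f u)⁻¹) U from
    fun α => this _ α (Nat.lt_succ_self _)
  intro n
  induction n with
  | zero => intro α h; omega
  | succ n ih =>
    intro α hα
    by_cases h : α = 0
    · refine h0.congr fun u _ => ?_
      rw [MvPowerSeries.coeff_inv, if_pos h]
    · refine ContDiffOn.congr ?_ fun u _ => (MvPowerSeries.coeff_inv α (f u)).trans (if_neg h)
      refine h0.neg.mul (ContDiffOn.sum fun p hp => ?_)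
      split_ifs with hlt
      · refine (hf _).mul (ih _ ?_)
        have hp' : p.1.degree + p.2.degree = α.degree := by
          rw [← Finset.HasAntidiagonal.mem_antidiagonal.mp hp, map_add]
        have : p.1.degree ≠ 0 := by
          intro h0
          rw [Finsupp.degree_eq_zero_iff] at h0
          have := Finset.HasAntidiagonal.mem_antidiagonal.mp hp
          rw [h0, zero_add] at this
          exact hlt.ne this
        omega
      · exact contDiffOn_const

end SmoothFamOn

/-- Extension by zero. -/
def extd {U : Opens (Model d)} (f : U → Pow d) : Model d → Pow d :=
  open Classical in fun v => if h : v ∈ U then f ⟨v, h⟩ else 0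

theorem extd_apply {U : Opens (Model d)} (f : U → Pow d) (u : U) : extd f u = f u := by
  simp [extd]

/-- The algebra of smooth families of formal power series over `U`. -/
def smoothFam (U : Opens (Model d)) : Subalgebra ℝ (U → Pow d) where
  -- Elements live on U only, so that agreement on U is equality in the ring. The extension by zero
  -- is there because derivatives are taken of functions on the whole model space; as U is open, its
  -- values outside do not matter.
  carrier := {f : U → Pow d | SmoothFamOn (U : Set (Model d)) (extd f)}
  mul_mem' {f g} hf hg := SmoothFamOn.congr (f := fun u => extd f u * extd g u)
    (SmoothFamOn.mul hf hg) fun u hu => by simp [extd, show u ∈ U from hu]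
  add_mem' {f g} hf hg := SmoothFamOn.congr (f := fun u => extd f u + extd g u)
    (SmoothFamOn.add hf hg) fun u hu => by simp [extd, show u ∈ U from hu]
  algebraMap_mem' r := (SmoothFamOn.const (MvPowerSeries.C r)).congr fun u hu => by
    simp only [extd, show u ∈ U from hu, dite_true]
    rfl

/-- Smooth families of formal power series over `U`. -/
abbrev Fam (U : Opens (Model d)) : Type := smoothFam U

namespace Fam

variable {U : Opens (Model d)}

instance : CoeFun (Fam U) fun _ => U → Pow d := ⟨fun f => f.1⟩

theorem ext' {f g : Fam U} (h : ∀ u : U, f u = g u) : f = g := Subtype.ext (funext h)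

/-- The restriction of a smooth family to `U`. -/
def res (F : Model d → Pow d) (h : SmoothFamOn U F) : Fam U :=
  ⟨fun u => F u, h.congr fun u hu => by simp [extd, show u ∈ U from hu]⟩

@[simp] theorem res_apply (F : Model d → Pow d) (h : SmoothFamOn U F) (u : U) : res F h u = F u :=
  rfl

@[simp] theorem add_apply (f g : Fam U) (u : U) : (f + g) u = f u + g u := rfl
@[simp] theorem sub_apply (f g : Fam U) (u : U) : (f - g) u = f u - g u := rfl
@[simp] theorem mul_apply (f g : Fam U) (u : U) : (f * g) u = f u * g u := rfl
@[simp] theorem neg_apply (f : Fam U) (u : U) : (-f) u = -f u := rfl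
@[simp] theorem zero_apply (u : U) : (0 : Fam U) u = 0 := rfl
@[simp] theorem one_apply (u : U) : (1 : Fam U) u = 1 := rfl
@[simp] theorem smul_apply (r : ℝ) (f : Fam U) (u : U) : (r • f) u = r • f u := rfl

/-- Evaluation at a point of `U`. -/
def eval (u : U) : Fam U →+* Pow d := (Pi.evalRingHom _ u).comp (smoothFam U).subtype

theorem eval_apply (u : U) (f : Fam U) : eval u f = f u := rfl

@[simp] theorem sum_apply {ι : Type*} (s : Finset ι) (F : ι → Fam U) (u : U) :
    (∑ i ∈ s, F i) u = ∑ i ∈ s, F i u := map_sum (eval u) F s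

@[simp] theorem prod_apply {ι : Type*} (s : Finset ι) (F : ι → Fam U) (u : U) :
    (∏ i ∈ s, F i) u = ∏ i ∈ s, F i u := map_prod (eval u) F s

theorem smooth (f : Fam U) : SmoothFamOn U (extd f.1) := f.2

/-- A smooth function on `U` as a family of constant power series. -/
def C (h : Model d → ℝ) (hh : ContDiffOn ℝ ∞ h U) : Fam U := res _ (SmoothFamOn.C hh)

@[simp] theorem C_apply (h : Model d → ℝ) (hh : ContDiffOn ℝ ∞ h U) (u : U) :
    C h hh u = MvPowerSeries.C (h u) := rfl

/-- The coordinate `yʲ`. -/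
def X (j : Fin d) : Fam U := res _ (SmoothFamOn.const (MvPowerSeries.X j))

@[simp] theorem X_apply (j : Fin d) (u : U) : (X j : Fam U) u = MvPowerSeries.X j := rfl

theorem differentiableAt {f : Model d → Pow d} (hf : SmoothFamOn U f) (u : U) (α : Fin d →₀ ℕ) :
    DifferentiableAt ℝ (fun v => MvPowerSeries.coeff α (f v)) u :=
  ((hf α).contDiffAt (U.isOpen.mem_nhds u.2)).differentiableAt (by simp)

theorem pdx_congr {F G : Model d → Pow d} (h : ∀ u ∈ U, F u = G u) (i : Fin d) (u : U) :
    pdx i F u = pdx i G u := by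
  funext α
  have : (fun v => MvPowerSeries.coeff α (F v)) =ᶠ[nhds (u : Model d)]
      fun v => MvPowerSeries.coeff α (G v) := by
    filter_upwards [U.isOpen.mem_nhds u.2] with v hv
    rw [h v hv]
  simp only [pdx, this.fderiv_eq]

theorem coeff_pdx (i : Fin d) (f : Model d → Pow d) (u : Model d) (α : Fin d →₀ ℕ) :
    MvPowerSeries.coeff α (pdx i f u) =
      fderiv ℝ (fun v => MvPowerSeries.coeff α (f v)) u (stdVec d i) := rfl

/-- `∂/∂xⁱ` as a derivation of smooth families. -/
def dx (i : Fin d) : Derivation ℝ (Fam U) (Fam U) :=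
  Derivation.mk'
    { toFun := fun f => res (pdx i (extd f.1)) (f.smooth.pdx U.isOpen i)
      map_add' := fun f g => ext' fun u => by
        ext α
        simp only [res_apply, add_apply, map_add]
        rw [pdx_congr (G := fun v => extd f.1 v + extd g.1 v)
          (fun v hv => by simp [extd, hv])]
        simp only [coeff_pdx, map_add]
        rw [fderiv_fun_add (differentiableAt f.smooth u α) (differentiableAt g.smooth u α)]
        rfl
      map_smul' := fun r f => ext' fun u => by
        ext α
        simp only [res_apply, smul_apply, RingHom.id_apply, MvPowerSeries.coeff_smul]
        rw [pdx_congr (G := fun v => r • extd f.1 v)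
          (fun v hv => by simp [extd, hv])]
        simp only [coeff_pdx, MvPowerSeries.coeff_smul]
        rw [fderiv_const_mul (differentiableAt f.smooth u α)]
        rfl }
    fun f g => ext' fun u => by
      classical
      ext α
      simp only [LinearMap.coe_mk, AddHom.coe_mk, smul_eq_mul, add_apply, mul_apply, res_apply,
        map_add]
      rw [pdx_congr (G := fun v => extd f.1 v * extd g.1 v)
        (fun v hv => by simp [extd, hv]), mul_comm (g u)]
      simp only [coeff_pdx, MvPowerSeries.coeff_mul]
      rw [fderiv_fun_sum fun p _ => (differentiableAt f.smooth u p.1).fun_mul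
        (differentiableAt g.smooth u p.2)]
      rw [_root_.sum_apply, ← Finset.sum_add_distrib]
      refine Finset.sum_congr rfl fun p _ => ?_
      rw [fderiv_fun_mul (differentiableAt f.smooth u p.1) (differentiableAt g.smooth u p.2)]
      simp only [_root_.add_apply, _root_.smul_apply, smul_eq_mul,
        extd_apply]
      ring

theorem dx_apply (i : Fin d) (f : Fam U) (u : U) : dx i f u = pdx i (extd f.1) u := rfl

theorem dx_apply' (i : Fin d) (f : Fam U) {F : Model d → Pow d} (h : ∀ u : U, f u = F u) (u : U) :
    dx i f u = pdx i F u :=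
  pdx_congr (fun v hv => by rw [← h ⟨v, hv⟩]; exact extd_apply f.1 ⟨v, hv⟩) i u

@[simp] theorem dx_res (i : Fin d) (F : Model d → Pow d) (h : SmoothFamOn U F) (u : U) :
    dx i (res F h) u = pdx i F u := dx_apply' i _ (fun _ => rfl) u

/-- `∂/∂yᵏ` as a derivation of smooth families. -/
def dy (k : Fin d) : Derivation ℝ (Fam U) (Fam U) :=
  Derivation.mk'
    { toFun := fun f => res (fun u => pdy k (extd f.1 u)) (f.smooth.pdy k)
      map_add' := fun f g => ext' fun u => by
        simp only [res_apply, add_apply, extd_apply]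
        exact map_add (MvPowerSeries.pderiv ℝ k) _ _
      map_smul' := fun r f => ext' fun u => by
        simp only [res_apply, smul_apply, extd_apply]
        exact (MvPowerSeries.pderiv ℝ k).map_smul _ _ }
    fun f g => ext' fun u => by
      simp only [LinearMap.coe_mk, AddHom.coe_mk, smul_eq_mul, add_apply, mul_apply, res_apply,
        extd_apply]
      exact Derivation.leibniz (MvPowerSeries.pderiv ℝ k) _ _

@[simp] theorem dy_apply (k : Fin d) (f : Fam U) (u : U) : dy k f u = pdy k (f u) := by
  change pdy k (extd f.1 u) = _
  rw [extd_apply]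

theorem dy_comm (k l : Fin d) (f : Fam U) : dy k (dy l f) = dy l (dy k f) :=
  ext' fun u => by simp only [dy_apply, pdy_comm k l]

theorem dx_dy (i k : Fin d) (f : Fam U) : dx i (dy k f) = dy k (dx i f) := ext' fun u => by
  rw [dx_apply' i (dy k f) (F := fun v => pdy k (extd f.1 v))
    fun v => by rw [dy_apply, extd_apply], dy_apply, dx_apply]
  ext α
  simp only [coeff_pdx, pdy, MvPowerSeries.coeff_pderiv]
  rw [fderiv_mul_const (differentiableAt f.smooth u _)]
  simp [mul_comm]

theorem dx_comm (i j : Fin d) (f : Fam U) : dx i (dx j f) = dx j (dx i f) := ext' fun u => by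
  have key : ∀ (i j : Fin d) (α : Fin d →₀ ℕ), MvPowerSeries.coeff α (dx i (dx j f) u) =
      fderiv ℝ (fderiv ℝ (fun v => MvPowerSeries.coeff α (extd f.1 v))) u (stdVec d i)
        (stdVec d j) := by
    intro i j α
    rw [dx_apply' i (dx j f) (F := pdx j (extd f.1)) fun v => rfl, coeff_pdx]
    simp only [coeff_pdx]
    rw [fderiv_clm_apply _ (differentiableAt_const _)]
    · simp
    · exact (((f.smooth α).fderiv_of_isOpen U.isOpen (m := ∞) (by simp)).contDiffAt
        (U.isOpen.mem_nhds u.2)).differentiableAt (by simp)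
  ext α
  rw [key, key]
  exact (((f.smooth α).contDiffAt (U.isOpen.mem_nhds u.2)).isSymmSndFDerivAt
    (by simp only [minSmoothness_of_isRCLikeNormedField]; exact WithTop.coe_le_coe.2 le_top)).eq _ _

@[simp] theorem dx_X (i j : Fin d) : dx i (X j : Fam U) = 0 := ext' fun u => by
  ext α
  rw [X, dx_res, coeff_pdx]
  simp

theorem dy_X (k j : Fin d) : dy k (X j : Fam U) = if j = k then 1 else 0 := ext' fun u => by
  classical
  rw [dy_apply, X_apply, pdy, MvPowerSeries.pderiv_X, Pi.single_apply]
  split_ifs <;> rfl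

@[simp] theorem dy_C (k : Fin d) (h : Model d → ℝ) (hh : ContDiffOn ℝ ∞ h U) :
    dy k (C h hh) = 0 := ext' fun u => by
  rw [dy_apply, C_apply, pdy, MvPowerSeries.pderiv_C]
  rfl

theorem contDiffOn_partial {h : Model d → ℝ} (hh : ContDiffOn ℝ ∞ h U) (i : Fin d) :
    ContDiffOn ℝ ∞ (fun u => fderiv ℝ h u (stdVec d i)) U :=
  (hh.fderiv_of_isOpen U.isOpen (m := ∞) (by simp)).clm_apply contDiffOn_const

theorem dx_C (i : Fin d) (h : Model d → ℝ) (hh : ContDiffOn ℝ ∞ h U) :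
    dx i (C h hh) = C _ (contDiffOn_partial hh i) := ext' fun u => by
  classical
  ext α
  rw [C, dx_res, coeff_pdx, C_apply]
  simp only [MvPowerSeries.coeff_C]
  split_ifs <;> simp

/-- Multiplication of the part of degree `p` by `1 / (p + q)`. -/
def scale (q : ℕ) (f : Fam U) : Fam U :=
  res (fun u => scaleInv q (extd f.1 u)) (f.smooth.scaleInv q)

@[simp] theorem scale_apply (q : ℕ) (f : Fam U) (u : U) : scale q f u = scaleInv q (f u) := by
  simp [scale, extd_apply]

theorem isUnit_of_constantCoeff (f : Fam U)
    (h : ∀ u : U, MvPowerSeries.constantCoeff (f u) ≠ 0) : IsUnit f := by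
  refine IsUnit.of_mul_eq_one (res _ (f.smooth.inv fun u hu => ?_)) (ext' fun u => ?_)
  · simpa [extd, show u ∈ U from hu] using h ⟨u, hu⟩
  · rw [mul_apply, res_apply, extd_apply, MvPowerSeries.mul_inv_cancel _ (h u), one_apply]

/-- The part of degree `n` in `y` vanishes at every point. -/
def Van (n : ℕ) (f : Fam U) : Prop := ∀ u : U, VanAt n (f u)

namespace Van

variable {n : ℕ} {f g : Fam U}

theorem zero (n : ℕ) : Van n (0 : Fam U) := fun _ => VanAt.zero n
theorem add (hf : Van n f) (hg : Van n g) : Van n (f + g) := fun u => (hf u).add (hg u)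
theorem neg (hf : Van n f) : Van n (-f) := fun u => (hf u).neg
theorem sub (hf : Van n f) (hg : Van n g) : Van n (f - g) := fun u => (hf u).sub (hg u)
theorem smul (r : ℝ) (hf : Van n f) : Van n (r • f) := fun u => (hf u).smul r

theorem sum {ι : Type*} {s : Finset ι} {F : ι → Fam U} (h : ∀ i ∈ s, Van n (F i)) :
    Van n (∑ i ∈ s, F i) := fun u => by
  rw [sum_apply]
  exact VanAt.sum fun i hi => h i hi u

theorem mul (h : ∀ a b, a + b = n → Van a f ∨ Van b g) : Van n (f * g) := fun u =>
  VanAt.mul fun a b hab => (h a b hab).imp (fun h => h u) (fun h => h u)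

theorem X {a : ℕ} (j : Fin d) (ha : a ≠ 1) : Van a (Fam.X j : Fam U) := fun _ => VanAt.X j ha

theorem C {a : ℕ} (h : Model d → ℝ) (hh : ContDiffOn ℝ ∞ h U) (ha : a ≠ 0) :
    Van a (Fam.C h hh) := fun _ => VanAt.C _ ha

theorem X_mul (j : Fin d) (hf : Van n f) : Van (n + 1) (Fam.X j * f) := fun u => (hf u).X_mul j

theorem X_mul_zero (j : Fin d) : Van 0 (Fam.X j * f) := fun _ => VanAt.X_mul_zero j

theorem dy (k : Fin d) (hf : Van (n + 1) f) : Van n (dy k f) := fun u => by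
  rw [dy_apply]
  exact (hf u).pdy k

/-- A coefficient that vanishes on all of the open set U has zero x-derivatives there, so ∂/∂xⁱ
respects degrees. -/
theorem dx (i : Fin d) (hf : Van n f) : Van n (dx i f) := fun u α hα => by
  rw [dx_apply, coeff_pdx]
  have : (fun v => MvPowerSeries.coeff α (extd f.1 v)) =ᶠ[nhds (u : Model d)] fun _ => 0 := by
    filter_upwards [U.isOpen.mem_nhds u.2] with v hv
    rw [← hf ⟨v, hv⟩ α hα]
    simp [extd, show v ∈ U from hv]
  rw [this.fderiv_eq]
  simp

theorem eq_zero (h : ∀ n, Van n f) : f = 0 := ext' fun u => VanAt.eq_zero fun n => h n u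

end Van

end Fam

end Families

/-! ### Vertical and horizontal calculus over a commutative ring -/

/-- A commutative algebra with commuting derivations `∂/∂xⁱ`, `∂/∂yᵏ` and coordinates `yʲ`. -/
structure JetAlg (d : ℕ) (R : Type*) [CommRing R] [Algebra ℝ R] where
  dx : Fin d → Derivation ℝ R R
  dy : Fin d → Derivation ℝ R R
  X : Fin d → R
  dx_comm : ∀ i j f, dx i (dx j f) = dx j (dx i f)
  dx_dy : ∀ i k f, dx i (dy k f) = dy k (dx i f)
  dy_comm : ∀ k l f, dy k (dy l f) = dy l (dy k f)
  dx_X : ∀ i j, dx i (X j) = 0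
  dy_X : ∀ k j, dy k (X j) = if j = k then 1 else 0

/-- A symmetric connection over a `JetAlg`, with coefficients `Γ i j k` independent of `y`. -/
structure JetConn (d : ℕ) (R : Type*) [CommRing R] [Algebra ℝ R] extends JetAlg d R where
  Γ : Fin d → Fin d → Fin d → R
  symm : ∀ i j k, Γ i j k = Γ j i k
  dy_Γ : ∀ l i j k, dy l (Γ i j k) = 0

theorem derivation_sum_apply {R ι : Type*} [CommRing R] [Algebra ℝ R] (s : Finset ι)
    (E : ι → Derivation ℝ R R) (f : R) : (∑ i ∈ s, E i) f = ∑ i ∈ s, E i f := by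
  classical
  induction s using Finset.induction_on with
  | empty => simp
  | insert i s hi ih => rw [Finset.sum_insert hi, Finset.sum_insert hi, Derivation.add_apply, ih]

namespace JetAlg

variable {d : ℕ} {R : Type*} [CommRing R] [Algebra ℝ R] (S : JetAlg d R)

/-- The bracket of vertical vector fields. -/
def bracket (V W : Fin d → R) (k : Fin d) : R :=
  ∑ l, (V l * S.dy l (W k) - W l * S.dy l (V k))

/-- `∂ᵢ + Vᵢᵏ ∂_{yᵏ}`. -/
def D (V : Fin d → Fin d → R) (i : Fin d) : Derivation ℝ R R :=
  S.dx i + ∑ k, V i k • S.dy k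

theorem D_apply (V : Fin d → Fin d → R) (i : Fin d) (f : R) :
    S.D V i f = S.dx i f + ∑ k, V i k * S.dy k f := by
  simp [D, derivation_sum_apply]

/-- The terms of second order in f are symmetric in i and j, since the coordinate derivations
commute. What survives is vertical: its components are the curvature of V. -/
theorem D_comm (V : Fin d → Fin d → R) (i j : Fin d) (f : R) :
    S.D V i (S.D V j f) - S.D V j (S.D V i f) =
      ∑ k, (S.D V i (V j k) - S.D V j (V i k)) * S.dy k f := by
  have key : ∀ i j, S.D V i (S.D V j f) = S.dx i (S.dx j f) +
      ∑ l, V i l * S.dx j (S.dy l f) + ∑ k, V j k * S.dx i (S.dy k f) +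
      ∑ k, ∑ l, V j k * (V i l * S.dy l (S.dy k f)) + ∑ k, S.D V i (V j k) * S.dy k f := by
    intro i j
    rw [S.D_apply V j f, map_add, map_sum]
    simp only [Derivation.leibniz, smul_eq_mul]
    rw [S.D_apply V i (S.dx j f)]
    simp only [S.D_apply V i (S.dy _ f), mul_add, Finset.mul_sum, Finset.sum_add_distrib]
    rw [Finset.sum_congr rfl fun l _ => by rw [← S.dx_dy j l]]
    simp only [mul_comm (S.dy _ f) _]
    ring
  rw [key i j, key j i, S.dx_comm i j]
  have : ∑ k, ∑ l, V j k * (V i l * S.dy l (S.dy k f)) =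
      ∑ k, ∑ l, V i k * (V j l * S.dy l (S.dy k f)) := by
    rw [Finset.sum_comm]
    refine Finset.sum_congr rfl fun k _ => Finset.sum_congr rfl fun l _ => ?_
    rw [S.dy_comm]
    ring
  rw [this]
  simp only [sub_mul, Finset.sum_sub_distrib]
  ring

theorem sum_mul_dy_X (c : Fin d → R) (k : Fin d) : ∑ j, c j * S.dy k (S.X j) = c k := by
  simp [S.dy_X]

theorem sum_mul_dy_X' (c : Fin d → R) (j : Fin d) : ∑ k, c k * S.dy k (S.X j) = c j := by
  simp [S.dy_X]

/-- `(δA)ᵢⱼ`. -/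
def delta (A : Fin d → Fin d → R) (i j k : Fin d) : R := S.dy i (A j k) - S.dy j (A i k)

/-- `y`-contraction of `δA`. -/
theorem contract_delta (A : Fin d → Fin d → R) (hA : ∀ k, ∑ i, S.X i * A i k = 0) (i k : Fin d) :
    ∑ j, S.X j * S.delta A j i k = ∑ j, S.X j * S.dy j (A i k) + A i k := by
  -- Differentiating yʲ Aⱼᵏ = 0 by yⁱ trades the second half of δA for A itself, which leaves the
  -- Euler operator plus one.
  have h := congrArg (S.dy i) (hA k)
  rw [map_sum, map_zero] at h
  simp only [Derivation.leibniz, smul_eq_mul, Finset.sum_add_distrib] at h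
  rw [S.sum_mul_dy_X] at h
  simp only [delta, mul_sub, Finset.sum_sub_distrib]
  linear_combination -h

end JetAlg

namespace JetConn

variable {d : ℕ} {R : Type*} [CommRing R] [Algebra ℝ R] (S : JetConn d R)

/-- `-Γ_{ij}^k yʲ`. -/
def conn (i k : Fin d) : R := -∑ j, S.Γ i j k * S.X j

/-- The components of the curvature. -/
def riem (i j k l : Fin d) : R :=
  S.dx i (S.Γ j k l) - S.dx j (S.Γ i k l) +
    ∑ m, (S.Γ i m l * S.Γ j k m - S.Γ j m l * S.Γ i k m)

/-- `-R_{ijk}^l yᵏ`. -/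
def curv (i j l : Fin d) : R := -∑ k, S.riem i j k l * S.X k

/-- `(∇'A)ᵢⱼ`. -/
def nabla (A : Fin d → Fin d → R) (i j k : Fin d) : R :=
  (S.dx i (A j k) + S.bracket (S.conn i) (A j) k) -
    (S.dx j (A i k) + S.bracket (S.conn j) (A i) k)

theorem dy_conn (l i k : Fin d) : S.dy l (S.conn i k) = -S.Γ i l k := by
  simp only [conn, map_neg, map_sum, Derivation.leibniz, smul_eq_mul, S.dy_Γ, mul_zero, add_zero]
  rw [S.sum_mul_dy_X (fun j => S.Γ i j k)]

/-- R^{∇'} is the curvature of the linear vertical connection `conn`: the bracket of two fields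
linear in y produces the quadratic Christoffel terms of `riem`. -/
theorem curv_eq (i j k : Fin d) :
    S.curv i j k = S.dx i (S.conn j k) - S.dx j (S.conn i k) +
      S.bracket (S.conn i) (S.conn j) k := by
  have h1 : ∀ i j, S.dx i (S.conn j k) = -∑ m, S.dx i (S.Γ j m k) * S.X m := by
    intro i j
    simp only [conn, map_neg, map_sum, Derivation.leibniz, smul_eq_mul, S.dx_X, mul_zero, zero_add]
    congr 1
    exact Finset.sum_congr rfl fun m _ => mul_comm _ _
  have h2 : ∀ i j, ∑ l, S.conn i l * S.dy l (S.conn j k) =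
      ∑ m, (∑ l, S.Γ j l k * S.Γ i m l) * S.X m := by
    intro i j
    simp only [dy_conn]
    simp only [conn, neg_mul_neg, Finset.sum_mul]
    rw [Finset.sum_comm]
    refine Finset.sum_congr rfl fun m _ => Finset.sum_congr rfl fun l _ => ?_
    ring
  rw [JetAlg.bracket, Finset.sum_sub_distrib, h1, h1, h2, h2, curv]
  simp only [riem, add_mul, sub_mul, Finset.sum_sub_distrib, Finset.sum_add_distrib]
  ring

/-- The curvature of `-δ + ∇' + A`. -/
theorem curvature_eq (A V : Fin d → Fin d → R)
    (hV : ∀ i k, V i k = -(if i = k then 1 else 0) + S.conn i k + A i k) (i j k : Fin d) :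
    S.D V i (V j k) - S.D V j (V i k) =
      S.curv i j k + S.nabla A i j k + S.bracket (A i) (A j) k - S.delta A i j k := by
  have h0 : ∀ (i k : Fin d) (E : Derivation ℝ R R), E (if i = k then (1 : R) else 0) = 0 := by
    intro i k E
    split_ifs
    · exact E.map_one_eq_zero
    · exact map_zero _
  have h1 : ∀ i j, S.D V i (V j k) = S.dx i (S.conn j k) + S.dx i (A j k) +
      (S.Γ j i k - S.dy i (A j k) + ∑ l, S.conn i l * S.dy l (S.conn j k) +
        ∑ l, S.conn i l * S.dy l (A j k) + ∑ l, A i l * S.dy l (S.conn j k) +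
        ∑ l, A i l * S.dy l (A j k)) := by
    intro i j
    rw [JetAlg.D_apply, hV j k]
    simp only [map_add, map_neg, h0, neg_zero, zero_add]
    congr 1
    have : ∀ l, V i l * (S.dy l (S.conn j k) + S.dy l (A j k)) =
        -(if i = l then S.dy l (S.conn j k) + S.dy l (A j k) else 0) +
        (S.conn i l * S.dy l (S.conn j k) + S.conn i l * S.dy l (A j k) +
        A i l * S.dy l (S.conn j k) + A i l * S.dy l (A j k)) := by
      intro l
      rw [hV i l]
      split_ifs <;> ring
    rw [Finset.sum_congr rfl fun l _ => this l]
    simp only [Finset.sum_add_distrib, Finset.sum_neg_distrib, Finset.sum_ite_eq,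
      Finset.mem_univ, if_true]
    rw [S.dy_conn i j k]
    ring
  -- The terms Γⱼᵢᵏ and Γᵢⱼᵏ, which come from δ meeting the connection part, cancel by symmetry:
  -- this is where vanishing torsion enters.
  rw [h1, h1, S.symm j i, curv_eq, nabla, JetAlg.delta]
  simp only [JetAlg.bracket, Finset.sum_sub_distrib]
  ring

/-! ### The geodesic spray and the Riccati form of Fedosov's equation -/

/-- `N_i^k = yʲ Γ_{ji}^k`. -/
def N : Matrix (Fin d) (Fin d) R := fun i k => ∑ j, S.X j * S.Γ j i k

/-- The geodesic spray `yʲ (∂_{xʲ} - Γ_{jm}^k yᵐ ∂_{yᵏ})`. -/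
def Z : Derivation ℝ R R := ∑ j, S.X j • S.dx j + ∑ l, (∑ j, S.X j * S.conn j l) • S.dy l

theorem Z_apply (f : R) :
    S.Z f = ∑ j, S.X j * S.dx j f + ∑ l, (∑ j, S.X j * S.conn j l) * S.dy l f := by
  simp [Z, derivation_sum_apply]

/-- The covariant derivative in the direction `y` of a matrix `B_i^k`. -/
def covZ (B : Matrix (Fin d) (Fin d) R) : Matrix (Fin d) (Fin d) R :=
  B.map S.Z + B * S.N - S.N * B

/-- `R_{i··}^k y^· y^·`. -/
def jacobi : Matrix (Fin d) (Fin d) R := fun i k => ∑ j, ∑ m, S.X j * S.X m * S.riem i j m k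

theorem riem_antisymm (i j k l : Fin d) : S.riem i j k l = -S.riem j i k l := by
  simp only [riem, Finset.sum_sub_distrib]
  ring

/-- The relation yʲ Aⱼᵏ = 0 removes the terms in which the contracted Aⱼ differentiates, and its
derivative yʲ ∂_{yˡ} Aⱼᵏ = -Aₗᵏ replaces those in which it is differentiated by A itself. So ½[A, A]
becomes the matrix square of A and ∇'A its covariant derivative along the spray. The absence of
loops has its origin here. -/
theorem contract_flat (A : Matrix (Fin d) (Fin d) R) (hA : ∀ k, ∑ i, S.X i * A i k = 0)
    (i k : Fin d) :
    ∑ j, S.X j * (S.curv j i k + S.nabla A j i k + S.bracket (A j) (A i) k) =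
      (S.jacobi + S.covZ A + A * A) i k := by
  have hdy : ∀ l, ∑ j, S.X j * S.dy l (A j k) = -A l k := by
    intro l
    have h := congrArg (S.dy l) (hA k)
    rw [map_sum, map_zero] at h
    simp only [Derivation.leibniz, smul_eq_mul, Finset.sum_add_distrib] at h
    rw [S.sum_mul_dy_X] at h
    linear_combination h
  have hdx : ∑ j, S.X j * S.dx i (A j k) = 0 := by
    have h := congrArg (S.dx i) (hA k)
    rw [map_sum, map_zero] at h
    simpa only [Derivation.leibniz, smul_eq_mul, S.dx_X, mul_zero, add_zero] using h
  have e1 : ∑ j, S.X j * S.curv j i k = S.jacobi i k := by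
    simp only [curv, jacobi]
    refine Finset.sum_congr rfl fun j _ => ?_
    rw [mul_neg, Finset.mul_sum, ← Finset.sum_neg_distrib]
    refine Finset.sum_congr rfl fun m _ => ?_
    rw [S.riem_antisymm j i]
    ring
  have swap : ∀ F : Fin d → Fin d → R, ∀ c : Fin d → R,
      ∑ j, S.X j * ∑ l, c l * F j l = ∑ l, c l * ∑ j, S.X j * F j l := by
    intro F c
    simp only [Finset.mul_sum]
    rw [Finset.sum_comm]
    exact Finset.sum_congr rfl fun _ _ => Finset.sum_congr rfl fun _ _ => by ring
  have swap' : ∀ F : Fin d → Fin d → R, ∀ c : Fin d → R,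
      ∑ j, S.X j * ∑ l, F j l * c l = ∑ l, (∑ j, S.X j * F j l) * c l := by
    intro F c
    simp only [Finset.mul_sum, Finset.sum_mul]
    rw [Finset.sum_comm]
    exact Finset.sum_congr rfl fun _ _ => Finset.sum_congr rfl fun _ _ => by ring
  have e2 : ∑ j, S.X j * S.bracket (A j) (A i) k = (A * A) i k := by
    simp only [JetAlg.bracket, Finset.sum_sub_distrib, mul_sub]
    rw [swap' (fun j l => A j l) (fun l => S.dy l (A i k)),
      swap (fun j l => S.dy l (A j k)) (fun l => A i l)]
    simp only [hA, hdy, Matrix.mul_apply]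
    simp
  have hN : ∀ l, S.conn i l = -S.N i l := by
    intro l
    rw [conn, N]
    congr 1
    exact Finset.sum_congr rfl fun m _ => by rw [S.symm i m, mul_comm]
  have e3 : ∑ j, S.X j * S.nabla A j i k = S.covZ A i k := by
    simp only [nabla, JetAlg.bracket, mul_sub, mul_add, Finset.sum_add_distrib,
      Finset.sum_sub_distrib]
    rw [hdx, swap' (fun j l => S.conn j l) (fun l => S.dy l (A i k)),
      swap (fun j l => S.dy l (S.conn j k)) (fun l => A i l),
      swap (fun j l => S.dy l (A j k)) (fun l => S.conn i l),
      swap' (fun j l => A j l) (fun l => S.dy l (S.conn i k))]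
    simp only [hA, hdy, dy_conn, hN]
    simp only [covZ, Matrix.sub_apply, Matrix.add_apply, Matrix.map_apply, Matrix.mul_apply,
      Z_apply, N]
    simp
    ring
  simp only [mul_add, Finset.sum_add_distrib, e1, e2, e3, Matrix.add_apply]

/-- `covZ` is a derivation. -/
theorem covZ_mul (B C : Matrix (Fin d) (Fin d) R) :
    S.covZ (B * C) = S.covZ B * C + B * S.covZ C := by
  have : (B * C).map S.Z = B.map S.Z * C + B * C.map S.Z := by
    ext i k
    simp only [Matrix.map_apply, Matrix.mul_apply, Matrix.add_apply, map_sum, Derivation.leibniz,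
      smul_eq_mul, Finset.sum_add_distrib]
    rw [add_comm]
    congr 1
    exact Finset.sum_congr rfl fun _ _ => mul_comm _ _
  rw [covZ, covZ, covZ, this]
  noncomm_ring

theorem covZ_add (B C : Matrix (Fin d) (Fin d) R) : S.covZ (B + C) = S.covZ B + S.covZ C := by
  have : (B + C).map S.Z = B.map S.Z + C.map S.Z := by
    ext i k
    simp
  rw [covZ, covZ, covZ, this]
  noncomm_ring

theorem covZ_smul (r : ℝ) (B : Matrix (Fin d) (Fin d) R) : S.covZ (r • B) = r • S.covZ B := by
  have : (r • B).map S.Z = r • B.map S.Z := by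
    ext i k
    simp
  rw [covZ, covZ, this, smul_sub, smul_add, Matrix.smul_mul, Matrix.mul_smul]

theorem covZ_zero : S.covZ 0 = 0 := by
  have : (0 : Matrix (Fin d) (Fin d) R).map S.Z = 0 := by ext; simp
  rw [covZ, this]
  simp

theorem covZ_one : S.covZ 1 = 0 := by
  have : (1 : Matrix (Fin d) (Fin d) R).map S.Z = 0 := by
    ext i k
    rw [Matrix.map_apply, Matrix.one_apply]
    split_ifs <;> simp
  rw [covZ, this]
  simp

/-! ### Connections that annihilate the exponential map -/

/-- If the fields `∂ᵢ + Vᵢᵏ ∂_{yᵏ}` kill functions `φ` with invertible `y`-Jacobian, they commute. -/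
theorem flat_of_kill (V : Fin d → Fin d → R) (φ : Fin d → R)
    (hφ : ∀ W : Fin d → R, (∀ j, ∑ k, W k * S.dy k (φ j) = 0) → W = 0)
    (hV : ∀ i j, S.D V i (φ j) = 0) (i j k : Fin d) : S.D V i (V j k) - S.D V j (V i k) = 0 := by
  refine congrFun (hφ (fun k => S.D V i (V j k) - S.D V j (V i k)) fun l => ?_) k
  -- The commutator of Dᵢ and Dⱼ is vertical with these components, and it kills φ because both
  -- fields do.
  rw [← S.D_comm, hV, hV, map_zero, map_zero, sub_zero]

/-- If moreover `φ` is a solution of the geodesic equation `Zφ = Eφ`, the connection `V` is radially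
standard. -/
theorem radial_of_kill (V : Fin d → Fin d → R) (φ : Fin d → R)
    (hφ : ∀ W : Fin d → R, (∀ j, ∑ k, W k * S.dy k (φ j) = 0) → W = 0)
    (hV : ∀ i j, S.D V i (φ j) = 0) (hZ : ∀ j, S.Z (φ j) = ∑ k, S.X k * S.dy k (φ j))
    (A : Fin d → Fin d → R)
    (hA : ∀ i k, V i k = -(if i = k then 1 else 0) + S.conn i k + A i k) (k : Fin d) :
    ∑ i, S.X i * A i k = 0 := by
  refine congrFun (hφ (fun k => ∑ i, S.X i * A i k) fun j => ?_) k
  -- The field yⁱDᵢ is Z minus the Euler field plus yⁱAᵢᵏ ∂_{yᵏ}. It kills φ, and so does Z minus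
  -- the Euler field; hence the vertical remainder kills φ too.
  have h1 : ∑ i, S.X i * S.D V i (φ j) = 0 := by simp [hV]
  have h2 : ∀ k, ∑ i, S.X i * V i k = -S.X k + ∑ i, S.X i * S.conn i k + ∑ i, S.X i * A i k := by
    intro k
    have : ∀ i, S.X i * V i k =
        -(if i = k then S.X i else 0) + S.X i * S.conn i k + S.X i * A i k := by
      intro i
      rw [hA]
      split_ifs <;> ring
    rw [Finset.sum_congr rfl fun i _ => this i]
    simp [Finset.sum_add_distrib]
  have h3 : ∑ i, S.X i * S.D V i (φ j) =
      ∑ i, S.X i * S.dx i (φ j) + ∑ k, (∑ i, S.X i * V i k) * S.dy k (φ j) := by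
    simp only [JetAlg.D_apply, mul_add, Finset.sum_add_distrib, Finset.mul_sum, Finset.sum_mul]
    congr 1
    rw [Finset.sum_comm]
    exact Finset.sum_congr rfl fun _ _ => Finset.sum_congr rfl fun _ _ => by ring
  have h4 := hZ j
  rw [Z_apply] at h4
  rw [h1] at h3
  simp only [h2, add_mul, Finset.sum_add_distrib, neg_mul, Finset.sum_neg_distrib] at h3
  linear_combination -h3 - h4

end JetConn

/-! ### Covariant derivatives of tensors contracted with `y` -/

namespace JetConn

variable {d : ℕ} {R : Type*} [CommRing R] [Algebra ℝ R] (S : JetConn d R)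

/-- Covariant derivative of a tensor with `n` lower indices and one upper index. -/
def covT {n : ℕ} (T : (Fin n → Fin d) → Fin d → R) : (Fin (n + 1) → Fin d) → Fin d → R :=
  fun I l =>
    S.dx (I 0) (T (Fin.tail I) l) + ∑ m, S.Γ (I 0) m l * T (Fin.tail I) m -
      ∑ a : Fin n, ∑ m, S.Γ (I 0) (Fin.tail I a) m * T (Function.update (Fin.tail I) a m) l

/-- Evaluation of a tensor on vectors. -/
def evalT {n : ℕ} (T : (Fin n → Fin d) → Fin d → R) (w : Fin n → Fin d → R) (k : Fin d) : R :=
  ∑ J : Fin n → Fin d, T J k * ∏ a, w a (J a)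

/-- The tensor with the slot `s` left open and the other lower indices contracted with `y`. -/
def contractT {n : ℕ} (s : Fin n) (T : (Fin n → Fin d) → Fin d → R) : Matrix (Fin d) (Fin d) R :=
  fun i k => evalT T (Function.update (fun _ => S.X) s (Pi.single i 1)) k

theorem prod_update {n : ℕ} (w : Fin n → Fin d → R) (a : Fin n) (v : Fin d → R)
    (J : Fin n → Fin d) :
    ∏ b, Function.update w a v b (J b) = v (J a) * ∏ b ∈ Finset.univ.erase a, w b (J b) := by
  rw [← Finset.mul_prod_erase _ _ (Finset.mem_univ a), Function.update_self]
  congr 1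
  refine Finset.prod_congr rfl fun b hb => ?_
  rw [Function.update_of_ne (Finset.ne_of_mem_erase hb)]

theorem evalT_update {n : ℕ} (T : (Fin n → Fin d) → Fin d → R) (w : Fin n → Fin d → R) (a : Fin n)
    (v : Fin d → R) (k : Fin d) :
    evalT T (Function.update w a v) k =
      ∑ J, T J k * (v (J a) * ∏ b ∈ Finset.univ.erase a, w b (J b)) := by
  simp only [evalT, prod_update]

theorem evalT_update_zero {n : ℕ} (T : (Fin n → Fin d) → Fin d → R) (w : Fin n → Fin d → R)
    (a : Fin n) (k : Fin d) : evalT T (Function.update w a 0) k = 0 := by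
  simp [evalT_update]

theorem evalT_update_neg {n : ℕ} (T : (Fin n → Fin d) → Fin d → R) (w : Fin n → Fin d → R)
    (a : Fin n) (v : Fin d → R) (k : Fin d) :
    evalT T (Function.update w a (-v)) k = -evalT T (Function.update w a v) k := by
  simp [evalT_update, Finset.sum_neg_distrib]

theorem evalT_update_sum {n : ℕ} (T : (Fin n → Fin d) → Fin d → R) (w : Fin n → Fin d → R)
    (a : Fin n) (c : Fin d → R) (k : Fin d) :
    evalT T (Function.update w a c) k =
      ∑ l, c l * evalT T (Function.update w a (Pi.single l 1)) k := by
  simp only [evalT_update, Finset.mul_sum]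
  rw [Finset.sum_comm]
  refine Finset.sum_congr rfl fun J _ => ?_
  rw [Finset.sum_eq_single (J a)]
  · simp
    ring
  · intro l _ hl
    simp [hl.symm]
  · simp

/-- Exchanging the index in slot a with the dummy index m is an involution of the range of
summation. It moves the Christoffel term of a covariant derivative from the tensor to the vector put
into slot a. -/
theorem sum_update_swap {n : ℕ} (T : (Fin n → Fin d) → Fin d → R) (w : Fin n → Fin d → R)
    (a : Fin n) (P : Matrix (Fin d) (Fin d) R) (k : Fin d) :
    ∑ J : Fin n → Fin d, ∑ m, P (J a) m * T (Function.update J a m) k * ∏ b, w b (J b) =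
      evalT T (Function.update w a (fun m => ∑ l, w a l * P l m)) k := by
  rw [evalT_update]
  simp only [Finset.sum_mul, Finset.mul_sum]
  rw [← Fintype.sum_prod_type', ← Fintype.sum_prod_type']
  let e : (Fin n → Fin d) × Fin d ≃ (Fin n → Fin d) × Fin d :=
    { toFun := fun p => (Function.update p.1 a p.2, p.1 a)
      invFun := fun p => (Function.update p.1 a p.2, p.1 a)
      left_inv := fun p => by simp
      right_inv := fun p => by simp }
  refine Fintype.sum_equiv e _ _ fun p => ?_
  simp only [e, Equiv.coe_fn_mk, Function.update_self]
  rw [← Finset.mul_prod_erase _ _ (Finset.mem_univ a)]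
  have : ∏ b ∈ Finset.univ.erase a, w b (Function.update p.1 a p.2 b) =
      ∏ b ∈ Finset.univ.erase a, w b (p.1 b) :=
    Finset.prod_congr rfl fun b hb => by rw [Function.update_of_ne (Finset.ne_of_mem_erase hb)]
  rw [this]
  ring

theorem Z_evalT {n : ℕ} (T : (Fin n → Fin d) → Fin d → R) (w : Fin n → Fin d → R) (k : Fin d) :
    S.Z (evalT T w k) = ∑ J, S.Z (T J k) * ∏ a, w a (J a) +
      ∑ a, evalT T (Function.update w a (fun m => S.Z (w a m))) k := by
  have hprod : ∀ (s : Finset (Fin n)) (J : Fin n → Fin d), S.Z (∏ a ∈ s, w a (J a)) =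
      ∑ a ∈ s, S.Z (w a (J a)) * ∏ b ∈ s.erase a, w b (J b) := by
    intro s J
    induction s using Finset.induction_on with
    | empty => simp
    | insert i s hi ih =>
      rw [Finset.prod_insert hi, Derivation.leibniz, ih, Finset.sum_insert hi,
        Finset.erase_insert hi, smul_eq_mul, smul_eq_mul, Finset.mul_sum, add_comm, mul_comm]
      congr 1
      refine Finset.sum_congr rfl fun a ha => ?_
      have hia : i ≠ a := fun h => hi (h ▸ ha)
      rw [Finset.erase_insert_of_ne hia,
        Finset.prod_insert fun h => hi (Finset.mem_of_mem_erase h)]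
      ring
  simp only [evalT_update]
  rw [Finset.sum_comm, ← Finset.sum_add_distrib, evalT, map_sum]
  refine Finset.sum_congr rfl fun J _ => ?_
  rw [Derivation.leibniz, hprod, smul_eq_mul, smul_eq_mul, Finset.mul_sum]
  ring

theorem Z_of_dy (f : R) (h : ∀ l, S.dy l f = 0) : S.Z f = ∑ j, S.X j * S.dx j f := by
  simp [Z_apply, h]

theorem Z_X (m : Fin d) : S.Z (S.X m) = -∑ l, S.X l * S.N l m := by
  rw [Z_apply]
  simp only [S.dx_X, mul_zero, Finset.sum_const_zero, zero_add]
  rw [S.sum_mul_dy_X' (fun l => ∑ j, S.X j * S.conn j l)]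
  simp only [conn, N, mul_neg, Finset.sum_neg_distrib, Finset.mul_sum]
  rw [Finset.sum_comm]
  congr 1
  exact Finset.sum_congr rfl fun _ _ => Finset.sum_congr rfl fun _ _ => by ring

/-- The components of T do not depend on y, so filling the new slot with y turns ∂/∂x into Z on
them, and Γ with one lower index filled by y is N. -/
theorem evalT_covT {n : ℕ} (T : (Fin n → Fin d) → Fin d → R) (hT : ∀ l J k, S.dy l (T J k) = 0)
    (w : Fin n → Fin d → R) (k : Fin d) :
    evalT (S.covT T) (Fin.cons S.X w : Fin (n + 1) → Fin d → R) k =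
      ∑ J, S.Z (T J k) * ∏ a, w a (J a) + ∑ m, evalT T w m * S.N m k -
        ∑ a, evalT T (Function.update w a (fun m => ∑ l, w a l * S.N l m)) k := by
  rw [evalT, ← (Fin.consEquiv fun _ => Fin d).sum_comp, Fintype.sum_prod_type]
  simp only [Fin.consEquiv, Equiv.coe_fn_mk, Fin.prod_univ_succ, Fin.cons_zero, Fin.cons_succ,
    covT, Fin.tail_cons]
  simp only [sub_mul, add_mul, Finset.sum_add_distrib, Finset.sum_sub_distrib]
  congr 1
  · congr 1
    · rw [Finset.sum_comm]
      refine Finset.sum_congr rfl fun J _ => ?_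
      rw [S.Z_of_dy _ fun l => hT l J k, Finset.sum_mul]
      exact Finset.sum_congr rfl fun _ _ => by ring
    · simp only [evalT, N, Finset.sum_mul_sum]
      rw [Finset.sum_comm]
      refine Eq.trans ?_ Finset.sum_comm
      refine Finset.sum_congr rfl fun J _ => ?_
      simp only [Finset.sum_mul]
      rw [Finset.sum_comm]
      exact Finset.sum_congr rfl fun _ _ => Finset.sum_congr rfl fun _ _ => by ring
  · simp only [← sum_update_swap T w _ S.N k]
    rw [Finset.sum_comm]
    simp only [Finset.sum_mul, N]
    refine Eq.trans ?_ Finset.sum_comm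
    refine Finset.sum_congr rfl fun J _ => ?_
    rw [Finset.sum_comm]
    refine Finset.sum_congr rfl fun a _ => ?_
    rw [Finset.sum_comm]
    exact Finset.sum_congr rfl fun _ _ => Finset.sum_congr rfl fun _ _ => by ring

/-- In a slot filled with y the Christoffel term cancels against Z(yᵐ) = -yˡ Nₗᵐ. Only the open slot
and the upper index keep theirs, and these are the two matrix products in `covZ`. -/
theorem contractT_covT {n : ℕ} (s : Fin n) (T : (Fin n → Fin d) → Fin d → R)
    (hT : ∀ l J k, S.dy l (T J k) = 0) :
    S.contractT s.succ (S.covT T) = S.covZ (S.contractT s T) := by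
  ext i k
  have hw : (Function.update (fun _ => S.X) s.succ (Pi.single i 1) : Fin (n + 1) → Fin d → R) =
      Fin.cons S.X (Function.update (fun _ => S.X) s (Pi.single i 1)) := by
    rw [Fin.cons_update]
    congr 1
    ext a
    refine Fin.cases ?_ (fun b => ?_) a <;> simp
  rw [contractT, hw, S.evalT_covT T hT]
  simp only [covZ, Matrix.sub_apply, Matrix.add_apply, Matrix.map_apply, Matrix.mul_apply]
  set w : Fin n → Fin d → R := Function.update (fun _ => S.X) s (Pi.single i 1) with hw'
  have e1 : ∀ m, S.contractT s T i m = evalT T w m := fun m => rfl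
  simp only [e1]
  rw [S.Z_evalT]
  have e2 : ∑ l, S.N i l * S.contractT s T l k =
      evalT T (Function.update w s (fun m => ∑ l, w s l * S.N l m)) k := by
    rw [evalT_update_sum]
    refine Finset.sum_congr rfl fun l _ => ?_
    rw [contractT, hw', Function.update_idem, Function.update_self]
    congr 1
    simp [Pi.single_apply]
  rw [e2, ← Finset.add_sum_erase _ _ (Finset.mem_univ s),
    ← Finset.add_sum_erase _ (fun a => evalT T (Function.update w a fun m => S.Z (w a m)) k)
      (Finset.mem_univ s)]
  have e3 : evalT T (Function.update w s fun m => S.Z (w s m)) k = 0 := by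
    have : (fun m => S.Z (w s m)) = 0 := by
      funext m
      rw [hw', Function.update_self, Pi.single_apply]
      split_ifs <;> simp
    rw [this, evalT_update_zero]
  have e4 : ∀ a ∈ Finset.univ.erase s, evalT T (Function.update w a fun m => S.Z (w a m)) k =
      -evalT T (Function.update w a fun m => ∑ l, w a l * S.N l m) k := by
    intro a ha
    rw [← evalT_update_neg]
    congr 2
    funext m
    rw [hw', Function.update_of_ne (Finset.ne_of_mem_erase ha), S.Z_X]
    rfl
  rw [e3, Finset.sum_congr rfl e4, Finset.sum_neg_distrib]
  ring

end JetConn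

/-! ### The universal coefficients -/

section Universal

/-- Concatenation of formal linear combinations of lists. -/
def mulList : (List ℕ →₀ ℝ) →ₗ[ℝ] (List ℕ →₀ ℝ) →ₗ[ℝ] (List ℕ →₀ ℝ) :=
  Finsupp.lsum ℝ fun l => LinearMap.toSpanSingleton ℝ _
    (Finsupp.lsum ℝ fun l' => LinearMap.toSpanSingleton ℝ _ (Finsupp.single (l ++ l') 1))

/-- The sum of the lists obtained by increasing one entry by one. -/
def incList : List ℕ → (List ℕ →₀ ℝ)
  | [] => 0
  | m :: l => Finsupp.single ((m + 1) :: l) 1 + mulList (Finsupp.single [m] 1) (incList l)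

/-- Linear extension of `incList`. -/
def incLin : (List ℕ →₀ ℝ) →ₗ[ℝ] (List ℕ →₀ ℝ) :=
  Finsupp.lsum ℝ fun l => LinearMap.toSpanSingleton ℝ _ (incList l)

/-- The coefficients of the no-loop polynomials. -/
def noLoopCoeff : ℕ → (List ℕ →₀ ℝ)
  | 0 => 0
  -- This is degree n + 1 of (E + 1)A = R_y + ∇_y A + A², with E the Euler operator. The factor is
  -- the reciprocal of (n + 1) + 1, the curvature enters only in degree 2 as the list `[0]`, and a +
  -- 1 and n - a run over 1, …, n because A has no constant term.
  | n + 1 => (1 / ((n : ℝ) + 2)) • ((if n = 1 then Finsupp.single [0] 1 else 0) +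
      incLin (noLoopCoeff n) + ∑ a : Fin n, mulList (noLoopCoeff (a + 1)) (noLoopCoeff (n - a)))

@[simp] theorem mulList_single (l l' : List ℕ) (r r' : ℝ) :
    mulList (Finsupp.single l r) (Finsupp.single l' r') = Finsupp.single (l ++ l') (r * r') := by
  simp [mulList, LinearMap.toSpanSingleton_apply]

@[simp] theorem incLin_single (l : List ℕ) (r : ℝ) :
    incLin (Finsupp.single l r) = r • incList l := by
  simp [incLin, LinearMap.toSpanSingleton_apply]

theorem mulList_nil (x y : List ℕ →₀ ℝ) : mulList x y [] = x [] * y [] := by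
  induction x using Finsupp.induction_linear with
  | zero => simp
  | add f g hf hg => simp [hf, hg, add_mul]
  | single l r =>
    induction y using Finsupp.induction_linear with
    | zero => simp
    | add f g hf hg => rw [map_add, Finsupp.add_apply, hf, hg, Finsupp.add_apply, mul_add]
    | single l' r' =>
      rw [mulList_single]
      by_cases h : l = [] <;> by_cases h' : l' = [] <;> simp [h, h']

theorem incList_nil (l : List ℕ) : incList l [] = 0 := by
  induction l with
  | nil => simp [incList]
  | cons m l ih => simp [incList, mulList_nil, ih]

theorem incLin_nil (x : List ℕ →₀ ℝ) : incLin x [] = 0 := by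
  induction x using Finsupp.induction_linear with
  | zero => simp
  | add f g hf hg => simp [hf, hg]
  | single l r => simp [incList_nil]

/-- The empty list would stand for the identity matrix, that is for s = 0. It never arises: the
curvature starts with `[0]`, increasing an entry keeps a list nonempty, and a concatenation is empty
only if both parts are. -/
theorem noLoopCoeff_nil (N : ℕ) : noLoopCoeff N [] = 0 := by
  induction N using Nat.strong_induction_on with
  | _ N ih =>
    cases N with
    | zero => simp [noLoopCoeff]
    | succ n =>
      rw [noLoopCoeff]
      simp only [Finsupp.smul_apply, Finsupp.add_apply, Finsupp.finsetSum_apply, mulList_nil,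
        incLin_nil]
      rw [Finset.sum_eq_zero fun a _ => by rw [ih _ (by omega), zero_mul]]
      split_ifs <;> simp

end Universal

/-! ### Smooth connections on an open set -/

section Smooth

variable {d : ℕ} {U : Opens (Model d)}

/-- The calculus of smooth families. -/
def jetAlg (U : Opens (Model d)) : JetAlg d (Fam U) where
  dx := Fam.dx
  dy := Fam.dy
  X := Fam.X
  dx_comm := Fam.dx_comm
  dx_dy := Fam.dx_dy
  dy_comm := Fam.dy_comm
  dx_X := Fam.dx_X
  dy_X := Fam.dy_X

/-- Smooth symmetric Christoffel symbols. -/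
structure SmoothConn (U : Opens (Model d)) (Γ : Chris d) : Prop where
  smooth : ∀ i j k, ContDiffOn ℝ ∞ (fun u => Γ u i j k) U
  symm : ∀ u ∈ U, ∀ i j k, Γ u i j k = Γ u j i k

variable {Γ : Chris d} (h : SmoothConn U Γ)

namespace SmoothConn

/-- The connection as a connection over the ring of smooth families. -/
def jet : JetConn d (Fam U) where
  toJetAlg := jetAlg U
  Γ i j k := Fam.C _ (h.smooth i j k)
  symm i j k := Fam.ext' fun u => by
    simp only [Fam.C_apply]
    rw [h.symm u u.2]
  dy_Γ l i j k := Fam.dy_C l _ _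

theorem X_eq (j : Fin d) : h.jet.X j = Fam.X j := rfl
theorem dy_eq (k : Fin d) : h.jet.dy k = Fam.dy k := rfl
theorem dx_eq (k : Fin d) : h.jet.dx k = Fam.dx k := rfl
theorem Γ_eq (i j k : Fin d) : h.jet.Γ i j k = Fam.C _ (h.smooth i j k) := rfl

theorem conn_apply (i k : Fin d) (u : U) : h.jet.conn i k u = conV Γ u i k := by
  simp [JetConn.conn, conV, Γ_eq, X_eq]

theorem bracket_apply (V W : Fin d → Fam U) (k : Fin d) (u : U) :
    h.jet.bracket V W k u = vbracket (fun l => V l u) (fun l => W l u) k := by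
  simp [JetAlg.bracket, vbracket, dy_eq]

theorem riem_apply (i j k l : Fin d) (u : U) :
    h.jet.riem i j k l u = MvPowerSeries.C (riem Γ u i j k l) := by
  simp [JetConn.riem, riem, Γ_eq, dx_eq, Fam.dx_C]

theorem curv_apply (i j l : Fin d) (u : U) : h.jet.curv i j l u = curvV Γ u i j l := by
  simp [JetConn.curv, curvV, riem_apply, X_eq]

theorem nabla_apply {A : LV1 d} {B : Matrix (Fin d) (Fin d) (Fam U)}
    (hA : ∀ u : U, ∀ i k, B i k u = A u i k) (i j k : Fin d) (u : U) :
    h.jet.nabla B i j k u = nablaV Γ A u i j k := by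
  simp only [JetConn.nabla, Fam.sub_apply, Fam.add_apply, dx_eq, bracket_apply, conn_apply]
  rw [Fam.dx_apply' i (B j k) (F := fun v => A v j k) fun v => hA v j k,
    Fam.dx_apply' j (B i k) (F := fun v => A v i k) fun v => hA v i k]
  simp only [hA]
  rfl

/-! #### Degrees -/

/-- All entries vanish in degree `n`. -/
def MVan (n : ℕ) (B : Matrix (Fin d) (Fin d) (Fam U)) : Prop := ∀ i k, Fam.Van n (B i k)

theorem MVan.zero (n : ℕ) : MVan n (0 : Matrix (Fin d) (Fin d) (Fam U)) :=
  fun _ _ => Fam.Van.zero n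

theorem MVan.add {n : ℕ} {B C : Matrix (Fin d) (Fin d) (Fam U)} (hB : MVan n B) (hC : MVan n C) :
    MVan n (B + C) := fun i k => (hB i k).add (hC i k)

theorem MVan.sub {n : ℕ} {B C : Matrix (Fin d) (Fin d) (Fam U)} (hB : MVan n B) (hC : MVan n C) :
    MVan n (B - C) := fun i k => (hB i k).sub (hC i k)

theorem MVan.smul {n : ℕ} (r : ℝ) {B : Matrix (Fin d) (Fin d) (Fam U)} (hB : MVan n B) :
    MVan n (r • B) := fun i k => (hB i k).smul r

theorem MVan.sum {n : ℕ} {ι : Type*} {s : Finset ι} {B : ι → Matrix (Fin d) (Fin d) (Fam U)}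
    (hB : ∀ a ∈ s, MVan n (B a)) : MVan n (∑ a ∈ s, B a) := fun i k => by
  rw [Matrix.sum_apply]
  exact Fam.Van.sum fun a ha => hB a ha i k

theorem MVan.mul {n : ℕ} {B C : Matrix (Fin d) (Fin d) (Fam U)}
    (hBC : ∀ a b, a + b = n → MVan a B ∨ MVan b C) : MVan n (B * C) := fun i k => by
  rw [Matrix.mul_apply]
  refine Fam.Van.sum fun l _ => Fam.Van.mul fun a b hab => ?_
  exact (hBC a b hab).imp (fun H => H i l) (fun H => H l k)

theorem Γ_van {n : ℕ} (hn : n ≠ 0) (i j k : Fin d) : Fam.Van n (h.jet.Γ i j k) :=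
  Fam.Van.C _ (h.smooth i j k) hn

theorem N_van {n : ℕ} (hn : n ≠ 1) : MVan n h.jet.N := fun i k => by
  refine Fam.Van.sum fun j _ => Fam.Van.mul fun a b hab => ?_
  by_cases ha : a = 1
  · exact Or.inr (h.Γ_van (by omega) _ _ _)
  · exact Or.inl (Fam.Van.X j ha)

theorem X_conn_van {n : ℕ} (hn : n ≠ 2) (j l : Fin d) :
    Fam.Van n (h.jet.X j * h.jet.conn j l) := by
  refine Fam.Van.mul fun a b hab => ?_
  by_cases ha : a = 1
  · refine Or.inr (Fam.Van.neg (Fam.Van.sum fun m _ => Fam.Van.mul fun a' b' hab' => ?_))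
    by_cases ha' : a' = 0
    · exact Or.inr (Fam.Van.X m (by omega))
    · exact Or.inl (h.Γ_van ha' _ _ _)
  · exact Or.inl (Fam.Van.X j ha)

/-- Both parts of Z raise the degree by one: yʲ ∂_{xʲ}, and ∂_{yˡ}, which lowers the degree by one
but has a coefficient quadratic in y. -/
theorem Z_van {n : ℕ} {f : Fam U} (hf : Fam.Van n f) : Fam.Van (n + 1) (h.jet.Z f) := by
  rw [JetConn.Z_apply]
  refine Fam.Van.add (Fam.Van.sum fun j _ => (hf.dx j).X_mul j)
    (Fam.Van.sum fun l _ => Fam.Van.mul fun a b hab => ?_)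
  by_cases ha : a = 2
  · right
    obtain ⟨m, rfl⟩ : ∃ m, n = m + 1 := ⟨n - 1, by omega⟩
    obtain rfl : b = m := by omega
    exact hf.dy l
  · exact Or.inl (Fam.Van.sum fun j _ => h.X_conn_van ha j l)

theorem Z_van_zero (f : Fam U) : Fam.Van 0 (h.jet.Z f) := by
  rw [JetConn.Z_apply]
  refine Fam.Van.add (Fam.Van.sum fun j _ => Fam.Van.X_mul_zero j)
    (Fam.Van.sum fun l _ => Fam.Van.mul fun a b hab => ?_)
  exact Or.inl (Fam.Van.sum fun j _ => h.X_conn_van (by omega) j l)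

theorem covZ_van {n : ℕ} {B : Matrix (Fin d) (Fin d) (Fam U)} (hB : MVan n B) :
    MVan (n + 1) (h.jet.covZ B) := by
  refine MVan.sub (MVan.add (fun i k => h.Z_van (hB i k)) (MVan.mul fun a b hab => ?_))
    (MVan.mul fun a b hab => ?_)
  · by_cases hb : b = 1
    · obtain rfl : a = n := by omega
      exact Or.inl hB
    · exact Or.inr (h.N_van hb)
  · by_cases ha : a = 1
    · obtain rfl : b = n := by omega
      exact Or.inr hB
    · exact Or.inl (h.N_van ha)

theorem covZ_van_zero (B : Matrix (Fin d) (Fin d) (Fam U)) : MVan 0 (h.jet.covZ B) := by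
  refine MVan.sub (MVan.add (fun i k => h.Z_van_zero _) (MVan.mul fun a b hab => ?_))
    (MVan.mul fun a b hab => ?_)
  · exact Or.inr (h.N_van (by omega))
  · exact Or.inl (h.N_van (by omega))

theorem jacobi_van {n : ℕ} (hn : n ≠ 2) : MVan n h.jet.jacobi := fun i k => by
  refine Fam.Van.sum fun j _ => Fam.Van.sum fun m _ => Fam.Van.mul fun a b hab => ?_
  by_cases ha : a = 2
  · right
    intro u
    rw [riem_apply]
    exact VanAt.C _ (by omega)
  · left
    refine Fam.Van.mul fun a' b' hab' => ?_
    by_cases ha' : a' = 1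
    · exact Or.inr (Fam.Van.X m (by omega))
    · exact Or.inl (Fam.Van.X j ha')

/-! #### Chains of covariant derivatives of the curvature -/

theorem covRiem_smooth (h : SmoothConn U Γ) (m : ℕ) (J : Fin (3 + m) → Fin d) (k : Fin d) :
    ContDiffOn ℝ ∞ (fun u => covRiem Γ m u J k) U := by
  induction m generalizing k with
  | zero =>
    simp only [covRiem, riem]
    refine ContDiffOn.add (ContDiffOn.sub ?_ ?_) (ContDiffOn.sum fun m _ => ContDiffOn.sub ?_ ?_)
    · exact Fam.contDiffOn_partial (h.smooth _ _ _) _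
    · exact Fam.contDiffOn_partial (h.smooth _ _ _) _
    · exact (h.smooth _ _ _).mul (h.smooth _ _ _)
    · exact (h.smooth _ _ _).mul (h.smooth _ _ _)
  | succ m ih =>
    simp only [covRiem, covTensor]
    refine ContDiffOn.sub (ContDiffOn.add ?_ ?_) ?_
    · exact Fam.contDiffOn_partial (ih _ _) _
    · exact ContDiffOn.sum fun m _ => (h.smooth _ _ _).mul (ih _ _)
    · exact ContDiffOn.sum fun a _ => ContDiffOn.sum fun m _ => (h.smooth _ _ _).mul (ih _ _)

/-- `∇ᵐR` over the ring of families. -/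
def covR (m : ℕ) (J : Fin (3 + m) → Fin d) (k : Fin d) : Fam U := Fam.C _ (h.covRiem_smooth m J k)

theorem covR_succ (m : ℕ) : h.covR (m + 1) = h.jet.covT (h.covR m) := by
  funext J k
  refine Fam.ext' fun u => ?_
  simp only [JetConn.covT, covR, dx_eq, Fam.dx_C, Γ_eq, Fam.add_apply, Fam.sub_apply,
    Fam.sum_apply, Fam.mul_apply, Fam.C_apply, ← map_mul, ← map_sum, ← map_add, ← map_sub]
  rfl

/-- `chainFactor` over the ring of families. -/
def factor (m : ℕ) : Matrix (Fin d) (Fin d) (Fam U) :=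
  JetConn.contractT (S := h.jet) (riemSlot m) (h.covR m)

theorem factor_apply (m : ℕ) (i k : Fin d) (u : U) : h.factor m i k u = chainFactor Γ u m i k := by
  simp only [factor, JetConn.contractT, JetConn.evalT, JetConn.prod_update, Fam.sum_apply,
    Fam.mul_apply, Fam.prod_apply, chainFactor]
  refine Finset.sum_congr rfl fun J _ => ?_
  rw [Pi.single_apply]
  split_ifs <;> simp [covR, X_eq]

/-- The new derivative index comes first and is contracted with y, and `riemSlot (m + 1)` is the
successor of `riemSlot m`, so this is an instance of `contractT_covT`. It makes ∇_y act on chains by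
raising entries. -/
theorem factor_succ (m : ℕ) : h.factor (m + 1) = h.jet.covZ (h.factor m) := by
  rw [factor, covR_succ]
  exact h.jet.contractT_covT (riemSlot m) (h.covR m) fun l J k => Fam.dy_C l _ _

theorem factor_zero : h.factor 0 = h.jet.jacobi := by
  ext1 i k
  rw [factor, JetConn.contractT, JetConn.evalT, JetConn.jacobi]
  have e : ∀ J : Fin 3 → Fin d, h.covR 0 J k = h.jet.riem (J 0) (J 1) (J 2) k := by
    intro J
    exact Fam.ext' fun u => by rw [riem_apply]; rfl
  have key : ∀ J : Fin 3 → Fin d, (∏ a, (Function.update (fun _ => h.jet.X) (riemSlot 0)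
      (Pi.single i 1) : Fin 3 → Fin d → Fam U) a (J a)) =
      if J 0 = i then h.jet.X (J 1) * h.jet.X (J 2) else 0 := by
    intro J
    have hs : riemSlot 0 = (0 : Fin 3) := rfl
    rw [Fin.prod_univ_three, hs, Function.update_self, Function.update_of_ne (by decide),
      Function.update_of_ne (by decide), Pi.single_apply]
    split_ifs <;> simp
  have : ∑ J : Fin 3 → Fin d, h.jet.riem (J 0) (J 1) (J 2) k *
      (if J 0 = i then h.jet.X (J 1) * h.jet.X (J 2) else 0) =
      ∑ j, ∑ m, h.jet.X j * h.jet.X m * h.jet.riem i j m k := by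
    rw [← (Fin.consEquiv fun _ => Fin d).sum_comp, Fintype.sum_prod_type,
      Finset.sum_eq_single i]
    · rw [← (Fin.consEquiv fun _ => Fin d).sum_comp, Fintype.sum_prod_type]
      refine Finset.sum_congr rfl fun j _ => ?_
      rw [← (Fin.consEquiv fun _ => Fin d).sum_comp, Fintype.sum_prod_type]
      refine Finset.sum_congr rfl fun m _ => ?_
      rw [Fintype.sum_unique]
      simp only [Fin.consEquiv, Equiv.coe_fn_mk, Fin.cons_zero, if_true]
      exact mul_comm _ _
    · intro b _ hb
      simp [Fin.consEquiv, hb]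
    · simp
  rw [← this]
  refine Finset.sum_congr rfl fun J _ => ?_
  rw [e, key]

/-- Evaluation of a formal combination of lists. -/
def ev : (List ℕ →₀ ℝ) →ₗ[ℝ] Matrix (Fin d) (Fin d) (Fam U) :=
  Finsupp.lsum ℝ fun l => LinearMap.toSpanSingleton ℝ _ (l.map h.factor).prod

@[simp] theorem ev_single (l : List ℕ) (r : ℝ) :
    h.ev (Finsupp.single l r) = r • (l.map h.factor).prod := by
  simp [ev, LinearMap.toSpanSingleton_apply]

theorem chain_apply (l : List ℕ) (i k : Fin d) (u : U) :
    (l.map h.factor).prod i k u = chain Γ u l i k := by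
  have := congrFun (congrFun (map_list_prod (RingHom.mapMatrix (Fam.eval u)) (l.map h.factor)) i) k
  rw [RingHom.mapMatrix_apply, Matrix.map_apply, Fam.eval_apply] at this
  have hf : (RingHom.mapMatrix (Fam.eval u)) ∘ h.factor = chainFactor Γ u := by
    funext m i k
    exact h.factor_apply m i k u
  rw [this, chain, List.map_map, hf]

theorem coeff_ev (x : List ℕ →₀ ℝ) (i k : Fin d) (u : U) (α : Fin d →₀ ℕ) :
    MvPowerSeries.coeff α (h.ev x i k u) =
      x.sum fun l r => r * MvPowerSeries.coeff α (chain Γ u l i k) := by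
  rw [ev, Finsupp.lsum_apply, Finsupp.sum, Matrix.sum_apply, Fam.sum_apply, map_sum, Finsupp.sum]
  refine Finset.sum_congr rfl fun l _ => ?_
  rw [LinearMap.toSpanSingleton_apply, Matrix.smul_apply, Fam.smul_apply, chain_apply,
    MvPowerSeries.coeff_smul]

/-- Concatenation of chains is matrix multiplication; this carries the recursion for numbers over to
matrices. -/
theorem ev_mul (x y : List ℕ →₀ ℝ) : h.ev (mulList x y) = h.ev x * h.ev y := by
  induction x using Finsupp.induction_linear with
  | zero => simp
  | add f g hf hg => simp [hf, hg, add_mul]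
  | single l r =>
    induction y using Finsupp.induction_linear with
    | zero => simp
    | add f g hf hg => rw [map_add, map_add, hf, hg, map_add, mul_add]
    | single l' r' =>
      simp only [mulList_single, ev_single, List.map_append, List.prod_append, Matrix.smul_mul,
        Matrix.mul_smul, smul_smul, mul_comm r' r]

/-- `covZ` is a derivation of the matrix algebra and raises the order of a single factor, so on a
product it raises each entry of the list in turn. -/
theorem ev_incList (l : List ℕ) : h.ev (incList l) = h.jet.covZ (l.map h.factor).prod := by
  induction l with
  | nil => simp [incList, JetConn.covZ_one]
  | cons m l ih => simp [incList, ev_mul, ih, JetConn.covZ_mul, factor_succ]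

theorem ev_incLin (x : List ℕ →₀ ℝ) : h.ev (incLin x) = h.jet.covZ (h.ev x) := by
  induction x using Finsupp.induction_linear with
  | zero => simp [JetConn.covZ_zero]
  | add f g hf hg => simp [hf, hg, JetConn.covZ_add]
  | single l r => simp [ev_incList, JetConn.covZ_smul]

/-- The part of degree `N` of the no-loop polynomials. -/
def noLoop (N : ℕ) : Matrix (Fin d) (Fin d) (Fam U) := h.ev (noLoopCoeff N)

theorem noLoop_zero : h.noLoop 0 = 0 := by simp [noLoop, noLoopCoeff]

theorem noLoop_succ (n : ℕ) : h.noLoop (n + 1) = (1 / ((n : ℝ) + 2)) •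
    ((if n = 1 then h.jet.jacobi else 0) + h.jet.covZ (h.noLoop n) +
      ∑ a : Fin n, h.noLoop (a + 1) * h.noLoop (n - a)) := by
  rw [noLoop, noLoopCoeff, map_smul, map_add, map_add, map_sum, ev_incLin]
  rw [Finset.sum_congr rfl fun (a : Fin n) _ =>
    h.ev_mul (noLoopCoeff (a + 1)) (noLoopCoeff (n - a))]
  congr 3
  split_ifs
  · simp [factor_zero]
  · simp

/-- `noLoop N` is homogeneous of degree `N`. -/
theorem noLoop_van (N n : ℕ) (hn : n ≠ N) : MVan n (h.noLoop N) := by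
  induction N using Nat.strong_induction_on generalizing n with
  | _ N ih =>
    cases N with
    | zero => rw [noLoop_zero]; exact MVan.zero n
    | succ N =>
      rw [noLoop_succ]
      refine MVan.smul _ (MVan.add (MVan.add ?_ ?_) (MVan.sum fun a _ => MVan.mul fun p q hpq => ?_))
      · split_ifs with h1
        · exact h.jacobi_van (by omega)
        · exact MVan.zero n
      · cases n with
        | zero => exact h.covZ_van_zero _
        | succ n => exact h.covZ_van (ih N (by omega) n (by omega))
      · by_cases hp : p = a + 1
        · exact Or.inr (ih _ (by omega) q (by omega))
        · exact Or.inl (ih _ (by omega) p hp)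

end SmoothConn

end Smooth

/-! ### Fedosov's recursion -/

section Recursion

variable {d : ℕ}

-- Used with F and G the homogeneous parts. As f and g have no constant term, the part of degree n +
-- 1 of their product involves only their parts of degrees 1, …, n, so the quadratic term of the
-- recursion looks only at degrees already known.
open MvPowerSeries in
theorem VanAt.mul_sub_sum {f g : Pow d} {F G : ℕ → Pow d} (n : ℕ)
    (hF : ∀ m b, b ≠ m → VanAt b (F m)) (hG : ∀ m b, b ≠ m → VanAt b (G m))
    (hf : ∀ m ≤ n, VanAt m (f - F m)) (hg : ∀ m ≤ n, VanAt m (g - G m))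
    (hf0 : VanAt 0 f) (hg0 : VanAt 0 g) :
    VanAt (n + 1) (f * g - ∑ a : Fin n, F (a + 1) * G (n - a)) := fun α hα => by
  classical
  rw [map_sub, map_sum, coeff_mul]
  simp only [coeff_mul]
  rw [Finset.sum_comm, ← Finset.sum_sub_distrib]
  refine Finset.sum_eq_zero fun p hp => ?_
  have hp' : p.1.degree + p.2.degree = n + 1 := by
    rw [← hα, ← Finset.HasAntidiagonal.mem_antidiagonal.mp hp, map_add]
  by_cases h1 : p.1.degree = 0
  · rw [hf0 _ h1, zero_mul, Finset.sum_eq_zero, sub_zero]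
    intro a _
    rw [hF (a + 1) 0 (by omega) _ h1, zero_mul]
  by_cases h2 : p.2.degree = 0
  · rw [hg0 _ h2, mul_zero, Finset.sum_eq_zero, sub_zero]
    intro a _
    rw [hG (n - a) 0 (by omega) _ h2, mul_zero]
  -- For a fixed pair of exponents only the summand in which F has the degree of the first exponent
  -- survives, that is a + 1 = p.1.degree.
  rw [Finset.sum_eq_single (⟨p.1.degree - 1, by omega⟩ : Fin n)]
  · have e1 : p.1.degree - 1 + 1 = p.1.degree := by omega
    have e2 : n - (p.1.degree - 1) = p.2.degree := by omega
    have q1 := hf p.1.degree (by omega) p.1 rfl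
    have q2 := hg p.2.degree (by omega) p.2 rfl
    rw [map_sub, sub_eq_zero] at q1 q2
    simp only [e1, e2]
    rw [q1, q2, sub_self]
  · intro a _ ha
    have : p.1.degree ≠ a + 1 := by
      intro hh
      apply ha
      ext
      simp only
      omega
    rw [hF _ _ this _ rfl, zero_mul]
  · simp

variable {U : Opens (Model d)} {Γ : Chris d} (h : SmoothConn U Γ)

theorem Fam.Van.scale {n q : ℕ} {f : Fam U} (hf : Fam.Van n f) : Fam.Van n (Fam.scale q f) :=
  fun u α hα => by rw [Fam.scale_apply, coeff_scaleInv, hf u α hα, zero_div]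

theorem Fam.scale_add (q : ℕ) (f g : Fam U) :
    Fam.scale q (f + g) = Fam.scale q f + Fam.scale q g := Fam.ext' fun u => by
  ext α
  simp only [Fam.scale_apply, Fam.add_apply, coeff_scaleInv, map_add, add_div]

theorem Fam.scale_zero (q : ℕ) : Fam.scale q (0 : Fam U) = 0 := Fam.ext' fun u => by
  ext α
  simp [coeff_scaleInv]

theorem Fam.scale_sum (q : ℕ) {ι : Type*} (s : Finset ι) (F : ι → Fam U) :
    Fam.scale q (∑ i ∈ s, F i) = ∑ i ∈ s, Fam.scale q (F i) :=
  map_sum (AddMonoidHom.mk' (Fam.scale q) (Fam.scale_add q)) F s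

theorem Fam.X_mul_scale (j : Fin d) (q : ℕ) (f : Fam U) :
    Fam.X j * Fam.scale (q + 1) f = Fam.scale q (Fam.X j * f) := Fam.ext' fun u => by
  simp only [Fam.scale_apply, Fam.mul_apply, Fam.X_apply, X_mul_scaleInv]

/-- The operator E + 1 multiplies the part of degree p by p + 1, and `scale 1` divides by it.
Together with `contract_delta` this says δ⁻¹δA = A whenever δ⁻¹A = 0. -/
theorem Fam.scale_euler (f : Fam U) :
    Fam.scale 1 (∑ j, Fam.X j * Fam.dy j f + f) = f := Fam.ext' fun u => by
  ext α
  rw [Fam.scale_apply, coeff_scaleInv, Fam.add_apply, map_add, Fam.sum_apply]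
  simp only [Fam.mul_apply, Fam.X_apply, Fam.dy_apply]
  rw [coeff_euler]
  have : (α.degree : ℝ) + 1 ≠ 0 := by positivity
  field_simp
  push_cast
  ring

namespace SmoothConn

/-- `curv + ∇'B + ½[B, B]`. -/
def curvTotal (B : Matrix (Fin d) (Fin d) (Fam U)) (i j k : Fin d) : Fam U :=
  h.jet.curv i j k + h.jet.nabla B i j k + h.jet.bracket (B i) (B j) k

/-- The right-hand side of Fedosov's equation. -/
def step (B : Matrix (Fin d) (Fin d) (Fam U)) : Matrix (Fin d) (Fin d) (Fam U) :=
  fun i k => Fam.scale 1 (∑ j, Fam.X j * h.curvTotal B j i k)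

/-- `yⁱ Bᵢᵏ = 0`. -/
def Radial (B : Matrix (Fin d) (Fin d) (Fam U)) : Prop := ∀ k, ∑ i, Fam.X i * B i k = 0

theorem curvTotal_antisymm (B : Matrix (Fin d) (Fin d) (Fam U)) (i j k : Fin d) :
    h.curvTotal B i j k = -h.curvTotal B j i k := by
  have h1 : h.jet.curv i j k = -h.jet.curv j i k := by
    rw [JetConn.curv, JetConn.curv, neg_neg, ← Finset.sum_neg_distrib]
    exact Finset.sum_congr rfl fun l _ => by
      rw [h.jet.riem_antisymm i j]; ring
  have h2 : h.jet.bracket (B i) (B j) k = -h.jet.bracket (B j) (B i) k := by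
    simp only [JetAlg.bracket, Finset.sum_sub_distrib, neg_sub]
  have h3 : h.jet.nabla B i j k = -h.jet.nabla B j i k := (neg_sub _ _).symm
  rw [curvTotal, curvTotal, h1, h2, h3]
  ring

/-- A 2-form contracted twice with y vanishes by antisymmetry, so (δ⁻¹)² = 0 and every output of
Fedosov's step is annihilated by δ⁻¹. -/
theorem radial_step (B : Matrix (Fin d) (Fin d) (Fam U)) : Radial (h.step B) := fun k => by
  simp only [step, Fam.X_mul_scale]
  rw [← Fam.scale_sum]
  have : ∑ i, Fam.X i * ∑ j, Fam.X j * h.curvTotal B j i k = 0 := by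
    set s := ∑ i, Fam.X i * ∑ j, Fam.X j * h.curvTotal B j i k with hs
    have h1 : s = -s := by
      conv_lhs => rw [hs]
      simp only [Finset.mul_sum]
      rw [Finset.sum_comm, hs, ← Finset.sum_neg_distrib]
      refine Finset.sum_congr rfl fun i _ => ?_
      rw [Finset.mul_sum, ← Finset.sum_neg_distrib]
      refine Finset.sum_congr rfl fun j _ => ?_
      rw [h.curvTotal_antisymm B i j]
      ring
    have h2 : (2 : ℝ) • s = 0 := by
      rw [two_smul]
      nth_rewrite 1 [h1]
      simp
    simpa using congrArg (fun t => (1 / 2 : ℝ) • t) h2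
  rw [this, Fam.scale_zero]

/-- The coefficient of yⁱ in ∑ yʲ Bⱼᵏ is the constant term of Bᵢᵏ. -/
theorem Radial.van {B : Matrix (Fin d) (Fin d) (Fam U)} (hB : Radial B) : MVan 0 B :=
  fun i k u α hα => by
    classical
    rw [Finsupp.degree_eq_zero_iff] at hα
    subst hα
    have h1 : (∑ i, Fam.X i * B i k : Fam U) u = 0 := by rw [hB k]; rfl
    have h2 := congrArg (MvPowerSeries.coeff (Finsupp.single i 1)) h1
    rw [Fam.sum_apply, map_sum, Finset.sum_eq_single i] at h2
    · rw [Fam.mul_apply, Fam.X_apply, coeff_X_mul_of_ne _ _ _ (by simp)] at h2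
      simpa using h2
    · intro j _ hj
      rw [Fam.mul_apply, Fam.X_apply, coeff_X_mul_of_eq]
      simp [hj.symm]
    · simp

theorem step_of_radial {B : Matrix (Fin d) (Fin d) (Fam U)} (hB : Radial B) :
    h.step B = (h.jet.jacobi + h.jet.covZ B + B * B).map (Fam.scale 1) := by
  funext i k
  rw [step, Matrix.map_apply]
  congr 1
  exact h.jet.contract_flat B hB i k

/-- The recursion determines the part of degree `N` from those of lower degree. -/
theorem step_agree {B : Matrix (Fin d) (Fin d) (Fam U)} (hB : Radial B) (N : ℕ)
    (hN : ∀ m < N, MVan m (B - h.noLoop m)) : MVan N (h.step B - h.noLoop N) := by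
  rw [h.step_of_radial hB]
  cases N with
  | zero =>
    rw [noLoop_zero, sub_zero]
    intro i k
    refine Fam.Van.scale ?_
    exact MVan.add (MVan.add (h.jacobi_van (by omega)) (h.covZ_van_zero B))
      (MVan.mul fun a b hab => Or.inl (by obtain rfl : a = 0 := by omega
                                          exact hB.van)) i k
  | succ n =>
    set Q := (if n = 1 then h.jet.jacobi else 0) + h.jet.covZ (h.noLoop n) +
      ∑ a : Fin n, h.noLoop (a + 1) * h.noLoop (n - a) with hQ
    -- Before scaling, the three terms agree in degree n + 1 one by one: the curvature term is
    -- quadratic, `covZ` raises the degree by one, and the factors of the product have no constant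
    -- term.
    have key : MVan (n + 1) (h.jet.jacobi + h.jet.covZ B + B * B - Q) := by
      have e : h.jet.jacobi + h.jet.covZ B + B * B - Q =
          (h.jet.jacobi - if n = 1 then h.jet.jacobi else 0) +
          h.jet.covZ (B - h.noLoop n) +
          (B * B - ∑ a : Fin n, h.noLoop (a + 1) * h.noLoop (n - a)) := by
        have : h.jet.covZ (B - h.noLoop n) = h.jet.covZ B - h.jet.covZ (h.noLoop n) := by
          rw [eq_sub_iff_add_eq, ← JetConn.covZ_add, sub_add_cancel]
        rw [hQ, this]
        abel
      rw [e]
      refine MVan.add (MVan.add ?_ (h.covZ_van (hN n (by omega)))) fun i k u => ?_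
      · split_ifs with h1
        · rw [sub_self]; exact MVan.zero _
        · rw [sub_zero]; exact h.jacobi_van (by omega)
      · rw [Matrix.sub_apply, Matrix.sum_apply, Matrix.mul_apply]
        simp only [Matrix.mul_apply]
        rw [Finset.sum_comm, ← Finset.sum_sub_distrib, Fam.sum_apply]
        refine VanAt.sum fun l _ => ?_
        rw [Fam.sub_apply, Fam.sum_apply]
        simp only [Fam.mul_apply]
        exact VanAt.mul_sub_sum (F := fun m => h.noLoop m i l u) (G := fun m => h.noLoop m l k u) n
          (fun m b hb => h.noLoop_van m b hb i l u) (fun m b hb => h.noLoop_van m b hb l k u)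
          (fun m hm => hN m (by omega) i l u) (fun m hm => hN m (by omega) l k u)
          (hB.van i l u) (hB.van l k u)
    intro i k u α hα
    have hk := key i k u α hα
    rw [Matrix.sub_apply, Fam.sub_apply, map_sub, sub_eq_zero] at hk ⊢
    rw [Matrix.map_apply, Fam.scale_apply, coeff_scaleInv, hk, noLoop_succ, Matrix.smul_apply, Fam.smul_apply,
      MvPowerSeries.coeff_smul, hα]
    push_cast
    rw [div_eq_mul_inv, mul_comm, one_div]
    congr 2
    ring

/-- The solution of Fedosov's equation is given by the no-loop polynomials. -/
theorem agree_of_step_eq {B : Matrix (Fin d) (Fin d) (Fam U)} (hB : h.step B = B) (N : ℕ) :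
    MVan N (B - h.noLoop N) := by
  -- A fixed point lies in the image of the step and is therefore radial automatically.
  have hr : Radial B := hB ▸ h.radial_step B
  induction N using Nat.strong_induction_on with
  | _ N ih =>
    have := h.step_agree hr N ih
    rwa [hB] at this

/-- Apply δ⁻¹ to the flatness equation: the right side becomes Fedosov's step, and the left side
gives B back by `contract_delta` and `scale_euler`. -/
theorem step_eq_of_flat {B : Matrix (Fin d) (Fin d) (Fam U)} (hr : Radial B)
    (hB : ∀ i j k, h.jet.delta B i j k = h.curvTotal B i j k) : h.step B = B := by
  funext i k
  rw [step]
  simp only [← hB]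
  rw [show (∑ j, Fam.X j * h.jet.delta B j i k) = ∑ j, Fam.X j * Fam.dy j (B i k) + B i k from
    h.jet.contract_delta B hr i k, Fam.scale_euler]

/-! #### Comparison with the local formulas -/

theorem curvTotal_apply {A : LV1 d} {B : Matrix (Fin d) (Fin d) (Fam U)}
    (hA : ∀ u : U, ∀ i k, B i k u = A u i k) (i j k : Fin d) (u : U) :
    h.curvTotal B i j k u = (curvV Γ + nablaV Γ A + halfBracket A) u i j k := by
  simp only [curvTotal, Fam.add_apply, curv_apply, h.nabla_apply hA, bracket_apply, hA]
  rfl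

theorem delta_apply {A : LV1 d} {B : Matrix (Fin d) (Fin d) (Fam U)}
    (hA : ∀ u : U, ∀ i k, B i k u = A u i k) (i j k : Fin d) (u : U) :
    h.jet.delta B i j k u = deltaV A u i j k := by
  simp only [JetAlg.delta, deltaV, Fam.sub_apply, dy_eq, Fam.dy_apply, hA]

theorem scaleInv_add (q : ℕ) (f g : Pow d) : scaleInv q (f + g) = scaleInv q f + scaleInv q g := by
  ext α
  simp only [coeff_scaleInv, map_add, add_div]

theorem step_apply {A : LV1 d} {B : Matrix (Fin d) (Fin d) (Fam U)}
    (hA : ∀ u : U, ∀ i k, B i k u = A u i k) (i k : Fin d) (u : U) :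
    h.step B i k u = fedosovStep Γ A u i k := by
  rw [step, Fam.scale_sum, Fam.sum_apply]
  simp only [← Fam.X_mul_scale, Fam.mul_apply, Fam.X_apply, Fam.scale_apply, h.curvTotal_apply hA]
  rw [fedosovStep]
  simp only [Pi.add_apply, deltaInvV2, scaleInv_add, mul_add, Finset.sum_add_distrib, add_assoc]

theorem radial_iff {A : LV1 d} {B : Matrix (Fin d) (Fin d) (Fam U)}
    (hA : ∀ u : U, ∀ i k, B i k u = A u i k) :
    Radial B ↔ ∀ u ∈ U, deltaInvV1 A u = 0 := by
  have key : ∀ (u : U) k, deltaInvV1 A u k = scaleInv 0 ((∑ i, Fam.X i * B i k : Fam U) u) := by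
    intro u k
    rw [← Fam.scale_apply, Fam.scale_sum, Fam.sum_apply]
    simp only [← Fam.X_mul_scale, Fam.mul_apply, Fam.X_apply, Fam.scale_apply, deltaInvV1, hA]
  constructor
  · intro hr u hu
    funext k
    rw [key ⟨u, hu⟩, hr k]
    ext α
    simp [coeff_scaleInv]
  · intro hr k
    refine Fam.ext' fun u => ?_
    have h1 := key u k
    rw [hr u u.2] at h1
    ext α
    -- In degree 0 `scaleInv 0` divides by zero and its value carries no information, but ∑ yⁱ Bᵢᵏ
    -- has no constant term in any case.
    by_cases hα : α.degree = 0
    · rw [Fam.sum_apply, map_sum]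
      simp only [Fam.mul_apply, Fam.X_apply, Fam.zero_apply, map_zero]
      exact Finset.sum_eq_zero fun i _ => VanAt.X_mul_zero i α hα
    · have h2 := congrArg (MvPowerSeries.coeff α) h1
      rw [coeff_scaleInv, Pi.zero_apply, map_zero] at h2
      have h3 : (α.degree : ℝ) + ((0 : ℕ) : ℝ) ≠ 0 := by simpa using hα
      rw [Fam.zero_apply, map_zero]
      exact (div_eq_zero_iff.mp h2.symm).resolve_right h3

theorem iterate_step_apply (n : ℕ) (i k : Fin d) (u : U) :
    (h.step^[n] 0) i k u = ((fedosovStep Γ)^[n] 0) u i k := by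
  induction n generalizing i k u with
  | zero => rfl
  | succ n ih =>
    rw [Function.iterate_succ_apply', Function.iterate_succ_apply']
    exact h.step_apply (fun u i k => ih i k u) i k u

/-- Each step makes one more degree correct, since degree N of its output depends only on lower
degrees of its input. This justifies reading off degree N after N steps in `fedosovLocal`. -/
theorem iterate_step_agree (n N : ℕ) (hN : N ≤ n) :
    MVan N (h.step^[n] 0 - h.noLoop N) := by
  have hr : ∀ n, Radial (h.step^[n] 0) := by
    intro n
    cases n with
    | zero => intro k; simp
    | succ n => rw [Function.iterate_succ_apply']; exact h.radial_step _
  induction n generalizing N with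
  | zero =>
    obtain rfl : N = 0 := by omega
    rw [noLoop_zero]
    simpa using MVan.zero 0
  | succ n ih =>
    rw [Function.iterate_succ_apply']
    exact h.step_agree (hr n) N fun m hm => ih m (by omega)

/-- The form of the Fedosov construction is given by the no-loop polynomials. -/
theorem coeff_fedosovLocal (i k : Fin d) (u : U) (α : Fin d →₀ ℕ) :
    MvPowerSeries.coeff α (fedosovLocal Γ u i k) =
      MvPowerSeries.coeff α (h.noLoop α.degree i k u) := by
  have := h.iterate_step_agree α.degree α.degree le_rfl i k u α rfl
  rw [Matrix.sub_apply, Fam.sub_apply, map_sub, sub_eq_zero, iterate_step_apply] at this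
  exact this

theorem eq_fedosovLocal {A : LV1 d} {B : Matrix (Fin d) (Fin d) (Fam U)}
    (hA : ∀ u : U, ∀ i k, B i k u = A u i k) (hB : h.step B = B) (u : U) :
    A u = fedosovLocal Γ u := by
  funext i k
  ext α
  rw [coeff_fedosovLocal h, ← hA]
  have := h.agree_of_step_eq hB α.degree i k u α rfl
  rwa [Matrix.sub_apply, Fam.sub_apply, map_sub, sub_eq_zero] at this

end SmoothConn

end Recursion

/-! ### The formal exponential map -/

section FormalExp

variable {d : ℕ} {U : Opens (Model d)} {Γ : Chris d} (h : SmoothConn U Γ)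

/-- For `E` the spray, which raises the degree by one, and f independent of y, the term Zⁿf / n! is
homogeneous of degree n. It thus supplies exactly the coefficients of that degree, and no infinite
sum has to be formed. -/
theorem Fam.iterate_smooth (E : Fam U → Fam U) (f : Fam U) :
    SmoothFamOn U (fun u => fun α : Fin d →₀ ℕ =>
      MvPowerSeries.coeff α (extd (E^[α.degree] f).1 u) / (α.degree.factorial : ℝ) : Model d → Pow d) :=
  fun α => ((E^[α.degree] f).smooth α).div_const _

theorem contDiffOn_coord (j : Fin d) : ContDiffOn ℝ ∞ (fun u : Model d => u j) U := by
  fun_prop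

theorem fderiv_coord (j i : Fin d) (u : Model d) :
    fderiv ℝ (fun u : Model d => u j) u (stdVec d i) = if i = j then 1 else 0 := by
  have : (fun u : Model d => u j) = EuclideanSpace.proj (𝕜 := ℝ) j := rfl
  rw [this, ContinuousLinearMap.fderiv]
  simp [stdVec, eq_comm]

namespace SmoothConn

/-- The formal series `∑ Zⁿ f / n!` of `f ∘ exp`. -/
def lift (f : Fam U) : Fam U := Fam.res _ (Fam.iterate_smooth h.jet.Z f)

theorem coeff_lift (f : Fam U) (u : U) (α : Fin d →₀ ℕ) :
    MvPowerSeries.coeff α (h.lift f u) =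
      MvPowerSeries.coeff α ((h.jet.Z^[α.degree] f) u) / (α.degree.factorial : ℝ) :=
  congrArg (fun t => MvPowerSeries.coeff α t / (α.degree.factorial : ℝ))
    (extd_apply (h.jet.Z^[α.degree] f).1 u)

/-- In degree n + 1, Z maps Zⁿf / n! to n + 1 times Zⁿ⁺¹f / (n + 1)!, and n + 1 is the eigenvalue of
the Euler operator. For the coordinates this is the geodesic equation of the formal exponential map.
-/
theorem Z_lift (f : Fam U) : h.jet.Z (h.lift f) = ∑ k, Fam.X k * Fam.dy k (h.lift f) :=
  Fam.ext' fun u => by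
    ext α
    rw [Fam.sum_apply]
    simp only [Fam.mul_apply, Fam.X_apply, Fam.dy_apply]
    rw [coeff_euler]
    rcases hn : α.degree with _ | n
    · rw [h.Z_van_zero _ u α hn]
      simp
    -- As Z raises the degree by one, in degree n + 1 of Z applied to the lift the lift may be
    -- replaced by Zⁿf / n!, with which it agrees in degree n.
    · have hv : Fam.Van n (h.lift f - (1 / (n.factorial : ℝ)) • (h.jet.Z^[n] f)) := by
        intro v β hβ
        rw [Fam.sub_apply, map_sub, coeff_lift, hβ, Fam.smul_apply, MvPowerSeries.coeff_smul]
        ring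
      have h1 := h.Z_van hv u α hn
      rw [map_sub, Derivation.map_smul, Fam.sub_apply, map_sub, sub_eq_zero] at h1
      rw [h1, coeff_lift, hn, Function.iterate_succ_apply', Fam.smul_apply,
        MvPowerSeries.coeff_smul, Nat.factorial_succ]
      have : (n.factorial : ℝ) ≠ 0 := by positivity
      push_cast
      field_simp

/-- The formal exponential map. -/
def phi (j : Fin d) : Fam U := h.lift (Fam.C _ (contDiffOn_coord j))

theorem Z_C (g : Model d → ℝ) (hg : ContDiffOn ℝ ∞ g U) :
    h.jet.Z (Fam.C g hg) = ∑ i, Fam.X i * Fam.C _ (Fam.contDiffOn_partial hg i) := by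
  rw [h.jet.Z_of_dy _ fun l => Fam.dy_C l g hg]
  exact Finset.sum_congr rfl fun i _ => by rw [dx_eq, Fam.dx_C, X_eq]

theorem coeff_single_phi (j k : Fin d) (u : U) :
    MvPowerSeries.coeff (Finsupp.single k 1) (h.phi j u) = if k = j then 1 else 0 := by
  classical
  rw [phi, coeff_lift]
  simp only [Finsupp.degree_single, Function.iterate_one, Nat.factorial_one, Nat.cast_one, div_one]
  rw [Z_C, Fam.sum_apply, map_sum, Finset.sum_eq_single k]
  · rw [Fam.mul_apply, Fam.X_apply, coeff_X_mul_of_ne _ _ _ (by simp), Fam.C_apply, fderiv_coord]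
    simp
  · intro i _ hi
    rw [Fam.mul_apply, Fam.X_apply, coeff_X_mul_of_eq]
    simp [hi.symm]
  · simp

/-- The Jacobian of the formal exponential map. -/
def jacPhi : Matrix (Fin d) (Fin d) (Fam U) := fun j k => Fam.dy k (h.phi j)

/-- The linear part of φ is y, so its Jacobian at y = 0 is the identity and the determinant has
constant term 1. -/
theorem isUnit_det_jacPhi : IsUnit h.jacPhi.det := by
  refine Fam.isUnit_of_constantCoeff _ fun u => ?_
  have h1 : (Matrix.map h.jacPhi (MvPowerSeries.constantCoeff.comp (Fam.eval u))) = 1 := by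
    ext j k
    rw [Matrix.map_apply, RingHom.comp_apply, Fam.eval_apply, jacPhi, Fam.dy_apply,
      ← MvPowerSeries.coeff_zero_eq_constantCoeff_apply, pdy, MvPowerSeries.coeff_pderiv, zero_add,
      coeff_single_phi, Matrix.one_apply]
    simp [eq_comm]
  have h2 := RingHom.map_det (MvPowerSeries.constantCoeff.comp (Fam.eval u)) h.jacPhi
  rw [RingHom.mapMatrix_apply, h1, Matrix.det_one, RingHom.comp_apply, Fam.eval_apply] at h2
  rw [h2]
  exact one_ne_zero

/-- The velocity of the formal exponential map. -/
def vel : Fin d → Fin d → Fam U := fun i k => -∑ j, h.jacPhi⁻¹ k j * Fam.dx i (h.phi j)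

/-- `vel` is the solution V of the linear system ∂φ/∂y · V = -∂φ/∂x, which says that the corrected
fields annihilate φ. -/
theorem vel_kill (i j : Fin d) : h.jet.D h.vel i (h.phi j) = 0 := by
  rw [JetAlg.D_apply]
  have h1 : ∑ k, h.vel i k * h.jet.dy k (h.phi j) =
      -(h.jacPhi * h.jacPhi⁻¹).mulVec (fun j => Fam.dx i (h.phi j)) j := by
    rw [← Matrix.mulVec_mulVec, Matrix.mulVec, dotProduct, ← Finset.sum_neg_distrib]
    refine Finset.sum_congr rfl fun k _ => ?_
    rw [vel, Matrix.mulVec, dotProduct, dy_eq, jacPhi]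
    ring
  rw [h1, Matrix.mul_nonsing_inv _ h.isUnit_det_jacPhi, Matrix.one_mulVec]
  exact add_neg_cancel _

theorem jacPhi_inj (W : Fin d → Fam U) (hW : ∀ j, ∑ k, W k * h.jet.dy k (h.phi j) = 0) :
    W = 0 := by
  have h1 : h.jacPhi.mulVec W = 0 := by
    funext j
    rw [Pi.zero_apply, ← hW j, Matrix.mulVec, dotProduct]
    exact Finset.sum_congr rfl fun k _ => mul_comm _ _
  rw [← Matrix.one_mulVec W, ← Matrix.nonsing_inv_mul _ h.isUnit_det_jacPhi,
    ← Matrix.mulVec_mulVec, h1, Matrix.mulVec_zero]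

/-- The connection form of the Grothendieck connection. -/
def conForm : Matrix (Fin d) (Fin d) (Fam U) :=
  fun i k => h.vel i k + (if i = k then 1 else 0) - h.jet.conn i k

theorem vel_eq (i k : Fin d) :
    h.vel i k = -(if i = k then 1 else 0) + h.jet.conn i k + h.conForm i k := by
  rw [conForm]
  ring

theorem radial_conForm : Radial h.conForm :=
  h.jet.radial_of_kill h.vel h.phi h.jacPhi_inj h.vel_kill (fun _ => h.Z_lift _) h.conForm h.vel_eq

/-- The corrected fields kill φ and hence commute, and by `curvature_eq` their commutator is the
defect of the flatness equation. -/
theorem flat_conForm (i j k : Fin d) :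
    h.jet.delta h.conForm i j k = h.curvTotal h.conForm i j k := by
  have h1 := h.jet.flat_of_kill h.vel h.phi h.jacPhi_inj h.vel_kill i j k
  rw [h.jet.curvature_eq h.conForm h.vel h.vel_eq] at h1
  exact (sub_eq_zero.mp h1).symm

theorem step_conForm : h.step h.conForm = h.conForm :=
  h.step_eq_of_flat h.radial_conForm h.flat_conForm

/-- This is the local comparison of the two constructions: the form read off from the exponential
map is radial and flat, so it is a fixed point of Fedosov's step, and all fixed points have the same
homogeneous parts. -/
theorem conForm_apply (i k : Fin d) (u : U) : h.conForm i k u = fedosovLocal Γ u i k := by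
  have := h.eq_fedosovLocal (A := fun v i k => extd (h.conForm i k).1 v) (B := h.conForm)
    (fun u i k => (extd_apply _ u).symm) h.step_conForm u
  rw [← this]
  exact (extd_apply _ u).symm

/-- Smoothness comes from the Grothendieck side: the form agrees with `conForm`, whose entries
belong to the ring of smooth families. -/
theorem fedosovLocal_smooth (h : SmoothConn U Γ) (i k : Fin d) : SmoothFamOn U fun u => fedosovLocal Γ u i k :=
  (h.conForm i k).smooth.congr fun u hu => by
    rw [← h.conForm_apply i k ⟨u, hu⟩]
    exact (extd_apply (h.conForm i k).1 ⟨u, hu⟩).symm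

/-- The Grothendieck connection in coordinates. -/
theorem jetVelocity_eq {φ : Model d → Fin d → Pow d} (hφ : ∀ (u : U) j, φ u j = h.phi j u) (u : U)
    (i k : Fin d) : jetVelocity φ u i k =
      -(if i = k then 1 else 0) + conV Γ u i k + fedosovLocal Γ u i k := by
  have hJ : jacY φ u = h.jacPhi.map (Fam.eval u) := by
    ext1 j k
    rw [Matrix.map_apply, Fam.eval_apply, jacPhi, Fam.dy_apply, jacY, Matrix.of_apply, hφ]
  have hJi : (jacY φ u)⁻¹ = h.jacPhi⁻¹.map (Fam.eval u) := by
    refine Matrix.inv_eq_left_inv ?_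
    rw [hJ]
    have h1 := congrArg (RingHom.mapMatrix (Fam.eval u))
      (Matrix.nonsing_inv_mul _ h.isUnit_det_jacPhi)
    rwa [map_mul, map_one] at h1
  have h2 : jetVelocity φ u i k = h.vel i k u := by
    rw [jetVelocity, vel, Fam.neg_apply, Fam.sum_apply, hJi]
    congr 1
    refine Finset.sum_congr rfl fun j _ => ?_
    rw [Fam.mul_apply, Fam.dx_apply' i (h.phi j) (F := fun v => φ v j) fun v => (hφ v j).symm]
    rfl
  rw [h2, vel_eq, Fam.add_apply, Fam.add_apply, conForm_apply, conn_apply, Fam.neg_apply]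
  congr 3
  split_ifs <;> rfl

theorem grothendieckLocal_eq {φ : Model d → Fin d → Pow d} (hφ : ∀ (u : U) j, φ u j = h.phi j u)
    {q : ℕ} (η : LForm d q) (u : U) : grothendieckLocal φ η u =
      (-deltaForm η + nablaForm Γ η + actForm (fedosovLocal Γ) η) u := by
  funext I
  simp only [grothendieckLocal, deltaForm, nablaForm, actForm, wedgeOp, Pi.add_apply, Pi.neg_apply]
  rw [← Finset.sum_neg_distrib, ← Finset.sum_add_distrib, ← Finset.sum_add_distrib]
  refine Finset.sum_congr rfl fun a _ => ?_
  rw [← smul_neg, ← smul_add, ← smul_add]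
  congr 1
  simp only [h.jetVelocity_eq hφ, add_mul, Finset.sum_add_distrib, neg_mul, ite_mul, one_mul,
    zero_mul, Finset.sum_neg_distrib, Finset.sum_ite_eq, Finset.mem_univ, if_true, conV,
    Finset.sum_mul]
  rw [Finset.sum_comm (s := (Finset.univ : Finset (Fin d)))]
  ring

end SmoothConn

end FormalExp

/-! ### Flatness -/

section Flat

/-- `∑ᵢ dxⁱ ∧ Dᵢ` over a ring. -/
def wedgeD {d : ℕ} {R : Type*} [CommRing R] [Algebra ℝ R] (D : Fin d → Derivation ℝ R R) {q : ℕ}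
    (η : (Fin q → Fin d) → R) : (Fin (q + 1) → Fin d) → R :=
  fun I => ∑ a : Fin (q + 1), (-1 : ℝ) ^ (a : ℕ) • D (I a) (η (a.removeNth I))

/-- Two indices can be removed in either order. The two terms contain the same component of η and,
as the derivations commute, the same second derivative, but they carry opposite signs. -/
theorem wedgeD_sq {d : ℕ} {R : Type*} [CommRing R] [Algebra ℝ R] (D : Fin d → Derivation ℝ R R)
    (hD : ∀ i j f, D i (D j f) = D j (D i f)) {q : ℕ} (η : (Fin q → Fin d) → R)
    (I : Fin (q + 2) → Fin d) : wedgeD D (wedgeD D η) I = 0 := by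
  simp only [wedgeD, map_sum, Derivation.map_smul, Finset.smul_sum]
  rw [← Fintype.sum_prod_type']
  refine Finset.sum_involution (fun p _ => (p.1.succAbove p.2, p.2.predAbove p.1)) ?_ ?_
    (fun _ _ => Finset.mem_univ _) ?_
  · rintro ⟨a, b⟩ -
    simp only [Fin.removeNth_apply a I b]
    rw [Fin.removeNth_apply, Fin.succAbove_succAbove_predAbove, hD (I (a.succAbove b)),
      Fin.removeNth_removeNth_eq_swap I b a, smul_smul, smul_smul, ← pow_add, ← pow_add,
      Fin.neg_one_pow_succAbove_add_predAbove, neg_smul, add_neg_cancel]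
  · rintro ⟨a, b⟩ - - h
    exact Fin.succAbove_ne a b (congrArg Prod.fst h)
  · rintro ⟨a, b⟩ -
    simp only [Fin.succAbove_succAbove_predAbove, Fin.predAbove_predAbove_succAbove]

variable {d : ℕ} {U : Opens (Model d)} {Γ : Chris d} (h : SmoothConn U Γ)

/-- The operator `-δ + ∇' + A` in coordinates. -/
def connLocal (Γ : Chris d) (A : LV1 d) {q : ℕ} (η : LForm d q) : LForm d (q + 1) :=
  -deltaForm η + nablaForm Γ η + actForm A η

namespace SmoothConn

/-- The coefficients of `-δ + ∇' + A` as a vertical correction of `∂ᵢ`. -/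
def conVel (B : Matrix (Fin d) (Fin d) (Fam U)) (i k : Fin d) : Fam U :=
  -(if i = k then 1 else 0) + h.jet.conn i k + B i k

theorem D_conVel_apply {A : LV1 d} {B : Matrix (Fin d) (Fin d) (Fam U)}
    (hA : ∀ u : U, ∀ i k, B i k u = A u i k) (i : Fin d) (f : Fam U) {F : Model d → Pow d}
    (hF : ∀ u : U, f u = F u) (u : U) :
    h.jet.D (h.conVel B) i f u = -pdy i (F u) + (pdx i F u -
      ∑ j, ∑ k, MvPowerSeries.C (Γ u i j k) * MvPowerSeries.X j * pdy k (F u)) +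
      ∑ k, A u i k * pdy k (F u) := by
  rw [JetAlg.D_apply, Fam.add_apply, Fam.sum_apply, dx_eq, Fam.dx_apply' i f hF]
  simp only [Fam.mul_apply, dy_eq, Fam.dy_apply, conVel, Fam.add_apply, conn_apply, hA, hF,
    add_mul, Finset.sum_add_distrib, Fam.neg_apply]
  have e1 : ∑ k, -(((if i = k then (1 : Fam U) else 0) : Fam U) u) * pdy k (F u) =
      -pdy i (F u) := by
    rw [Finset.sum_eq_single i]
    · simp
    · intro k _ hk
      simp [hk.symm]
    · simp
  rw [e1]
  simp only [conV, neg_mul, Finset.sum_neg_distrib, Finset.sum_mul]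
  rw [Finset.sum_comm]
  ring

theorem connLocal_apply {A : LV1 d} {B : Matrix (Fin d) (Fin d) (Fam U)}
    (hA : ∀ u : U, ∀ i k, B i k u = A u i k) {q : ℕ} {η : LForm d q} {θ : (Fin q → Fin d) → Fam U}
    (hη : ∀ (u : U) I, θ I u = η u I) (u : U) (I : Fin (q + 1) → Fin d) :
    wedgeD (h.jet.D (h.conVel B)) θ I u = connLocal Γ A η u I := by
  rw [wedgeD, Fam.sum_apply, connLocal]
  simp only [deltaForm, nablaForm, actForm, wedgeOp, Pi.add_apply, Pi.neg_apply]
  rw [← Finset.sum_neg_distrib, ← Finset.sum_add_distrib, ← Finset.sum_add_distrib]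
  refine Finset.sum_congr rfl fun a _ => ?_
  rw [← smul_neg, ← smul_add, ← smul_add, Fam.smul_apply,
    h.D_conVel_apply hA (I a) (θ (a.removeNth I)) (F := fun v => η v (a.removeNth I))
      (fun v => hη v _)]

/-- For arbitrary B the commutator is the defect of the flatness equation, acting as a vertical
field. Both directions of the flatness criterion rest on this. -/
theorem D_comm_eq (B : Matrix (Fin d) (Fin d) (Fam U)) (i j : Fin d) (f : Fam U) :
    h.jet.D (h.conVel B) i (h.jet.D (h.conVel B) j f) -
      h.jet.D (h.conVel B) j (h.jet.D (h.conVel B) i f) =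
    ∑ k, (h.curvTotal B i j k - h.jet.delta B i j k) * Fam.dy k f := by
  rw [h.jet.D_comm]
  refine Finset.sum_congr rfl fun k _ => ?_
  rw [h.jet.curvature_eq B (h.conVel B) (fun i k => rfl)]
  rfl

/-- The flatness equation implies that the operator `-δ + ∇' + A` has square zero. -/
theorem connLocal_sq {A : LV1 d} {B : Matrix (Fin d) (Fin d) (Fam U)}
    (hA : ∀ u : U, ∀ i k, B i k u = A u i k)
    (hB : ∀ i j k, h.jet.delta B i j k = h.curvTotal B i j k) {q : ℕ} {η : LForm d q}
    (hη : ∀ I, SmoothFamOn U fun u => η u I) (u : U) :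
    connLocal Γ A (connLocal Γ A η) u = 0 := by
  funext I
  rw [← h.connLocal_apply hA (θ := wedgeD (h.jet.D (h.conVel B)) fun I => Fam.res _ (hη I))
    (fun u I => h.connLocal_apply hA (fun _ _ => rfl) u I), wedgeD_sq]
  · rfl
  · intro i j f
    rw [← sub_eq_zero, D_comm_eq]
    simp [hB]

/-- The square of `-δ + ∇' + A` on a function that is equal to `yᵏ` near a point. -/
theorem connLocal_sq_coord {A : LV1 d} {B : Matrix (Fin d) (Fin d) (Fam U)}
    (hA : ∀ u : U, ∀ i k, B i k u = A u i k) (k : Fin d) {η : LForm d 0}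
    (hη : ∀ u ∈ U, ∀ I, η u I = MvPowerSeries.X k) (i j : Fin d) (u : U) :
    connLocal Γ A (connLocal Γ A η) u ![i, j] =
      (h.curvTotal B i j k - h.jet.delta B i j k) u := by
  rw [← h.connLocal_apply hA (θ := wedgeD (h.jet.D (h.conVel B)) fun _ => Fam.X k)
    (fun u I => h.connLocal_apply hA (fun u I => (hη u u.2 I).symm) u I)]
  have : wedgeD (h.jet.D (h.conVel B)) (wedgeD (h.jet.D (h.conVel B)) fun _ => Fam.X k) ![i, j] =
      h.curvTotal B i j k - h.jet.delta B i j k := by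
    -- Applied to yᵏ, the vertical field returns its k-th component.
    have h1 := h.D_comm_eq B i j (Fam.X k)
    rw [Finset.sum_eq_single k] at h1
    · rw [Fam.dy_X, if_pos rfl, mul_one] at h1
      rw [← h1]
      simp [wedgeD, Fin.sum_univ_two, Fin.removeNth]
      ring
    · intro l _ hl
      rw [Fam.dy_X, if_neg hl.symm, mul_zero]
    · simp
  rw [this]

/-- Since Aᵢ sends yᵏ to Aᵢᵏ, the components of A can be recovered from the operator on sections
that look like yᵏ. -/
theorem connLocal_coord {A : LV1 d} (k : Fin d) {η : LForm d 0} {u : Model d}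
    (hη : ∀ I, η u I = MvPowerSeries.X k) (i : Fin d) :
    actForm A η u ![i] = A u i k := by
  classical
  simp only [actForm, wedgeOp, hη, Nat.reduceAdd, Fin.sum_univ_one]
  rw [Finset.sum_eq_single k]
  · simp [pdy]
  · intro l _ hl
    simp [pdy, MvPowerSeries.pderiv_X_of_ne hl.symm]
  · simp

end SmoothConn

end Flat

/-! ### Changes of coordinates over a ring -/

section Natural

variable {d : ℕ} {R R' : Type*} [CommRing R] [Algebra ℝ R] [CommRing R'] [Algebra ℝ R']

/-- A change of coordinates: `Ψ` is the pull-back, `J k a` is the Jacobian `∂x'ᵏ/∂xᵃ`. -/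
structure JetMap (S : JetConn d R) (S' : JetConn d R') where
  -- The fields record what is needed to compare the two connections. That Ψ intertwines the sprays
  -- is not among them: it enters below as the hypothesis `hZ`, which `Z_pull` supplies for smooth
  -- families.
  Ψ : R' →+* R
  J : Fin d → Fin d → R
  map_X : ∀ k, Ψ (S'.X k) = ∑ m, J k m * S.X m
  dx_J : ∀ i c m, S.dx i (J c m) = S.dx m (J c i)
  dy_J : ∀ l c m, S.dy l (J c m) = 0
  law : ∀ i j l, ∑ k, J l k * S.Γ i j k =
    S.dx i (J l j) + ∑ r, ∑ s, Ψ (S'.Γ r s l) * J r i * J s j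
  dx_map_Γ : ∀ i r s l, S.dx i (Ψ (S'.Γ r s l)) = ∑ a, J a i * Ψ (S'.dx a (S'.Γ r s l))

namespace JetConn

variable (S : JetConn d R)

/-- `Γ_{jm}^k yʲ yᵐ`. -/
def Q (k : Fin d) : R := ∑ j, ∑ m, S.X j * S.X m * S.Γ j m k

theorem Z_X' (k : Fin d) : S.Z (S.X k) = -S.Q k := by
  simp only [Z_apply, S.dx_X, mul_zero, Finset.sum_const_zero, zero_add, S.dy_X, mul_ite, mul_one,
    Finset.sum_ite_eq, Finset.mem_univ, if_true, conn, Q, mul_neg, Finset.sum_neg_distrib,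
    Finset.mul_sum]
  congr 1
  exact Finset.sum_congr rfl fun _ _ => Finset.sum_congr rfl fun _ _ => by ring

theorem Z_of_dy_eq_zero {f : R} (hf : ∀ l, S.dy l f = 0) : S.Z f = ∑ j, S.X j * S.dx j f := by
  simp [Z_apply, hf]

/-- By symmetry of Γ, Nᵢᵏ is half of ∂Qᵏ/∂yⁱ. Through Q and N the contracted curvature involves only
quantities with simple transformation laws, so covariance of the full tensor is never needed. -/
theorem jacobi_eq : S.jacobi = Matrix.of (fun i k => S.dx i (S.Q k)) - S.N.map S.Z - S.N * S.N := by
  ext i k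
  have h1 : S.Z (S.N i k) = ∑ m, (∑ j, S.X j * S.X m * S.dx j (S.Γ m i k)) -
      ∑ m, S.Q m * S.Γ m i k := by
    simp only [N, map_sum, Derivation.leibniz, smul_eq_mul, Z_X',
      S.Z_of_dy_eq_zero (fun l => S.dy_Γ l _ _ _)]
    rw [← Finset.sum_sub_distrib]
    refine Finset.sum_congr rfl fun m _ => ?_
    rw [Finset.mul_sum, mul_neg, ← sub_eq_add_neg, mul_comm (S.Γ m i k)]
    congr 1
    exact Finset.sum_congr rfl fun j _ => by ring
  have h2 : S.dx i (S.Q k) = ∑ j, ∑ m, S.X j * S.X m * S.dx i (S.Γ j m k) := by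
    simp [Q, S.dx_X]
  have h3 : ∑ m, S.Q m * S.Γ m i k = ∑ j, ∑ m, S.X j * S.X m * ∑ n, S.Γ i n k * S.Γ j m n := by
    simp only [Q, Finset.sum_mul, Finset.mul_sum]
    rw [Finset.sum_comm]
    refine Finset.sum_congr rfl fun j _ => ?_
    rw [Finset.sum_comm]
    refine Finset.sum_congr rfl fun m _ => Finset.sum_congr rfl fun n _ => ?_
    rw [S.symm n i k]
    ring
  have h4 : (S.N * S.N) i k = ∑ j, ∑ m, S.X j * S.X m * ∑ n, S.Γ j n k * S.Γ i m n := by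
    simp only [Matrix.mul_apply, N, Finset.sum_mul_sum]
    rw [Finset.sum_comm, Finset.sum_congr rfl fun m _ => Finset.sum_comm, Finset.sum_comm]
    refine Finset.sum_congr rfl fun j _ => Finset.sum_congr rfl fun m _ => ?_
    rw [Finset.mul_sum]
    exact Finset.sum_congr rfl fun n _ => by rw [S.symm m i n]; ring
  rw [Matrix.sub_apply, Matrix.sub_apply, Matrix.of_apply, Matrix.map_apply, h1, h2, h3, h4,
    Finset.sum_comm (f := fun m j => S.X j * S.X m * S.dx j (S.Γ m i k)), jacobi]
  rw [sub_sub_eq_add_sub, ← Finset.sum_add_distrib, ← Finset.sum_sub_distrib,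
    ← Finset.sum_sub_distrib]
  refine Finset.sum_congr rfl fun j _ => ?_
  rw [← Finset.sum_add_distrib, ← Finset.sum_sub_distrib, ← Finset.sum_sub_distrib]
  refine Finset.sum_congr rfl fun m _ => ?_
  rw [riem, Finset.sum_sub_distrib, S.symm m i k]
  ring

end JetConn

namespace JetMap

variable {S : JetConn d R} {S' : JetConn d R'} (F : JetMap S S')

/-- The transposed Jacobian. -/
def jacT : Matrix (Fin d) (Fin d) R := Matrix.of fun k l => F.J l k

/-- The matrices `B`, `B'` correspond to each other. -/
def Rel (B : Matrix (Fin d) (Fin d) R) (B' : Matrix (Fin d) (Fin d) R') : Prop :=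
  B * F.jacT = F.jacT * F.Ψ.mapMatrix B'

variable {F}

namespace Rel

variable {B C : Matrix (Fin d) (Fin d) R} {B' C' : Matrix (Fin d) (Fin d) R'}

theorem add (hB : F.Rel B B') (hC : F.Rel C C') : F.Rel (B + C) (B' + C') := by
  rw [Rel, map_add, add_mul, mul_add, hB, hC]

theorem mul (hB : F.Rel B B') (hC : F.Rel C C') : F.Rel (B * C) (B' * C') := by
  rw [Rel, map_mul, mul_assoc, hC, ← mul_assoc, hB, mul_assoc]

theorem zero : F.Rel 0 0 := by
  rw [Rel, map_zero, zero_mul, mul_zero]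

theorem sum {ι : Type*} {s : Finset ι} {B : ι → Matrix (Fin d) (Fin d) R}
    {B' : ι → Matrix (Fin d) (Fin d) R'} (h : ∀ a ∈ s, F.Rel (B a) (B' a)) :
    F.Rel (∑ a ∈ s, B a) (∑ a ∈ s, B' a) := by
  rw [Rel, map_sum, Finset.sum_mul, Finset.mul_sum]
  exact Finset.sum_congr rfl h

theorem smul (hΨ : ∀ (r : ℝ) f, F.Ψ (r • f) = r • F.Ψ f) (r : ℝ) (hB : F.Rel B B') :
    F.Rel (r • B) (r • B') := by
  have : F.Ψ.mapMatrix (r • B') = r • F.Ψ.mapMatrix B' := by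
    ext i k
    simp [hΨ]
  rw [Rel, this, Matrix.smul_mul, Matrix.mul_smul, hB]

end Rel

theorem map_Z_mul (B C : Matrix (Fin d) (Fin d) R) :
    (B * C).map S.Z = B.map S.Z * C + B * C.map S.Z := by
  ext i k
  simp only [Matrix.map_apply, Matrix.mul_apply, Matrix.add_apply, map_sum, Derivation.leibniz,
    smul_eq_mul, Finset.sum_add_distrib]
  rw [add_comm]
  congr 1
  exact Finset.sum_congr rfl fun _ _ => mul_comm _ _

theorem Z_J (l i : Fin d) : S.Z (F.J l i) = ∑ j, S.X j * S.dx j (F.J l i) :=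
  S.Z_of_dy_eq_zero fun _ => F.dy_J _ _ _

/-- This is the Christoffel law with one lower index contracted with y: N transforms like a
connection matrix along Z, with inhomogeneous term Z(J). -/
theorem N_mul_jacT : S.N * F.jacT = F.jacT.map S.Z + F.jacT * F.Ψ.mapMatrix S'.N := by
  ext i l
  rw [Matrix.add_apply, Matrix.map_apply, jacT, Matrix.of_apply, Z_J]
  simp only [Matrix.mul_apply, Matrix.of_apply, JetConn.N, RingHom.mapMatrix_apply,
    Matrix.map_apply, map_sum, map_mul, F.map_X]
  have : ∀ j, ∑ k, S.X j * S.Γ j i k * F.J l k = S.X j * S.dx j (F.J l i) +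
      ∑ r, ∑ s, S.X j * (F.Ψ (S'.Γ r s l) * F.J r j * F.J s i) := by
    intro j
    simp only [← Finset.mul_sum]
    rw [← mul_add, ← F.law, Finset.mul_sum]
    exact Finset.sum_congr rfl fun k _ => by ring
  rw [Finset.sum_congr rfl fun k _ => Finset.sum_mul _ _ _, Finset.sum_comm]
  rw [Finset.sum_congr rfl fun j _ => this j, Finset.sum_add_distrib]
  congr 1
  rw [Finset.sum_comm, Finset.sum_congr rfl fun r _ => Finset.sum_comm, Finset.sum_comm]
  refine Finset.sum_congr rfl fun s _ => ?_
  rw [Finset.mul_sum]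
  refine Finset.sum_congr rfl fun r _ => ?_
  rw [Finset.sum_mul, Finset.mul_sum]
  exact Finset.sum_congr rfl fun j _ => by ring

/-- The inhomogeneous term of N compensates the derivative of the transition matrix that appears
when Z is applied to the relation between B and B'. -/
theorem Rel.covZ (hZ : ∀ f, S.Z (F.Ψ f) = F.Ψ (S'.Z f)) {B : Matrix (Fin d) (Fin d) R}
    {B' : Matrix (Fin d) (Fin d) R'} (hB : F.Rel B B') : F.Rel (S.covZ B) (S'.covZ B') := by
  have h1 := congrArg (fun M : Matrix (Fin d) (Fin d) R => M.map S.Z) hB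
  simp only [map_Z_mul] at h1
  have h2 : (F.Ψ.mapMatrix B').map S.Z = F.Ψ.mapMatrix (B'.map S'.Z) := by
    ext i k
    simp [hZ]
  rw [h2] at h1
  have h3 := N_mul_jacT (F := F)
  rw [Rel] at hB ⊢
  simp only [JetConn.covZ, map_sub, map_add, map_mul, sub_mul, add_mul, mul_add, mul_sub]
  rw [mul_assoc B, h3, mul_assoc S.N, hB, mul_add, ← mul_assoc S.N, h3, add_mul,
    ← mul_assoc B, hB, ← add_assoc, h1]
  noncomm_ring

theorem dx_map_X (i r : Fin d) : S.dx i (F.Ψ (S'.X r)) = S.Z (F.J r i) := by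
  rw [F.map_X, Z_J, map_sum]
  refine Finset.sum_congr rfl fun m _ => ?_
  rw [Derivation.leibniz, S.dx_X, smul_zero, zero_add, smul_eq_mul, F.dx_J]

theorem map_Q (l : Fin d) : F.Ψ (S'.Q l) =
    ∑ r, ∑ s, F.Ψ (S'.X r) * F.Ψ (S'.X s) * F.Ψ (S'.Γ r s l) := by
  simp only [JetConn.Q, map_sum, map_mul]

/-- This is the Christoffel law with both lower indices contracted with y. -/
theorem sum_J_Q (l : Fin d) : ∑ k, F.J l k * S.Q k =
    ∑ j, ∑ m, S.X j * S.X m * S.dx j (F.J l m) + F.Ψ (S'.Q l) := by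
  have h1 : F.Ψ (S'.Q l) = ∑ j, ∑ m, S.X j * S.X m *
      ∑ r, ∑ s, F.Ψ (S'.Γ r s l) * F.J r j * F.J s m := by
    have : ∀ r s, F.Ψ (S'.X r) * F.Ψ (S'.X s) * F.Ψ (S'.Γ r s l) = ∑ j, ∑ m,
        S.X j * S.X m * (F.Ψ (S'.Γ r s l) * F.J r j * F.J s m) := by
      intro r s
      rw [F.map_X, F.map_X, Finset.sum_mul_sum, Finset.sum_mul]
      refine Finset.sum_congr rfl fun j _ => ?_
      rw [Finset.sum_mul]
      exact Finset.sum_congr rfl fun m _ => by ring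
    simp only [map_Q, this, Finset.mul_sum]
    rw [Finset.sum_congr rfl fun r _ => Finset.sum_comm, Finset.sum_comm]
    refine Finset.sum_congr rfl fun j _ => ?_
    rw [Finset.sum_congr rfl fun r _ => Finset.sum_comm, Finset.sum_comm]
  rw [h1, ← Finset.sum_add_distrib]
  simp only [JetConn.Q]
  rw [Finset.sum_congr rfl fun k _ => Finset.mul_sum _ _ _, Finset.sum_comm]
  refine Finset.sum_congr rfl fun j _ => ?_
  rw [Finset.sum_congr rfl fun k _ => Finset.mul_sum _ _ _, Finset.sum_comm,
    ← Finset.sum_add_distrib]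
  refine Finset.sum_congr rfl fun m _ => ?_
  rw [← mul_add, ← F.law, Finset.mul_sum]
  exact Finset.sum_congr rfl fun k _ => by ring

theorem Z_Z_J (l i : Fin d) : S.Z (S.Z (F.J l i)) =
    ∑ j, ∑ m, S.X j * S.X m * S.dx j (S.dx m (F.J l i)) - ∑ j, S.Q j * S.dx j (F.J l i) := by
  have : ∀ j, S.Z (S.dx j (F.J l i)) = ∑ m, S.X m * S.dx m (S.dx j (F.J l i)) := fun j =>
    S.Z_of_dy_eq_zero fun k => by rw [← S.dx_dy, F.dy_J, map_zero]
  rw [Z_J, map_sum, Finset.sum_comm, ← Finset.sum_sub_distrib]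
  refine Finset.sum_congr rfl fun j _ => ?_
  rw [Derivation.leibniz, JetConn.Z_X', this, smul_eq_mul, smul_eq_mul, Finset.mul_sum, mul_neg,
    ← sub_eq_add_neg, mul_comm (S.dx j _)]
  congr 1
  exact Finset.sum_congr rfl fun m _ => by ring

/-- By the chain rule, the pull-back of Q' depends on x through the two factors y' = Jy and through
Γ'. By symmetry of Γ' the two factors contribute equally, whence the 2. -/
theorem dx_map_Q (i l : Fin d) : S.dx i (F.Ψ (S'.Q l)) =
    2 * ∑ r, S.Z (F.J r i) * F.Ψ (S'.N r l) + ∑ a, F.J a i * F.Ψ (S'.dx a (S'.Q l)) := by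
  have h1 : ∀ a, F.Ψ (S'.dx a (S'.Q l)) =
      ∑ r, ∑ s, F.Ψ (S'.X r) * F.Ψ (S'.X s) * F.Ψ (S'.dx a (S'.Γ r s l)) := by
    intro a
    simp [JetConn.Q, S'.dx_X]
  have h2 : ∀ r, F.Ψ (S'.N r l) = ∑ s, F.Ψ (S'.X s) * F.Ψ (S'.Γ r s l) := by
    intro r
    simp only [JetConn.N, map_sum, map_mul]
    exact Finset.sum_congr rfl fun s _ => by rw [S'.symm]
  have h3 : ∑ a, F.J a i * F.Ψ (S'.dx a (S'.Q l)) =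
      ∑ r, ∑ s, F.Ψ (S'.X r) * F.Ψ (S'.X s) * S.dx i (F.Ψ (S'.Γ r s l)) := by
    simp only [h1, F.dx_map_Γ, Finset.mul_sum]
    rw [Finset.sum_comm]
    refine Finset.sum_congr rfl fun r _ => ?_
    rw [Finset.sum_comm]
    exact Finset.sum_congr rfl fun s _ => Finset.sum_congr rfl fun a _ => by ring
  have h4 : ∑ r, ∑ s, S.Z (F.J s i) * (F.Ψ (S'.X r) * F.Ψ (S'.Γ r s l)) =
      ∑ r, ∑ s, S.Z (F.J r i) * (F.Ψ (S'.X s) * F.Ψ (S'.Γ r s l)) := by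
    rw [Finset.sum_comm]
    exact Finset.sum_congr rfl fun s _ => Finset.sum_congr rfl fun r _ => by rw [S'.symm]
  rw [h3, two_mul]
  simp only [h2, Finset.mul_sum]
  nth_rewrite 1 [← h4]
  simp only [map_Q, map_sum, ← Finset.sum_add_distrib]
  refine Finset.sum_congr rfl fun r _ => Finset.sum_congr rfl fun s _ => ?_
  simp only [Derivation.leibniz, smul_eq_mul, dx_map_X]
  ring

/-- Differentiate `sum_J_Q` by xⁱ. The second derivatives of J combine with the term Q · ∂J into
Z(Z(J)) by `Z_Z_J`. -/
theorem dx_Q_mul_jacT : Matrix.of (fun i k => S.dx i (S.Q k)) * F.jacT =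
    (F.jacT.map S.Z).map S.Z +
      (F.jacT.map S.Z * F.Ψ.mapMatrix S'.N + F.jacT.map S.Z * F.Ψ.mapMatrix S'.N) +
      F.jacT * F.Ψ.mapMatrix (Matrix.of fun i k => S'.dx i (S'.Q k)) := by
  ext i l
  have h1 := congrArg (S.dx i) (F.sum_J_Q l)
  rw [map_add, dx_map_Q] at h1
  have h2 : S.dx i (∑ k, F.J l k * S.Q k) = ∑ k, S.dx i (S.Q k) * F.J l k +
      ∑ k, S.Q k * S.dx k (F.J l i) := by
    rw [map_sum, ← Finset.sum_add_distrib]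
    refine Finset.sum_congr rfl fun k _ => ?_
    rw [Derivation.leibniz, smul_eq_mul, smul_eq_mul, F.dx_J i l k, mul_comm (F.J l k)]
  have h3 : S.dx i (∑ j, ∑ m, S.X j * S.X m * S.dx j (F.J l m)) =
      ∑ j, ∑ m, S.X j * S.X m * S.dx j (S.dx m (F.J l i)) := by
    simp only [map_sum, Derivation.leibniz, smul_eq_mul, S.dx_X, mul_zero, add_zero]
    refine Finset.sum_congr rfl fun j _ => Finset.sum_congr rfl fun m _ => ?_
    rw [S.dx_comm i j, F.dx_J i l m]
  rw [h2, h3] at h1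
  have h4 := Z_Z_J (F := F) l i
  simp only [Matrix.add_apply, Matrix.mul_apply, Matrix.of_apply, jacT, Matrix.map_apply,
    RingHom.mapMatrix_apply]
  linear_combination h1 - h4

/-- In ∂Q - Z(N) - N² the term Z(Z(J)) from ∂Q cancels against the one from Z(N), and the products
of Z(J) with N and N' cancel among the three terms. -/
theorem Rel.jacobi (hZ : ∀ f, S.Z (F.Ψ f) = F.Ψ (S'.Z f)) : F.Rel S.jacobi S'.jacobi := by
  have h3 := N_mul_jacT (F := F)
  have hN : (F.Ψ.mapMatrix S'.N).map S.Z = F.Ψ.mapMatrix (S'.N.map S'.Z) := by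
    ext i k
    simp [hZ]
  have h4 := congrArg (fun M : Matrix (Fin d) (Fin d) R => M.map S.Z) h3
  have hadd : ∀ B C : Matrix (Fin d) (Fin d) R, (B + C).map S.Z = B.map S.Z + C.map S.Z := by
    intro B C
    ext i k
    simp
  simp only [map_Z_mul, hadd, hN] at h4
  rw [Rel, S.jacobi_eq, S'.jacobi_eq]
  simp only [map_sub, map_mul, sub_mul, mul_sub]
  rw [dx_Q_mul_jacT, mul_assoc S.N, h3, mul_add, ← mul_assoc S.N, h3, eq_sub_of_add_eq h4]
  noncomm_ring

end JetMap

end Natural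

/-! ### Linear substitutions -/

section Subst

variable {d : ℕ}

theorem VanAt.one {n : ℕ} (hn : n ≠ 0) : VanAt n (1 : Pow d) := by
  have := VanAt.C (d := d) 1 hn
  rwa [map_one] at this

theorem VanAt.pow {f : Pow d} (hf : ∀ n, n ≠ 1 → VanAt n f) (e : ℕ) :
    ∀ n, n ≠ e → VanAt n (f ^ e) := by
  induction e with
  | zero => intro n hn; rw [pow_zero]; exact VanAt.one hn
  | succ e ih =>
    intro n hn
    rw [pow_succ]
    refine VanAt.mul fun a b hab => ?_
    by_cases ha : a = e
    · exact Or.inr (hf b (by omega))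
    · exact Or.inl (ih a ha)

theorem VanAt.prod {ι : Type*} (s : Finset ι) {f : ι → Pow d} (e : ι → ℕ)
    (hf : ∀ i n, n ≠ e i → VanAt n (f i)) : ∀ n, n ≠ ∑ i ∈ s, e i → VanAt n (∏ i ∈ s, f i) := by
  classical
  induction s using Finset.induction_on with
  | empty => intro n hn; rw [Finset.prod_empty]; exact VanAt.one (by simpa using hn)
  | insert i s hi ih =>
    intro n hn
    rw [Finset.sum_insert hi] at hn
    rw [Finset.prod_insert hi]
    refine VanAt.mul fun a b hab => ?_
    by_cases ha : a = e i
    · exact Or.inr (ih b (by omega))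
    · exact Or.inl (hf i a ha)

/-- The linear forms of a linear substitution. -/
def linForm (J : Fin d → Fin d → ℝ) (k : Fin d) : Pow d :=
  ∑ i, MvPowerSeries.C (J k i) * MvPowerSeries.X i

theorem linForm_van (J : Fin d → Fin d → ℝ) (k : Fin d) (n : ℕ) (hn : n ≠ 1) :
    VanAt n (linForm J k) :=
  VanAt.sum fun i _ => (VanAt.X i hn).C_mul _

theorem hasSubst_linForm (J : Fin d → Fin d → ℝ) : MvPowerSeries.HasSubst (linForm J) :=
  MvPowerSeries.hasSubst_of_constantCoeff_zero fun k => by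
    simp [linForm]

/-- The linear substitution as a homomorphism of algebras. -/
def linHom (J : Fin d → Fin d → ℝ) : Pow d →ₐ[ℝ] Pow d :=
  MvPowerSeries.substAlgHom (hasSubst_linForm J)

theorem linHom_apply (J : Fin d → Fin d → ℝ) (f : Pow d) : linHom J f = linSubst J f := by
  rw [linHom, MvPowerSeries.coe_substAlgHom]
  rfl

theorem linHom_X (J : Fin d → Fin d → ℝ) (k : Fin d) :
    linHom J (MvPowerSeries.X k) = linForm J k :=
  MvPowerSeries.substAlgHom_X _ k

theorem linHom_C (J : Fin d → Fin d → ℝ) (r : ℝ) :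
    linHom J (MvPowerSeries.C r) = MvPowerSeries.C r :=
  (linHom J).commutes r

theorem mem_antidiag {n : ℕ} {β : Fin d →₀ ℕ} :
    β ∈ (Finset.univ : Finset (Fin d)).finsuppAntidiag n ↔ β.degree = n := by
  rw [Finset.mem_finsuppAntidiag, Finsupp.degree_eq_sum]
  simp

/-- A linear substitution preserves the degree, so only the finitely many β of the degree of α
contribute. The coefficient is thus polynomial in the entries of J, which yields smooth dependence
on the point. -/
theorem coeff_linHom (J : Fin d → Fin d → ℝ) (f : Pow d) (α : Fin d →₀ ℕ) :
    MvPowerSeries.coeff α (linHom J f) =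
      ∑ β ∈ (Finset.univ : Finset (Fin d)).finsuppAntidiag α.degree,
        MvPowerSeries.coeff β f * MvPowerSeries.coeff α (∏ k, linForm J k ^ β k) := by
  rw [linHom, MvPowerSeries.coe_substAlgHom, MvPowerSeries.coeff_subst (hasSubst_linForm J)]
  have e : ∀ β : Fin d →₀ ℕ, (β.prod fun s e => linForm J s ^ e) = ∏ k, linForm J k ^ β k :=
    fun β => Finsupp.prod_fintype _ _ fun _ => pow_zero _
  rw [finsum_eq_sum_of_support_subset]
  · exact Finset.sum_congr rfl fun β _ => by rw [e, smul_eq_mul]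
  · intro β hβ
    rw [Finset.mem_coe, mem_antidiag]
    by_contra h
    refine hβ ?_
    simp only
    rw [e, VanAt.prod Finset.univ (fun k => β k) (fun k => VanAt.pow (linForm_van J k) (β k))
      α.degree (by rw [← Finsupp.degree_eq_sum]; exact Ne.symm h) α rfl, smul_zero]

theorem VanAt.linHom {n : ℕ} {f : Pow d} (hf : VanAt n f) (J : Fin d → Fin d → ℝ) :
    VanAt n (linHom J f) := fun α hα => by
  rw [coeff_linHom]
  exact Finset.sum_eq_zero fun β hβ => by rw [hf β (by rw [mem_antidiag.1 hβ, hα]), zero_mul]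

theorem SmoothFamOn.prod {U : Set (Model d)} {ι : Type*} (s : Finset ι) {f : ι → Model d → Pow d}
    (hf : ∀ i, SmoothFamOn U (f i)) : SmoothFamOn U fun u => ∏ i ∈ s, f i u := by
  classical
  induction s using Finset.induction_on with
  | empty => simpa using SmoothFamOn.const 1
  | insert i s hi ih =>
    simp only [Finset.prod_insert hi]
    exact (hf i).mul ih

theorem SmoothFamOn.sum {U : Set (Model d)} {ι : Type*} (s : Finset ι) {f : ι → Model d → Pow d}
    (hf : ∀ i, SmoothFamOn U (f i)) : SmoothFamOn U fun u => ∑ i ∈ s, f i u := fun α => by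
  simp only [map_sum]
  exact ContDiffOn.sum fun i _ => hf i α

theorem SmoothFamOn.pow {U : Set (Model d)} {f : Model d → Pow d} (hf : SmoothFamOn U f) (e : ℕ) :
    SmoothFamOn U fun u => f u ^ e := by
  induction e with
  | zero => simpa using SmoothFamOn.const 1
  | succ e ih =>
    simp only [pow_succ]
    exact ih.mul hf

theorem SmoothFamOn.linForm {U : Set (Model d)} {J : Model d → Fin d → Fin d → ℝ}
    (hJ : ∀ k i, ContDiffOn ℝ ∞ (fun u => J u k i) U) (k : Fin d) :
    SmoothFamOn U fun u => linForm (J u) k :=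
  SmoothFamOn.sum _ fun i => (SmoothFamOn.C (hJ k i)).mul (SmoothFamOn.const _)

theorem SmoothFamOn.linHom {U : Set (Model d)} {J : Model d → Fin d → Fin d → ℝ}
    {f : Model d → Pow d} (hJ : ∀ k i, ContDiffOn ℝ ∞ (fun u => J u k i) U)
    (hf : SmoothFamOn U f) : SmoothFamOn U fun u => linHom (J u) (f u) := fun α => by
  simp only [coeff_linHom]
  exact ContDiffOn.sum fun β _ => (hf β).mul
    (SmoothFamOn.prod _ (fun k => (SmoothFamOn.linForm hJ k).pow (β k)) α)

end Subst

/-! ### Changes of coordinates -/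

section Change

variable {d : ℕ} {W U' : Opens (Model d)}

/-- The Jacobian of a map. -/
def jacM (ψ : Model d → Model d) (u : Model d) (k a : Fin d) : ℝ :=
  fderiv ℝ (fun v => ψ v k) u (stdVec d a)

/-- The transformation law of Christoffel symbols. -/
def ChristoffelLaw (W : Opens (Model d)) (ψ : Model d → Model d) (Γ Γ' : Chris d) : Prop :=
  ∀ u ∈ W, ∀ i j l, ∑ k, jacM ψ u l k * Γ u i j k =
    fderiv ℝ (fun v => jacM ψ v l j) u (stdVec d i) +
      ∑ r, ∑ s, Γ' (ψ u) r s l * jacM ψ u r i * jacM ψ u s j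

/-- A smooth change of coordinates. -/
structure SmoothChange (W U' : Opens (Model d)) (ψ : Model d → Model d) : Prop where
  smooth : ContDiffOn ℝ ∞ ψ W
  maps : ∀ u ∈ W, ψ u ∈ U'

namespace SmoothChange

variable {ψ : Model d → Model d} (hψ : SmoothChange W U' ψ)

theorem smooth_coord (hψ : SmoothChange W U' ψ) (k : Fin d) :
    ContDiffOn ℝ ∞ (fun v => ψ v k) W :=
  (EuclideanSpace.proj k : Model d →L[ℝ] ℝ).contDiff.comp_contDiffOn hψ.smooth

theorem smooth_jacM (hψ : SmoothChange W U' ψ) (k a : Fin d) :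
    ContDiffOn ℝ ∞ (fun u => jacM ψ u k a) W :=
  Fam.contDiffOn_partial (hψ.smooth_coord k) a

theorem smooth_comp (hψ : SmoothChange W U' ψ) {h : Model d → ℝ} (hh : ContDiffOn ℝ ∞ h U') :
    ContDiffOn ℝ ∞ (fun u => h (ψ u)) W :=
  hh.comp hψ.smooth hψ.maps

/-- The pull-back of families of formal power series. -/
def pull : Fam U' →+* Fam W where
  toFun g := Fam.res (fun u => linHom (jacM ψ u) (extd g.1 (ψ u)))
    (SmoothFamOn.linHom hψ.smooth_jacM fun α => hψ.smooth_comp (g.smooth α))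
  map_one' := Fam.ext' fun u => by
    rw [Fam.res_apply, extd_apply _ (⟨ψ u, hψ.maps u u.2⟩ : U')]
    exact map_one _
  map_zero' := Fam.ext' fun u => by
    rw [Fam.res_apply, extd_apply _ (⟨ψ u, hψ.maps u u.2⟩ : U')]
    exact map_zero _
  map_add' f g := Fam.ext' fun u => by
    simp only [Fam.res_apply, extd_apply _ (⟨ψ u, hψ.maps u u.2⟩ : U'), Fam.add_apply]
    exact map_add _ _ _
  map_mul' f g := Fam.ext' fun u => by
    simp only [Fam.res_apply, extd_apply _ (⟨ψ u, hψ.maps u u.2⟩ : U'), Fam.mul_apply]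
    exact map_mul _ _ _

theorem pull_apply (g : Fam U') (u : W) :
    hψ.pull g u = linHom (jacM ψ u) (g ⟨ψ u, hψ.maps u u.2⟩) :=
  congrArg (linHom (jacM ψ u)) (extd_apply g.1 (⟨ψ u, hψ.maps u u.2⟩ : U'))

theorem pull_smul (r : ℝ) (g : Fam U') : hψ.pull (r • g) = r • hψ.pull g :=
  Fam.ext' fun u => by simp only [pull_apply, Fam.smul_apply, map_smul]

theorem pull_C {h : Model d → ℝ} (hh : ContDiffOn ℝ ∞ h U') :
    hψ.pull (Fam.C h hh) = Fam.C _ (hψ.smooth_comp hh) :=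
  Fam.ext' fun u => by rw [pull_apply, Fam.C_apply, Fam.C_apply, linHom_C]

theorem pull_van {n : ℕ} {g : Fam U'} (hg : Fam.Van n g) : Fam.Van n (hψ.pull g) := fun u => by
  rw [pull_apply]
  exact (hg _).linHom _

/-- The Jacobian over the ring of families. -/
def jacF (k a : Fin d) : Fam W := Fam.C _ (hψ.smooth_jacM k a)

theorem jacF_eq (k a : Fin d) : hψ.jacF k a = Fam.dx a (Fam.C _ (hψ.smooth_coord k)) := by
  rw [Fam.dx_C]
  rfl

theorem pull_X (k : Fin d) : hψ.pull (Fam.X k) = ∑ m, hψ.jacF k m * Fam.X m :=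
  Fam.ext' fun u => by
    rw [pull_apply, Fam.X_apply, linHom_X, Fam.sum_apply]
    rfl

theorem fderiv_comp_apply (hψ : SmoothChange W U' ψ) {h : Model d → ℝ}
    (hh : ContDiffOn ℝ ∞ h U') (i : Fin d) (u : W) :
    fderiv ℝ (fun v => h (ψ v)) u (stdVec d i) =
      ∑ a, jacM ψ u a i * fderiv ℝ h (ψ u) (stdVec d a) := by
  have hd : DifferentiableAt ℝ ψ u :=
    ((hψ.smooth.contDiffAt (W.isOpen.mem_nhds u.2)).differentiableAt (by simp))
  have hd' : DifferentiableAt ℝ h (ψ u) :=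
    ((hh.contDiffAt (U'.isOpen.mem_nhds (hψ.maps u u.2))).differentiableAt (by simp))
  have h1 : ∀ a, jacM ψ u a i = fderiv ℝ ψ u (stdVec d i) a := by
    intro a
    have : (fun v => ψ v a) = (EuclideanSpace.proj a : Model d →L[ℝ] ℝ) ∘ ψ := rfl
    rw [jacM, this, fderiv_comp _ (ContinuousLinearMap.differentiableAt _) hd,
      ContinuousLinearMap.fderiv]
    rfl
  have h2 : fderiv ℝ ψ u (stdVec d i) = ∑ a, (fderiv ℝ ψ u (stdVec d i)) a • stdVec d a := by
    have := (EuclideanSpace.basisFun (Fin d) ℝ).sum_repr (fderiv ℝ ψ u (stdVec d i))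
    simpa [stdVec] using this.symm
  have h3 : fderiv ℝ (fun v => h (ψ v)) u = (fderiv ℝ h (ψ u)).comp (fderiv ℝ ψ u) :=
    fderiv_comp _ hd' hd
  rw [h3, ContinuousLinearMap.comp_apply, h2, map_sum]
  exact Finset.sum_congr rfl fun a _ => by rw [map_smul, smul_eq_mul, h1]

theorem dx_pull_C {h : Model d → ℝ} (hh : ContDiffOn ℝ ∞ h U') (i : Fin d) :
    Fam.dx i (hψ.pull (Fam.C h hh)) =
      ∑ a, hψ.jacF a i * hψ.pull (Fam.dx a (Fam.C h hh)) := Fam.ext' fun u => by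
  simp only [pull_C, Fam.dx_C, Fam.sum_apply, Fam.mul_apply, jacF, Fam.C_apply, ← map_mul,
    ← map_sum]
  rw [hψ.fderiv_comp_apply hh]

/-! ### Naturality of the spray and of the no-loop forms -/

section Conn

variable {Γ Γ' : Chris d} (h : SmoothConn W Γ) (h' : SmoothConn U' Γ')
  (law : ChristoffelLaw W ψ Γ Γ')

/-- The change of coordinates over the rings of families. -/
def jetMap : JetMap h.jet h'.jet where
  Ψ := hψ.pull
  J := hψ.jacF
  map_X := hψ.pull_X
  dx_J i c m := by
    rw [jacF_eq, jacF_eq]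
    exact Fam.dx_comm _ _ _
  dy_J l c m := Fam.dy_C _ _ _
  law i j l := Fam.ext' fun u => by
    simp only [SmoothConn.Γ_eq, SmoothConn.dx_eq, pull_C, jacF, Fam.dx_C, Fam.sum_apply,
      Fam.add_apply, Fam.mul_apply, Fam.C_apply, ← map_mul, ← map_sum, ← map_add]
    rw [law u u.2]
  dx_map_Γ i r s l := hψ.dx_pull_C _ i

/-- In a single degree, a family is a polynomial in the yᵏ with smooth functions as coefficients.
Identities between operators that raise the degree by one can therefore be checked on the subring
generated by functions and the yᵏ. -/
theorem fam_eq_add_of_degree (n : ℕ) (f : Fam U') : ∃ g : Fam U', Fam.Van n g ∧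
    f = ∑ β ∈ (Finset.univ : Finset (Fin d)).finsuppAntidiag n,
      Fam.C _ (f.smooth β) * ∏ k, Fam.X k ^ β k + g := by
  classical
  refine ⟨f - ∑ β ∈ (Finset.univ : Finset (Fin d)).finsuppAntidiag n,
      Fam.C _ (f.smooth β) * ∏ k, Fam.X k ^ β k, fun u α hα => ?_, by ring⟩
  have e : ∀ β : Fin d →₀ ℕ, (∏ k, (Fam.X k : Fam U') ^ β k) u = MvPowerSeries.monomial β 1 := by
    intro β
    rw [Fam.prod_apply, MvPowerSeries.monomial_eq', Finsupp.prod_fintype _ _ fun _ => pow_zero _,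
      map_one, one_mul]
    exact Finset.prod_congr rfl fun k _ => map_pow (Fam.eval u) _ _
  simp only [Fam.sub_apply, Fam.sum_apply, Fam.mul_apply, Fam.C_apply, e, map_sub, map_sum,
    MvPowerSeries.coeff_C_mul, MvPowerSeries.coeff_monomial]
  rw [Finset.sum_eq_single α]
  · rw [extd_apply]
    simp
  · intro β _ hβ
    simp [hβ.symm]
  · intro h
    exact absurd (mem_antidiag.2 hα) h

/-- By the Leibniz rule the families for which the identity holds form a subring. For functions it
is the chain rule, for yᵏ the Christoffel law contracted twice with y (`sum_J_Q`). Since Z raises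
the degree by one, degree n + 1 sees only degree n of f, where f coincides with an element of the
subring. -/
theorem Z_pull (h : SmoothConn W Γ) (h' : SmoothConn U' Γ') (law : ChristoffelLaw W ψ Γ Γ')
    (hψ : SmoothChange W U' ψ) (f : Fam U') : h.jet.Z (hψ.pull f) = hψ.pull (h'.jet.Z f) := by
  let T : Subring (Fam U') :=
    { carrier := {f | h.jet.Z (hψ.pull f) = hψ.pull (h'.jet.Z f)}
      mul_mem' := fun {f g} hf hg => by
        simp only [Set.mem_ofPred_eq, map_mul, Derivation.leibniz, smul_eq_mul, map_add] at hf hg ⊢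
        rw [hf, hg]
      one_mem' := by simp
      add_mem' := fun {f g} hf hg => by
        simp only [Set.mem_ofPred_eq, map_add] at hf hg ⊢
        rw [hf, hg]
      zero_mem' := by simp
      neg_mem' := fun {f} hf => by
        simp only [Set.mem_ofPred_eq, map_neg] at hf ⊢
        rw [hf] }
  have hC : ∀ (k : Model d → ℝ) (hk : ContDiffOn ℝ ∞ k U'), Fam.C k hk ∈ T := by
    intro k hk
    change h.jet.Z (hψ.pull (Fam.C k hk)) = hψ.pull (h'.jet.Z (Fam.C k hk))
    rw [h'.jet.Z_of_dy_eq_zero fun l => Fam.dy_C _ _ _, h.jet.Z_of_dy_eq_zero fun l => by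
      rw [pull_C]; exact Fam.dy_C _ _ _]
    simp only [map_sum, map_mul, SmoothConn.dx_eq, SmoothConn.X_eq, pull_X, dx_pull_C,
      Finset.mul_sum, Finset.sum_mul]
    rw [Finset.sum_comm]
    exact Finset.sum_congr rfl fun a _ => Finset.sum_congr rfl fun j _ => by ring
  have hX : ∀ k, Fam.X k ∈ T := by
    intro k
    change h.jet.Z (hψ.pull (h'.jet.X k)) = hψ.pull (h'.jet.Z (h'.jet.X k))
    let F := hψ.jetMap h h' law
    change h.jet.Z (F.Ψ (h'.jet.X k)) = F.Ψ (h'.jet.Z (h'.jet.X k))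
    rw [JetConn.Z_X', map_neg, F.map_X, map_sum]
    have h1 := F.sum_J_Q k
    have h2 : ∀ m, h.jet.Z (F.J k m * h.jet.X m) =
        ∑ j, h.jet.X j * h.jet.X m * h.jet.dx j (F.J k m) - F.J k m * h.jet.Q m := by
      intro m
      have : ∑ j, h.jet.X j * h.jet.X m * h.jet.dx j (F.J k m) =
          h.jet.X m * ∑ j, h.jet.X j * h.jet.dx j (F.J k m) := by
        rw [Finset.mul_sum]
        exact Finset.sum_congr rfl fun j _ => by ring
      rw [Derivation.leibniz, JetConn.Z_X', F.Z_J, this]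
      simp only [smul_eq_mul]
      ring
    rw [Finset.sum_congr rfl fun m _ => h2 m, Finset.sum_sub_distrib, h1, Finset.sum_comm]
    ring
  refine sub_eq_zero.1 (Fam.Van.eq_zero fun n => ?_)
  cases n with
  | zero => exact (h.Z_van_zero _).sub (hψ.pull_van (h'.Z_van_zero _))
  | succ n =>
    obtain ⟨g, hg, hf⟩ := fam_eq_add_of_degree n f
    have hT : f - g ∈ T := by
      rw [hf, add_sub_cancel_right]
      exact T.sum_mem fun β _ => T.mul_mem (hC _ _) (T.prod_mem fun k _ => T.pow_mem (hX k) _)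
    have hT' : h.jet.Z (hψ.pull (f - g)) = hψ.pull (h'.jet.Z (f - g)) := hT
    simp only [map_sub] at hT'
    have : h.jet.Z (hψ.pull f) - hψ.pull (h'.jet.Z f) =
        h.jet.Z (hψ.pull g) - hψ.pull (h'.jet.Z g) := by linear_combination hT'
    rw [this]
    exact (h.Z_van (hψ.pull_van hg)).sub (hψ.pull_van (h'.Z_van hg))

/-- The recursion uses only the contracted curvature, `covZ`, products, sums and real factors, and
each of these respects the correspondence of matrices. -/
theorem rel_noLoop (N : ℕ) : (hψ.jetMap h h' law).Rel (h.noLoop N) (h'.noLoop N) := by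
  induction N using Nat.strong_induction_on with
  | _ N ih =>
    cases N with
    | zero =>
      rw [SmoothConn.noLoop_zero, SmoothConn.noLoop_zero]
      exact JetMap.Rel.zero
    | succ n =>
      rw [SmoothConn.noLoop_succ, SmoothConn.noLoop_succ]
      have hZ : ∀ f, h.jet.Z ((hψ.jetMap h h' law).Ψ f) = (hψ.jetMap h h' law).Ψ (h'.jet.Z f) :=
        Z_pull h h' law hψ
      have h1 : (hψ.jetMap h h' law).Rel (if n = 1 then h.jet.jacobi else 0)
          (if n = 1 then h'.jet.jacobi else 0) := by
        split_ifs
        · exact JetMap.Rel.jacobi hZ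
        · exact JetMap.Rel.zero
      have h2 : (hψ.jetMap h h' law).Rel (h.jet.covZ (h.noLoop n)) (h'.jet.covZ (h'.noLoop n)) :=
        (ih n n.lt_succ_self).covZ hZ
      have h3 : (hψ.jetMap h h' law).Rel (∑ a : Fin n, h.noLoop (a + 1) * h.noLoop (n - a))
          (∑ a : Fin n, h'.noLoop (a + 1) * h'.noLoop (n - a)) :=
        JetMap.Rel.sum fun a _ => (ih _ (by omega)).mul (ih _ (by omega))
      exact ((h1.add h2).add h3).smul hψ.pull_smul _

/-- The transformation law of the `1`-form of the Fedosov construction. -/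
theorem fedosovLocal_transform (h : SmoothConn W Γ) (h' : SmoothConn U' Γ')
    (law : ChristoffelLaw W ψ Γ Γ') (hψ : SmoothChange W U' ψ) (u : W) (i l : Fin d) :
    ∑ k, jacM ψ u l k • fedosovLocal Γ u i k =
      ∑ a, jacM ψ u a i • linSubst (jacM ψ u) (fedosovLocal Γ' (ψ u) a l) := by
  simp only [← linHom_apply]
  refine sub_eq_zero.1 (VanAt.eq_zero fun N => ?_)
  have h1 : ∀ k, VanAt N (fedosovLocal Γ u i k - h.noLoop N i k u) := fun k α hα => by
    rw [map_sub, h.coeff_fedosovLocal, hα, sub_self]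
  have h2 : ∀ a, VanAt N (fedosovLocal Γ' (ψ u) a l - h'.noLoop N a l ⟨ψ u, hψ.maps u u.2⟩) :=
    fun k α hα => by
      rw [map_sub, h'.coeff_fedosovLocal (u := ⟨ψ u, hψ.maps u u.2⟩), hα, sub_self]
  have h3 := congrFun (congrFun (hψ.rel_noLoop h h' law N) i) l
  have h4 : ∑ k, jacM ψ u l k • h.noLoop N i k u = ∑ a, jacM ψ u a i •
      linHom (jacM ψ u) (h'.noLoop N a l ⟨ψ u, hψ.maps u u.2⟩) := by
    have := congrArg (Fam.eval u) h3
    simp only [Matrix.mul_apply, map_sum, map_mul, Fam.eval_apply, JetMap.jacT, Matrix.of_apply,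
      RingHom.mapMatrix_apply, Matrix.map_apply, jetMap, jacF, Fam.C_apply, pull_apply] at this
    simp only [MvPowerSeries.smul_eq_C_mul]
    rw [← this]
    exact Finset.sum_congr rfl fun k _ => mul_comm _ _
  have h5 : ∑ k, jacM ψ u l k • fedosovLocal Γ u i k - ∑ a, jacM ψ u a i •
      linHom (jacM ψ u) (fedosovLocal Γ' (ψ u) a l) =
      ∑ k, jacM ψ u l k • (fedosovLocal Γ u i k - h.noLoop N i k u) -
      ∑ a, jacM ψ u a i • linHom (jacM ψ u) (fedosovLocal Γ' (ψ u) a l -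
        h'.noLoop N a l ⟨ψ u, hψ.maps u u.2⟩) := by
    simp only [smul_sub, map_sub, Finset.sum_sub_distrib]
    rw [h4]
    ring
  rw [h5]
  exact (VanAt.sum fun k _ => (h1 k).smul _).sub (VanAt.sum fun a _ => ((h2 a).linHom _).smul _)

end Conn

end SmoothChange

end Change

/-! ### Homogeneous parts as functions -/

section HomEval

variable {d : ℕ}

/-- `homEval` as a linear map. -/
def homEvalLin (n : ℕ) (y : Model d) : Pow d →ₗ[ℝ] ℝ where
  toFun f := homEval n f y
  map_add' f g := by simp only [homEval, map_add, add_mul, Finset.sum_add_distrib]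
  map_smul' r f := by
    simp only [homEval, MvPowerSeries.coeff_smul, smul_eq_mul, mul_assoc, Finset.mul_sum,
      RingHom.id_apply]

theorem homEval_add (n : ℕ) (f g : Pow d) (y : Model d) :
    homEval n (f + g) y = homEval n f y + homEval n g y := map_add (homEvalLin n y) f g

theorem homEval_neg (n : ℕ) (f : Pow d) (y : Model d) : homEval n (-f) y = -homEval n f y :=
  map_neg (homEvalLin n y) f

theorem homEval_sum {ι : Type*} (s : Finset ι) (n : ℕ) (f : ι → Pow d) (y : Model d) :
    homEval n (∑ i ∈ s, f i) y = ∑ i ∈ s, homEval n (f i) y := map_sum (homEvalLin n y) f s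

theorem homEval_of_van {n : ℕ} {f : Pow d} (hf : VanAt n f) (y : Model d) : homEval n f y = 0 :=
  Finset.sum_eq_zero fun β hβ => by rw [hf β (mem_antidiag.1 hβ), zero_mul]

theorem homEval_mul (n : ℕ) (f g : Pow d) (y : Model d) :
    homEval n (f * g) y = ∑ p ∈ Finset.HasAntidiagonal.antidiagonal n, homEval p.1 f y * homEval p.2 g y := by
  classical
  simp only [homEval, MvPowerSeries.coeff_mul, Finset.sum_mul_sum]
  simp only [Finset.sum_mul]
  simp only [← Finset.sum_product']
  rw [Finset.sum_sigma', Finset.sum_sigma']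
  refine Finset.sum_bij' (fun x _ => ⟨(x.2.1.degree, x.2.2.degree), x.2⟩)
    (fun x _ => ⟨x.2.1 + x.2.2, x.2⟩) ?_ ?_ ?_ ?_ ?_
  · rintro ⟨α, β, γ⟩ hx
    simp only [Finset.mem_sigma, mem_antidiag, Finset.HasAntidiagonal.mem_antidiagonal, Finset.mem_product] at hx ⊢
    rw [← hx.1, ← hx.2, map_add]
    simp
  · rintro ⟨⟨a, b⟩, β, γ⟩ hx
    simp only [Finset.mem_sigma, mem_antidiag, Finset.HasAntidiagonal.mem_antidiagonal, Finset.mem_product] at hx ⊢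
    rw [map_add, hx.2.1, hx.2.2]
    simp [hx.1]
  · rintro ⟨α, β, γ⟩ hx
    simp only [Finset.mem_sigma, Finset.HasAntidiagonal.mem_antidiagonal] at hx
    simp [hx.2]
  · rintro ⟨⟨a, b⟩, β, γ⟩ hx
    simp only [Finset.mem_sigma, mem_antidiag, Finset.mem_product] at hx
    simp [hx.2.1, hx.2.2]
  · rintro ⟨α, β, γ⟩ hx
    simp only [Finset.mem_sigma, Finset.HasAntidiagonal.mem_antidiagonal] at hx
    simp only [← hx.2, Finsupp.add_apply, pow_add, Finset.prod_mul_distrib]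
    ring

theorem homEval_C (n : ℕ) (r : ℝ) (y : Model d) :
    homEval n (MvPowerSeries.C r) y = if n = 0 then r else 0 := by
  split_ifs with h
  · subst h
    simp [homEval]
  · exact homEval_of_van (VanAt.C r h) y

theorem homEval_X (n : ℕ) (k : Fin d) (y : Model d) :
    homEval n (MvPowerSeries.X k) y = if n = 1 then y k else 0 := by
  classical
  split_ifs with h
  · subst h
    rw [homEval, Finset.sum_eq_single (Finsupp.single k 1)]
    · rw [MvPowerSeries.coeff_X, if_pos rfl, one_mul, Finset.prod_eq_single k]
      · simp
      · intro i _ hi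
        simp [hi.symm]
      · simp
    · intro β _ hβ
      rw [MvPowerSeries.coeff_X, if_neg hβ, zero_mul]
    · intro h
      exact absurd (mem_antidiag.2 (by simp)) h
  · exact homEval_of_van (VanAt.X k h) y

theorem homEval_X_mul (n : ℕ) (k : Fin d) (f : Pow d) (y : Model d) :
    homEval (n + 1) (MvPowerSeries.X k * f) y = y k * homEval n f y := by
  rw [homEval_mul, Finset.sum_eq_single (1, n)]
  · rw [homEval_X, if_pos rfl]
  · rintro ⟨a, b⟩ hp hne
    rw [homEval_X, if_neg, zero_mul]
    rintro rfl
    simp only [Finset.HasAntidiagonal.mem_antidiagonal] at hp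
    exact hne (by simp; omega)
  · intro h
    exact absurd (Finset.HasAntidiagonal.mem_antidiagonal.2 (add_comm 1 n)) h

/-- In each degree the values are those of a polynomial, and a polynomial over the infinite field ℝ
is determined by its values. Hence a function has at most one series in the sense of
`IsTaylorSeries`. -/
theorem eq_of_homEval_eq {f g : Pow d} (h : ∀ n y, homEval n f y = homEval n g y) : f = g := by
  classical
  ext α
  let A := (Finset.univ : Finset (Fin d)).finsuppAntidiag α.degree
  have key : ∀ f : Pow d, ∃ P : MvPolynomial (Fin d) ℝ,
      (∀ y : Fin d → ℝ, MvPolynomial.eval y P = homEval α.degree f (WithLp.toLp 2 y)) ∧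
      MvPolynomial.coeff α P = MvPowerSeries.coeff α f := by
    intro f
    refine ⟨∑ β ∈ A, MvPolynomial.monomial β (MvPowerSeries.coeff β f), fun y => ?_, ?_⟩
    · rw [map_sum, homEval]
      refine Finset.sum_congr rfl fun β _ => ?_
      rw [MvPolynomial.eval_monomial, Finsupp.prod_fintype _ _ fun _ => pow_zero _]
    · rw [MvPolynomial.coeff_sum, Finset.sum_eq_single α]
      · simp
      · intro β _ hβ
        simp [MvPolynomial.coeff_monomial, hβ]
      · intro h
        exact absurd (mem_antidiag.2 rfl) h
  obtain ⟨P, hP, hP'⟩ := key f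
  obtain ⟨Q, hQ, hQ'⟩ := key g
  have hPQ : P = Q := MvPolynomial.funext fun y => by rw [hP, hQ, h]
  rw [← hP', ← hQ', hPQ]

theorem IsTaylorSeries.unique {F : Model d → ℝ} {f g : Pow d} (hf : IsTaylorSeries F f)
    (hg : IsTaylorSeries F g) : f = g :=
  eq_of_homEval_eq fun n y => by rw [← (hf y).2, ← (hg y).2]

theorem IsTaylorSeries.taylorSeries_eq {F : Model d → ℝ} {f : Pow d} (hf : IsTaylorSeries F f) :
    taylorSeries F = f := by
  have h : ∃ f, IsTaylorSeries F f := ⟨f, hf⟩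
  rw [taylorSeries, dif_pos h]
  exact h.choose_spec.unique hf

end HomEval

/-! ### Geodesics in coordinates -/

section Geodesic

variable {d : ℕ} {U : Opens (Model d)} {Γ : Chris d}

/-- The geodesic equation at time `t` for a curve `c` with velocity `w`, with derivatives within
`s`. -/
def GeodesicAt (Γ : Chris d) (c w : ℝ → Model d) (s : Set ℝ) (t : ℝ) : Prop :=
  HasDerivWithinAt c (w t) s t ∧ ∀ k, HasDerivWithinAt (fun τ => w τ k)
    (-∑ r, ∑ q, Γ (c t) r q k * w t r * w t q) s t

theorem extd_mul (f g : Fam U) (v : Model d) : extd (f * g).1 v = extd f.1 v * extd g.1 v := by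
  by_cases hv : v ∈ U <;> simp [extd, hv]

theorem extd_add (f g : Fam U) (v : Model d) : extd (f + g).1 v = extd f.1 v + extd g.1 v := by
  by_cases hv : v ∈ U <;> simp [extd, hv]

theorem extd_neg (f : Fam U) (v : Model d) : extd (-f).1 v = -extd f.1 v := by
  by_cases hv : v ∈ U <;> simp [extd, hv]

theorem fderiv_eq_sum (f : Model d → ℝ) (u w : Model d) :
    fderiv ℝ f u w = ∑ a, w a * fderiv ℝ f u (stdVec d a) := by
  have h2 : w = ∑ a, w a • stdVec d a := by
    have := (EuclideanSpace.basisFun (Fin d) ℝ).sum_repr w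
    simpa [stdVec] using this.symm
  conv_lhs => rw [h2, map_sum]
  exact Finset.sum_congr rfl fun a _ => by rw [map_smul, smul_eq_mul]

namespace SmoothConn

/-- Along a geodesic, the derivative of the evaluation of a family of power series at the velocity
is given by the geodesic spray. -/
theorem hasDerivAt_homEval (h : SmoothConn U Γ) {c w : ℝ → Model d} {t : ℝ} (ht : c t ∈ U)
    (hc : GeodesicAt Γ c w Set.univ t) (g : Fam U) (n : ℕ) :
    HasDerivAt (fun τ => homEval n (extd g.1 (c τ)) (w τ))
      (homEval (n + 1) (extd (h.jet.Z g).1 (c t)) (w t)) t := by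
  have hc1 : HasDerivAt c (w t) t := hasDerivWithinAt_univ.1 hc.1
  have hc2 := fun k => hasDerivWithinAt_univ.1 (hc.2 k)
  have hU : ∀ᶠ τ in nhds t, c τ ∈ U := hc1.continuousAt.eventually (U.isOpen.mem_nhds ht)
  have e : ∀ f : Fam U, extd f.1 (c t) = f ⟨c t, ht⟩ := fun f => extd_apply f.1 ⟨c t, ht⟩
  -- The families with this property in every degree form a subring that contains functions and the
  -- yᵏ; the general case follows by looking at one degree at a time.
  let P : Fam U → Prop := fun g => ∀ n, HasDerivAt (fun τ => homEval n (extd g.1 (c τ)) (w τ))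
      (homEval (n + 1) (extd (h.jet.Z g).1 (c t)) (w t)) t
  have hadd : ∀ f g, P f → P g → P (f + g) := fun f g hf hg n => by
    simp only [extd_add, homEval_add, map_add]
    exact (hf n).add (hg n)
  have hZ0 : ∀ f, homEval 0 (extd (h.jet.Z f).1 (c t)) (w t) = 0 := fun f => by
    rw [e]
    exact homEval_of_van (h.Z_van_zero f _) _
  have hmul : ∀ f g, P f → P g → P (f * g) := fun f g hf hg n => by
    simp only [extd_mul, homEval_mul, Derivation.leibniz, smul_eq_mul, extd_add, homEval_add]
    -- Values of Z have no part of degree 0, so the boundary terms of the sum over degree n + 1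
    -- vanish and the others match the product rule in degree n.
    rw [Finset.Nat.antidiagonal_succ']
    simp only [Finset.sum_cons, Finset.sum_map, hZ0, mul_zero, zero_add]
    have := HasDerivAt.fun_sum (u := Finset.HasAntidiagonal.antidiagonal n)
      (fun p _ => (hf p.1).fun_mul (hg p.2))
    refine this.congr_deriv ?_
    rw [Finset.sum_add_distrib]
    refine (add_comm _ _).trans (congrArg₂ (· + ·) ?_ ?_)
    · refine (Finset.sum_congr rfl fun p _ => ?_)
      simp
    · rw [← Finset.Nat.sum_antidiagonal_swap]
      refine Finset.sum_congr rfl fun p _ => ?_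
      simp [mul_comm]
  have hC : ∀ (k : Model d → ℝ) (hk : ContDiffOn ℝ ∞ k U), P (Fam.C k hk) := by
    intro k hk n
    have h1 : (fun τ => homEval n (extd (Fam.C k hk).1 (c τ)) (w τ)) =ᶠ[nhds t]
        fun τ => if n = 0 then k (c τ) else 0 := by
      filter_upwards [hU] with τ hτ
      rw [extd_apply (Fam.C k hk).1 (⟨c τ, hτ⟩ : U), Fam.C_apply, homEval_C]
    refine HasDerivAt.congr_of_eventuallyEq ?_ h1
    rw [e, h.jet.Z_of_dy_eq_zero fun l => Fam.dy_C _ _ _, Fam.sum_apply, homEval_sum]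
    simp only [X_eq, dx_eq, Fam.dx_C, Fam.mul_apply, Fam.X_apply, Fam.C_apply, homEval_X_mul,
      homEval_C]
    split_ifs with hn
    · rw [← fderiv_eq_sum]
      exact ((hk.contDiffAt (U.isOpen.mem_nhds ht)).differentiableAt
        (by simp)).hasFDerivAt.comp_hasDerivAt t hc1
    · simpa using hasDerivAt_const t (0 : ℝ)
  -- The geodesic equation enters here: evaluating yᵏ gives the k-th component of the velocity, and
  -- Zyᵏ = -Qᵏ is its prescribed derivative.
  have hX : ∀ k, P (Fam.X k) := by
    intro k n
    have h1 : (fun τ => homEval n (extd (Fam.X k : Fam U).1 (c τ)) (w τ)) =ᶠ[nhds t]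
        fun τ => if n = 1 then w τ k else 0 := by
      filter_upwards [hU] with τ hτ
      rw [extd_apply (Fam.X k : Fam U).1 (⟨c τ, hτ⟩ : U), Fam.X_apply, homEval_X]
    refine HasDerivAt.congr_of_eventuallyEq ?_ h1
    rw [e, ← h.X_eq, JetConn.Z_X', Fam.neg_apply, homEval_neg]
    simp only [JetConn.Q, Fam.sum_apply, homEval_sum, Fam.mul_apply, X_eq, Γ_eq, Fam.X_apply,
      Fam.C_apply, mul_assoc, homEval_X_mul]
    cases n with
    | zero =>
      have : ∀ (m : Fin d) (f : Pow d), homEval 0 (MvPowerSeries.X m * f) (w t) = 0 := fun m f =>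
        homEval_of_van (VanAt.X_mul_zero m) _
      simpa [this] using hasDerivAt_const t (0 : ℝ)
    | succ n =>
      simp only [homEval_X_mul, homEval_C, Nat.add_eq_right]
      split_ifs with hn
      · refine (hc2 k).congr_deriv ?_
        congr 1
        exact Finset.sum_congr rfl fun r _ => Finset.sum_congr rfl fun q _ => by ring
      · simpa using hasDerivAt_const t (0 : ℝ)
  let T : Subring (Fam U) :=
    { carrier := {f | P f}
      mul_mem' := fun {f g} hf hg => hmul f g hf hg
      one_mem' := by
        have : (1 : Fam U) = Fam.C (fun _ => 1) contDiffOn_const :=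
          Fam.ext' fun u => by rw [Fam.one_apply, Fam.C_apply, map_one]
        rw [this]
        exact hC _ _
      add_mem' := fun {f g} hf hg => hadd f g hf hg
      zero_mem' := by
        have : (0 : Fam U) = Fam.C (fun _ => 0) contDiffOn_const :=
          Fam.ext' fun u => by rw [Fam.zero_apply, Fam.C_apply, map_zero]
        rw [this]
        exact hC _ _
      neg_mem' := fun {f} hf n => by
        simp only [extd_neg, homEval_neg, map_neg]
        exact (hf n).neg }
  -- Subtracting r changes neither degree n of g nor degree n + 1 of Zg, and g - r lies in the
  -- subring.
  obtain ⟨r, hr, hg⟩ := SmoothChange.fam_eq_add_of_degree n g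
  have hT : g - r ∈ T := by
    rw [hg, add_sub_cancel_right]
    exact T.sum_mem fun β _ => T.mul_mem (hC _ _) (T.prod_mem fun k _ => T.pow_mem (hX k) _)
  have h2 := (show P (g - r) from hT) n
  have h3 : ∀ v, homEval n (extd (g - r).1 v) = homEval n (extd g.1 v) := by
    intro v
    funext y
    have : extd g.1 v = extd (g - r).1 v + extd r.1 v := by rw [← extd_add, sub_add_cancel]
    rw [this, homEval_add, homEval_of_van (f := extd r.1 v), add_zero]
    by_cases hv : v ∈ U
    · rw [extd_apply r.1 (⟨v, hv⟩ : U)]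
      exact hr _
    · simp only [extd, hv, dite_false]
      exact VanAt.zero n
  have h4 : homEval (n + 1) (extd (h.jet.Z (g - r)).1 (c t)) (w t) =
      homEval (n + 1) (extd (h.jet.Z g).1 (c t)) (w t) := by
    have : h.jet.Z g = h.jet.Z (g - r) + h.jet.Z r := by rw [← map_add, sub_add_cancel]
    rw [this, extd_add, homEval_add, e (h.jet.Z r),
      homEval_of_van (h.Z_van hr _), add_zero]
  simp only [h3, h4] at h2
  exact h2

end SmoothConn

end Geodesic

/-! ### Existence, local uniqueness and coordinate change for geodesics -/

section GeodesicFlow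

variable {d : ℕ} {U : Opens (Model d)} {Γ : Chris d}

theorem hasDerivWithinAt_iff_coord {c : ℝ → Model d} {w : Model d} {s : Set ℝ} {t : ℝ} :
    HasDerivWithinAt c w s t ↔ ∀ k, HasDerivWithinAt (fun τ => c τ k) (w k) s t := by
  rw [hasDerivWithinAt_iff_hasFDerivWithinAt, hasFDerivWithinAt_euclidean]
  refine forall_congr' fun k => ?_
  rw [hasDerivWithinAt_iff_hasFDerivWithinAt]
  refine iff_of_eq (congrArg (fun L => HasFDerivWithinAt (fun τ => c τ k) L s t) ?_)
  ext
  simp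

/-- The power series `φ` is the Taylor series of a function that follows the geodesics. -/
theorem SmoothConn.isTaylorSeries_phi (h : SmoothConn U Γ) (u : U) (k : Fin d) {F : Model d → ℝ}
    (hF : ∀ y, ∃ (c w : ℝ → Model d) (s : Set ℝ), IsOpen s ∧ (0 : ℝ) ∈ s ∧ c 0 = u ∧ w 0 = y ∧
      (∀ t ∈ s, c t ∈ U ∧ GeodesicAt Γ c w Set.univ t) ∧ ∀ t ∈ s, F (t • y) = c t k) :
    IsTaylorSeries F (h.phi k u) := by
  intro y
  obtain ⟨c, w, s, hs, h0, hc0, hw0, hg, hFc⟩ := hF y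
  let x : Fam U := Fam.C _ (contDiffOn_coord k)
  -- G n is going to be the n-th derivative of the coordinate along the geodesic: each
  -- differentiation applies Z once and raises the degree by one.
  let G : ℕ → ℝ → ℝ := fun n τ => homEval n (extd (h.jet.Z^[n] x).1 (c τ)) (w τ)
  have hG : ∀ n, ∀ t ∈ s, HasDerivAt (G n) (G (n + 1) t) t := by
    intro n t ht
    have := h.hasDerivAt_homEval (hg t ht).1 (hg t ht).2 (h.jet.Z^[n] x) n
    simp only [G, Function.iterate_succ_apply']
    exact this
  have hG0 : ∀ t ∈ s, F (t • y) = G 0 t := by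
    intro t ht
    simp only [G, Function.iterate_zero, id]
    rw [extd_apply x.1 (⟨c t, (hg t ht).1⟩ : U), Fam.C_apply, homEval_C, if_pos rfl, hFc t ht]
  have hit : ∀ n, Set.EqOn (iteratedDerivWithin n (fun t => F (t • y)) s) (G n) s := by
    intro n
    induction n with
    | zero => intro t ht; rw [iteratedDerivWithin_zero, hG0 t ht]
    | succ n ih =>
      intro t ht
      rw [iteratedDerivWithin_succ, derivWithin_congr ih (ih ht), derivWithin_of_isOpen hs ht,
        (hG n t ht).deriv]
  refine ⟨?_, fun n => ?_⟩
  · have : ContDiffOn ℝ ∞ (fun t => F (t • y)) s :=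
      contDiffOn_of_differentiableOn_deriv fun n _ => fun t ht =>
        ((hG n t ht).differentiableAt.differentiableWithinAt).congr (fun τ hτ => hit n hτ) (hit n ht)
    exact this.contDiffAt (hs.mem_nhds h0)
  · rw [← iteratedDerivWithin_of_isOpen hs h0, hit n h0]
    simp only [G]
    rw [hw0, hc0, extd_apply, homEval, homEval, Finset.sum_div]
    refine Finset.sum_congr rfl fun α hα => ?_
    rw [phi, h.coeff_lift, mem_antidiag.1 hα]
    ring

/-- The vector field of the geodesic flow. -/
def geodesicField (Γ : Chris d) (z : Model d × Model d) : Model d × Model d :=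
  (z.2, WithLp.toLp 2 fun k => -∑ r, ∑ q, Γ z.1 r q k * z.2 r * z.2 q)

theorem SmoothConn.contDiffAt_geodesicField (h : SmoothConn U Γ) {z : Model d × Model d}
    (hz : z.1 ∈ U) : ContDiffAt ℝ 1 (geodesicField Γ) z := by
  refine ContDiffAt.prodMk contDiffAt_snd (contDiffAt_euclidean.2 fun k => ?_)
  refine (ContDiffAt.sum fun r _ => ContDiffAt.sum fun q _ => ContDiffAt.mul (ContDiffAt.mul ?_ ?_)
    ?_).neg
  · have h1 : ContDiffAt ℝ 1 (fun u => Γ u r q k) z.1 :=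
      ((h.smooth r q k).contDiffAt (U.isOpen.mem_nhds hz)).of_le (by simp)
    exact h1.comp z contDiffAt_fst
  · exact contDiffAt_euclidean.1 contDiffAt_snd r
  · exact contDiffAt_euclidean.1 contDiffAt_snd q

theorem geodesicAt_iff {c w : ℝ → Model d} {s : Set ℝ} {t : ℝ} :
    GeodesicAt Γ c w s t ↔
      HasDerivWithinAt (fun τ => (c τ, w τ)) (geodesicField Γ (c t, w t)) s t := by
  constructor
  · rintro ⟨h1, h2⟩
    refine h1.prodMk ?_
    exact hasDerivWithinAt_iff_coord.2 h2
  · intro h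
    exact ⟨h.fst, hasDerivWithinAt_iff_coord.1 h.snd⟩

/-- Picard–Lindelöf for the first-order system. The interval is two-sided because the Taylor
coefficients at t = 0 are ordinary, not one-sided, derivatives. -/
theorem SmoothConn.exists_geodesic (h : SmoothConn U Γ) {u : Model d} (hu : u ∈ U) (y : Model d) :
    ∃ (c w : ℝ → Model d) (ε : ℝ), 0 < ε ∧ c 0 = u ∧ w 0 = y ∧
      ∀ t ∈ Set.Ioo (-ε) ε, c t ∈ U ∧ GeodesicAt Γ c w Set.univ t := by
  obtain ⟨z, hz0, ε, hε, hz⟩ := (h.contDiffAt_geodesicField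
    (z := (u, y)) hu).exists_forall_mem_closedBall_exists_eq_forall_mem_Ioo_hasDerivAt₀ 0
  have hcont : ContinuousAt z 0 := (hz 0 (by simp [hε])).continuousAt
  have hU : ∀ᶠ t in nhds 0, (z t).1 ∈ U := by
    refine (continuousAt_fst.comp hcont).eventually (U.isOpen.mem_nhds ?_)
    simp [hz0, hu]
  obtain ⟨δ, hδ, hδU⟩ := Metric.eventually_nhds_iff.1 hU
  refine ⟨fun t => (z t).1, fun t => (z t).2, min ε δ, lt_min hε hδ, congrArg Prod.fst hz0,
    congrArg Prod.snd hz0,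
    fun t ht => ⟨hδU ?_, ?_⟩⟩
  · rw [Real.dist_eq, sub_zero, abs_lt]
    exact ⟨(neg_le_neg (min_le_right _ _)).trans_lt ht.1, ht.2.trans_le (min_le_right _ _)⟩
  · refine geodesicAt_iff.2 (hz t ⟨?_, ?_⟩).hasDerivWithinAt
    · have := (neg_le_neg (min_le_left ε δ)).trans_lt ht.1
      linarith
    · have := ht.2.trans_le (min_le_left ε δ)
      linarith

theorem GeodesicAt.mono {c w : ℝ → Model d} {s s' : Set ℝ} {t : ℝ} (h : GeodesicAt Γ c w s t)
    (hs : s' ⊆ s) : GeodesicAt Γ c w s' t :=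
  ⟨h.1.mono hs, fun k => (h.2 k).mono hs⟩

theorem GeodesicAt.continuousWithinAt {c w : ℝ → Model d} {s : Set ℝ} {t : ℝ}
    (h : GeodesicAt Γ c w s t) : ContinuousWithinAt (fun τ => (c τ, w τ)) s t :=
  (geodesicAt_iff.1 h).continuousWithinAt

/-- The geodesic equation is quadratic in the velocity, so scaling time by a scales the velocity by
a; negative a and a = 0 are included. -/
theorem GeodesicAt.comp_mul {c w : ℝ → Model d} {a t : ℝ}
    (h : GeodesicAt Γ c w Set.univ (a * t)) :
    GeodesicAt Γ (fun τ => c (a * τ)) (fun τ => a • w (a * τ)) Set.univ t := by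
  have hm : HasDerivAt (fun τ : ℝ => a * τ) a t := by simpa using (hasDerivAt_id t).const_mul a
  refine ⟨((hasDerivWithinAt_univ.1 h.1).scomp t hm).hasDerivWithinAt, fun k => ?_⟩
  have h2 := (((hasDerivWithinAt_univ.1 (h.2 k)).scomp t hm).const_mul a).hasDerivWithinAt
    (s := Set.univ)
  refine h2.congr_deriv ?_
  simp only [PiLp.smul_apply, smul_eq_mul, mul_neg, Finset.mul_sum]
  congr 1
  exact Finset.sum_congr rfl fun r _ => Finset.sum_congr rfl fun q _ => by ring

/-- Geodesics with the same initial position and velocity agree for a short time. -/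
theorem SmoothConn.geodesic_eventuallyEq (h : SmoothConn U Γ) {c₁ w₁ c₂ w₂ : ℝ → Model d} {a b : ℝ}
    (hab : a < b)
    (h1 : ∀ᶠ t in nhdsWithin a (Set.Icc a b), GeodesicAt Γ c₁ w₁ (Set.Icc a b) t)
    (h2 : ∀ᶠ t in nhdsWithin a (Set.Icc a b), GeodesicAt Γ c₂ w₂ (Set.Icc a b) t)
    (hU : c₁ a ∈ U) (hc : c₁ a = c₂ a) (hw : w₁ a = w₂ a) :
    ∀ᶠ t in nhdsWithin a (Set.Ioi a), c₁ t = c₂ t ∧ w₁ t = w₂ t := by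
  have ha : a ∈ Set.Icc a b := Set.left_mem_Icc.2 hab.le
  -- The field is C¹, hence Lipschitz only near the common initial point. The interval is cut down
  -- until both curves stay in this neighbourhood, and ε / 2 below keeps the closed interval inside
  -- the open ball.
  obtain ⟨K, V, hV, hK⟩ := (h.contDiffAt_geodesicField
    (z := (c₁ a, w₁ a)) hU).exists_lipschitzOnWith
  have e1 := (h1.self_of_nhdsWithin ha).continuousWithinAt.eventually hV
  have e2 := (h2.self_of_nhdsWithin ha).continuousWithinAt.eventually
    (p := fun z => z ∈ V) (by simp only [← hc, ← hw]; exact hV)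
  obtain ⟨ε, hε, hall⟩ := Metric.mem_nhdsWithin_iff.1 (h1.and (h2.and (e1.and e2)))
  let b' := min b (a + ε / 2)
  have hb' : a < b' := lt_min hab (by linarith)
  have hsub : Set.Icc a b' ⊆ Set.Icc a b := Set.Icc_subset_Icc_right (min_le_left _ _)
  have hmem : ∀ t ∈ Set.Icc a b', t ∈ Metric.ball a ε ∩ Set.Icc a b := by
    intro t ht
    refine ⟨?_, hsub ht⟩
    rw [Metric.mem_ball, Real.dist_eq, abs_lt]
    have := ht.2.trans (min_le_right b (a + ε / 2))
    constructor <;> linarith [ht.1]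
  have key : Set.EqOn (fun t => (c₁ t, w₁ t)) (fun t => (c₂ t, w₂ t)) (Set.Icc a b') := by
    have hnhds : ∀ t ∈ Set.Ico a b', Set.Icc a b ∈ nhdsWithin t (Set.Ici t) := by
      intro t ht
      refine Filter.mem_of_superset (Icc_mem_nhdsGE (ht.2.trans_le (min_le_left _ _))) ?_
      exact Set.Icc_subset_Icc_left ht.1
    refine ODE_solution_unique_of_mem_Icc_right (v := fun _ => geodesicField Γ) (s := fun _ => V)
      (K := K) (fun _ _ => hK) ?_ ?_ ?_ ?_ ?_ ?_ (by rw [hc, hw])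
    · exact fun t ht => ((hall (hmem t ht)).1.continuousWithinAt).mono hsub
    · intro t ht
      exact (geodesicAt_iff.1 (hall (hmem t ⟨ht.1, ht.2.le⟩)).1).mono_of_mem_nhdsWithin
        (hnhds t ht)
    · exact fun t ht => (hall (hmem t ⟨ht.1, ht.2.le⟩)).2.2.1
    · exact fun t ht => ((hall (hmem t ht)).2.1.continuousWithinAt).mono hsub
    · intro t ht
      exact (geodesicAt_iff.1 (hall (hmem t ⟨ht.1, ht.2.le⟩)).2.1).mono_of_mem_nhdsWithin
        (hnhds t ht)
    · exact fun t ht => (hall (hmem t ⟨ht.1, ht.2.le⟩)).2.2.2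
  filter_upwards [Ioc_mem_nhdsGT hb'] with t ht
  have := key ⟨ht.1.le, ht.2⟩
  exact ⟨congrArg Prod.fst this, congrArg Prod.snd this⟩

/-- Geodesics are preserved by changes of coordinates. -/
theorem GeodesicAt.change {W U' : Opens (Model d)} {ψ : Model d → Model d} {Γ' : Chris d}
    (hψ : SmoothChange W U' ψ) (law : ChristoffelLaw W ψ Γ Γ') {c w : ℝ → Model d} {s : Set ℝ}
    {t : ℝ} (ht : c t ∈ W) (h : GeodesicAt Γ c w s t) :
    GeodesicAt Γ' (fun τ => ψ (c τ))
      (fun τ => WithLp.toLp 2 fun l => ∑ j, jacM ψ (c τ) l j * w τ j) s t := by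
  refine ⟨?_, fun l => ?_⟩
  · refine hasDerivWithinAt_iff_coord.2 fun l => ?_
    have hd : DifferentiableAt ℝ (fun v => ψ v l) (c t) :=
      ((hψ.smooth_coord l).contDiffAt (W.isOpen.mem_nhds ht)).differentiableAt (by simp)
    refine (hd.hasFDerivAt.comp_hasDerivWithinAt t h.1).congr_deriv ?_
    rw [fderiv_eq_sum]
    exact Finset.sum_congr rfl fun j _ => mul_comm _ _
  · have hJ : ∀ j, HasDerivWithinAt (fun τ => jacM ψ (c τ) l j)
        (∑ i, w t i * fderiv ℝ (fun v => jacM ψ v l j) (c t) (stdVec d i)) s t := by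
      intro j
      have hd : DifferentiableAt ℝ (fun v => jacM ψ v l j) (c t) :=
        ((hψ.smooth_jacM l j).contDiffAt (W.isOpen.mem_nhds ht)).differentiableAt (by simp)
      rw [← fderiv_eq_sum]
      exact hd.hasFDerivAt.comp_hasDerivWithinAt t h.1
    have hsum := HasDerivWithinAt.fun_sum (u := Finset.univ) fun j _ => (hJ j).fun_mul (h.2 j)
    refine hsum.congr_deriv ?_
    -- Differentiating the velocity produces second derivatives of ψ. The Christoffel law eliminates
    -- them, and its Γ-part cancels the contribution of the geodesic equation of c.
    have e1 : ∀ i j, w t i * w t j * fderiv ℝ (fun v => jacM ψ v l j) (c t) (stdVec d i) =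
        w t i * w t j * ∑ k, jacM ψ (c t) l k * Γ (c t) i j k -
        w t i * w t j * ∑ r, ∑ q, Γ' (ψ (c t)) r q l * jacM ψ (c t) r i * jacM ψ (c t) q j := by
      intro i j
      rw [law _ ht]
      ring
    have e2 : ∑ j, (∑ i, w t i * fderiv ℝ (fun v => jacM ψ v l j) (c t) (stdVec d i)) * w t j =
        ∑ i, ∑ j, w t i * w t j * ∑ k, jacM ψ (c t) l k * Γ (c t) i j k -
        ∑ i, ∑ j, w t i * w t j * ∑ r, ∑ q, Γ' (ψ (c t)) r q l * jacM ψ (c t) r i *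
          jacM ψ (c t) q j := by
      simp only [← Finset.sum_sub_distrib, ← e1, Finset.sum_mul]
      rw [Finset.sum_comm]
      exact Finset.sum_congr rfl fun i _ => Finset.sum_congr rfl fun j _ => by ring
    have e3 : ∑ j, jacM ψ (c t) l j * -∑ r, ∑ q, Γ (c t) r q j * w t r * w t q =
        -∑ i, ∑ j, w t i * w t j * ∑ k, jacM ψ (c t) l k * Γ (c t) i j k := by
      simp only [mul_neg, Finset.sum_neg_distrib, Finset.mul_sum]
      rw [Finset.sum_comm, Finset.sum_congr rfl fun i _ => Finset.sum_comm]
      congr 1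
      exact Finset.sum_congr rfl fun i _ => Finset.sum_congr rfl fun j _ =>
        Finset.sum_congr rfl fun k _ => by ring
    have e4 : ∑ i, ∑ j, w t i * w t j * ∑ r, ∑ q, Γ' (ψ (c t)) r q l * jacM ψ (c t) r i *
          jacM ψ (c t) q j = ∑ r, ∑ q, Γ' (ψ (c t)) r q l * (∑ j, jacM ψ (c t) r j * w t j) *
          ∑ j, jacM ψ (c t) q j * w t j := by
      have : ∀ r q, Γ' (ψ (c t)) r q l * (∑ j, jacM ψ (c t) r j * w t j) *
          ∑ j, jacM ψ (c t) q j * w t j = ∑ i, ∑ j, w t i * w t j *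
          (Γ' (ψ (c t)) r q l * jacM ψ (c t) r i * jacM ψ (c t) q j) := by
        intro r q
        rw [mul_assoc, Finset.sum_mul_sum, Finset.mul_sum]
        refine Finset.sum_congr rfl fun i _ => ?_
        rw [Finset.mul_sum]
        exact Finset.sum_congr rfl fun j _ => by ring
      simp only [this]
      simp only [Finset.mul_sum]
      rw [Finset.sum_congr rfl fun i _ => Finset.sum_comm, Finset.sum_comm]
      refine Finset.sum_congr rfl fun r _ => ?_
      rw [Finset.sum_congr rfl fun i _ => Finset.sum_comm, Finset.sum_comm]
    rw [Finset.sum_add_distrib, e2, e3, e4]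
    ring

end GeodesicFlow

/-! ### Charts -/

section Charts

variable {d : ℕ} {M : Type*} [TopologicalSpace M] [ChartedSpace (Model d) M]

/-- The target of a chart. -/
def chTarget (d : ℕ) {M : Type*} [TopologicalSpace M] [ChartedSpace (Model d) M] (p : M) :
    Opens (Model d) :=
  ⟨(ch d p).target, (ch d p).open_target⟩

/-- The part of the target of the chart around `p` that lies in the chart around `p'`. -/
def overlap (d : ℕ) {M : Type*} [TopologicalSpace M] [ChartedSpace (Model d) M] (p p' : M) :
    Opens (Model d) :=
  ⟨((ch d p).symm.trans (ch d p')).source, ((ch d p).symm.trans (ch d p')).open_source⟩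

/-- The change from the chart around `p` to the chart around `p'`. -/
def transMap (d : ℕ) {M : Type*} [TopologicalSpace M] [ChartedSpace (Model d) M] (p p' : M) :
    Model d → Model d :=
  ch d p' ∘ (ch d p).symm

theorem mem_overlap {p p' : M} {u : Model d} :
    u ∈ overlap d p p' ↔ u ∈ (ch d p).target ∧ (ch d p).symm u ∈ (ch d p').source := by
  change u ∈ ((ch d p).symm.trans (ch d p')).source ↔ _
  rw [OpenPartialHomeomorph.trans_source]
  rfl

theorem mem_overlap_of_mem {p p' x : M} (hx : x ∈ (ch d p).source) (hx' : x ∈ (ch d p').source) :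
    ch d p x ∈ overlap d p p' :=
  mem_overlap.2 ⟨(ch d p).map_source hx, by rwa [(ch d p).left_inv hx]⟩

variable [IsManifold (𝓡 d) ∞ M]

theorem smoothChange_transMap (p p' : M) :
    SmoothChange (overlap d p p') (chTarget d p') (transMap d p p') where
  smooth := by
    have := contDiffOn_ext_coord_change (I := 𝓡 d) (n := ∞) p' p
    simpa [extChartAt, overlap, transMap, OpenPartialHomeomorph.extend] using this
  maps u hu := (ch d p').map_source (mem_overlap.1 hu).2

theorem tangentCoordChange_eq (p p' x : M) :
    tangentCoordChange (𝓡 d) p p' x = fderiv ℝ (transMap d p p') (ch d p x) := by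
  rw [tangentCoordChange_def]
  simp [extChartAt, transMap, OpenPartialHomeomorph.extend, fderivWithin_univ]

theorem jac_eq_jacM {p p' x : M} (hx : x ∈ (ch d p).source) (hx' : x ∈ (ch d p').source) :
    jac d p p' x = jacM (transMap d p p') (ch d p x) := by
  funext k i
  have hd : DifferentiableAt ℝ (transMap d p p') (ch d p x) :=
    ((smoothChange_transMap p p').smooth.contDiffAt ((overlap d p p').isOpen.mem_nhds
      (mem_overlap_of_mem hx hx'))).differentiableAt (by simp)
  have : (fun v => transMap d p p' v k) =
      (EuclideanSpace.proj k : Model d →L[ℝ] ℝ) ∘ transMap d p p' := rfl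
  rw [jac, tangentCoordChange_eq, jacM, this,
    fderiv_comp _ (ContinuousLinearMap.differentiableAt _) hd, ContinuousLinearMap.fderiv]
  rfl

/-- The `k`-th component of a tangent vector in the chart around `p`. -/
theorem frameCoeff_eq {p x : M} (hx : x ∈ (ch d p).source) (v : TangentSpace (𝓡 d) x) (k : Fin d) :
    (trivializationAt (Model d) (TangentSpace (𝓡 d)) p).localFrameCoeff (𝓡 d)
      (EuclideanSpace.basisFun (Fin d) ℝ).toBasis k x v =
      (tangentCoordChange (𝓡 d) x p x v) k := by
  classical
  -- The comparison of coefficients is formulated for sections, and the coefficient at x sees only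
  -- the value at x; so a section equal to v at x and zero elsewhere suffices.
  let s : ∀ y : M, TangentSpace (𝓡 d) y := fun y => if h : x = y then h ▸ v else 0
  have hs : s x = v := by simp [s]
  have := (trivializationAt (Model d) (TangentSpace (𝓡 d)) p).localFrameCoeff_eq_coeff
    (I := 𝓡 d) (b := (EuclideanSpace.basisFun (Fin d) ℝ).toBasis) (s := s) (x := x) hx (i := k)
  rw [hs] at this
  rw [this]
  simp only [OrthonormalBasis.coe_toBasis_repr_apply, EuclideanSpace.basisFun_repr, hs]
  rfl

/-- Tangent vectors at x are expressed in the preferred chart at x, so ∂ᵢ of the chart around p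
appears as the i-th column of the Jacobian from p to x. -/
theorem coordField_eq {p x : M} (hx : x ∈ (ch d p).source) (i : Fin d) :
    coordField d p i x = tangentCoordChange (𝓡 d) p x x (stdVec d i) := by
  have hx' : x ∈ (trivializationAt (Model d) (TangentSpace (𝓡 d)) p).baseSet := hx
  rw [coordField, Bundle.Trivialization.localFrame_apply_of_mem_baseSet _ _ hx',
    Bundle.Trivialization.basisAt, Module.Basis.map_apply]
  have := TangentBundle.symmL_trivializationAt_eq_core (I := 𝓡 d) (b₀ := p) (b := x) hx
  have h1 : (EuclideanSpace.basisFun (Fin d) ℝ).toBasis i = stdVec d i := by simp [stdVec]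
  rw [h1]
  exact ((trivializationAt (Model d) (TangentSpace (𝓡 d)) p).symmL_apply (R := ℝ) hx' _).symm.trans
    (congrArg (fun L : Model d →L[ℝ] Model d => L (stdVec d i)) this)

theorem frameCoeff_coordField {p q x : M} (hp : x ∈ (ch d p).source) (hq : x ∈ (ch d q).source)
    (j k : Fin d) : (trivializationAt (Model d) (TangentSpace (𝓡 d)) p).localFrameCoeff (𝓡 d)
      (EuclideanSpace.basisFun (Fin d) ℝ).toBasis k x (coordField d q j x) = jac d q p x k j := by
  rw [frameCoeff_eq hp, coordField_eq hq, jac]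
  have := tangentCoordChange_comp (I := 𝓡 d) (w := q) (x := x) (y := p) (z := x) (v := stdVec d j)
    (by simp [hp, hq])
  exact congrArg (fun v : Model d => v k) this

theorem eq_sum_coordField {p x : M} (hx : x ∈ (ch d p).source) (v : TangentSpace (𝓡 d) x) :
    v = ∑ k, (trivializationAt (Model d) (TangentSpace (𝓡 d)) p).localFrameCoeff (𝓡 d)
      (EuclideanSpace.basisFun (Fin d) ℝ).toBasis k x v • coordField d p k x := by
  classical
  let s : ∀ y : M, TangentSpace (𝓡 d) y := fun y => if h : x = y then h ▸ v else 0
  have hs : s x = v := by simp [s]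
  have := (trivializationAt (Model d) (TangentSpace (𝓡 d)) p).eq_sum_localFrameCoeff_smul
    (I := 𝓡 d) (b := (EuclideanSpace.basisFun (Fin d) ℝ).toBasis) (s := s) (x' := x) hx
  rwa [hs] at this

theorem coordField_eq_sum {p p' x : M} (hx : x ∈ (ch d p).source) (hx' : x ∈ (ch d p').source)
    (j : Fin d) : coordField d p j x = ∑ k, jac d p p' x k j • coordField d p' k x := by
  conv_lhs => rw [eq_sum_coordField hx' (coordField d p j x)]
  exact Finset.sum_congr rfl fun k _ => by rw [frameCoeff_coordField hx' hx]

theorem jac_self {p x : M} (hx : x ∈ (ch d p).source) (k i : Fin d) :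
    jac d p p x k i = if k = i then 1 else 0 := by
  rw [jac, tangentCoordChange_self (by simpa [extChartAt_source] using hx)]
  simp [stdVec]

theorem jac_comp {p p' p'' x : M} (hp : x ∈ (ch d p).source) (hp' : x ∈ (ch d p').source)
    (hp'' : x ∈ (ch d p'').source) (k i : Fin d) :
    ∑ m, jac d p' p'' x k m * jac d p p' x m i = jac d p p'' x k i := by
  rw [jac, ← tangentCoordChange_comp (I := 𝓡 d) (x := p') (by simp [*])]
  have h2 : tangentCoordChange (𝓡 d) p p' x (stdVec d i) =
      ∑ a, jac d p p' x a i • stdVec d a := by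
    have := (EuclideanSpace.basisFun (Fin d) ℝ).sum_repr
      (tangentCoordChange (𝓡 d) p p' x (stdVec d i))
    simpa [stdVec, jac] using this.symm
  rw [h2, map_sum]
  simp [jac, mul_comm]

theorem contMDiffAt_coordField {p x : M} (hx : x ∈ (ch d p).source) (i : Fin d) :
    ContMDiffAt (𝓡 d) ((𝓡 d).prod 𝓘(ℝ, Model d)) ∞
      (fun y => (⟨y, coordField d p i y⟩ : TangentBundle (𝓡 d) M)) x :=
  contMDiffAt_localFrame_of_mem ∞ _ _ i hx

theorem mdifferentiableAt_coordField {p x : M} (hx : x ∈ (ch d p).source) (i : Fin d) :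
    MDifferentiableAt (𝓡 d) ((𝓡 d).prod 𝓘(ℝ, Model d))
      (fun y => (⟨y, coordField d p i y⟩ : TangentBundle (𝓡 d) M)) x :=
  (contMDiffAt_coordField hx i).mdifferentiableAt (by simp)

end Charts

/-! ### Christoffel symbols -/

section Christoffel

open scoped Topology

variable {d : ℕ} {M : Type*} [TopologicalSpace M] [ChartedSpace (Model d) M]
  [IsManifold (𝓡 d) ∞ M]
  (cov : CovariantDerivative (𝓡 d) (Model d) (TangentSpace (𝓡 d) : M → Type _))

theorem cov_coordField {p x : M} (hx : x ∈ (ch d p).source) (i j : Fin d) :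
    cov (coordField d p j) x (coordField d p i x) =
      ∑ k, christoffel cov p (ch d p x) i j k • coordField d p k x := by
  have := eq_sum_coordField hx (cov (coordField d p j) x (coordField d p i x))
  refine this.trans (Finset.sum_congr rfl fun k _ => ?_)
  rw [christoffel, (ch d p).left_inv hx]

theorem exists_bump [T2Space M] {p x : M} (hx : x ∈ (ch d p).source) :
    ∃ f : M → ℝ, ContMDiff (𝓡 d) 𝓘(ℝ, ℝ) ∞ f ∧ tsupport f ⊆ (ch d p).source ∧
      f =ᶠ[𝓝 x] 1 := by
  obtain ⟨f, -, hf⟩ := (SmoothBumpFunction.nhds_basis_tsupport (I := 𝓡 d) x).mem_iff.1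
    ((ch d p).open_source.mem_nhds hx)
  exact ⟨f, f.contMDiff, hf, f.eventuallyEq_one⟩

/-- The smoothness of the connection is applied to a global field, so ∂ⱼ is cut off by a bump
function equal to 1 near x. This does not change the covariant derivative near x, which depends only
on germs. -/
theorem contMDiffAt_cov_coordField [T2Space M]
    (hcov : CovariantDerivative.ContMDiffCovariantDerivative cov ∞)
    {p x : M} (hx : x ∈ (ch d p).source) (j : Fin d) :
    ContMDiffAt (𝓡 d) ((𝓡 d).prod 𝓘(ℝ, Model d →L[ℝ] Model d)) ∞
      (fun y => (⟨y, cov (coordField d p j) y⟩ : Bundle.TotalSpace (Model d →L[ℝ] Model d)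
        fun y : M => TangentSpace (𝓡 d) y →L[ℝ] TangentSpace (𝓡 d) y)) x := by
  obtain ⟨f, hf, hs, h1⟩ := exists_bump (d := d) hx
  have hσ : ContMDiff (𝓡 d) ((𝓡 d).prod 𝓘(ℝ, Model d)) ∞
      (fun y => (⟨y, (f • coordField d p j) y⟩ : TangentBundle (𝓡 d) M)) :=
    ContMDiffOn.smul_section_of_tsupport hf.contMDiffOn (ch d p).open_source hs
      fun y hy => (contMDiffAt_coordField hy j).contMDiffWithinAt
  have h2 := hcov.contMDiff.contMDiff (σ := f • coordField d p j)
    (by simpa using hσ.contMDiffOn)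
  refine (h2.contMDiffAt Filter.univ_mem).congr_of_eventuallyEq ?_
  filter_upwards [h1.eventuallyEq_nhds, (ch d p).open_source.mem_nhds hx] with y hy hyp
  have := cov.isCovariantDerivativeOn.congr_of_eventuallyEq
    (mdifferentiableAt_coordField hyp j)
    ((hσ y).mdifferentiableAt (by simp)) Filter.univ_mem
    (by filter_upwards [hy] with z hz; simp [hz])
  rw [this]

theorem contDiffOn_christoffel [T2Space M]
    (hcov : CovariantDerivative.ContMDiffCovariantDerivative cov ∞) (p : M) (i j k : Fin d) :
    ContDiffOn ℝ ∞ (fun u => christoffel cov p u i j k) (chTarget d p) := by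
  intro u hu
  have hx : (ch d p).symm u ∈ (ch d p).source := (ch d p).map_target hu
  have h1 := (contMDiffAt_cov_coordField cov hcov hx j).clm_bundle_apply
    (contMDiffAt_coordField hx i)
  have h2 := contMDiffAt_localFrameCoeff (EuclideanSpace.basisFun (Fin d) ℝ).toBasis
    (e := trivializationAt (Model d) (TangentSpace (𝓡 d)) p) (I := 𝓡 d) hx h1 k
  have h3 : ContMDiffAt (𝓡 d) (𝓡 d) ∞ (ch d p).symm u :=
    (contMDiffOn_chart_symm (I := 𝓡 d) (H := Model d) (x := p)).contMDiffAt
      ((ch d p).open_target.mem_nhds hu)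
  exact (contMDiffAt_iff_contDiffAt.1 (h2.comp u h3)).contDiffWithinAt

/-- A constant vector field on the model space. -/
def constField (d : ℕ) (v : Model d) (u : Model d) : TangentSpace (𝓡 d) u := v

theorem coordField_eq_mpullback {p x : M} (hx : x ∈ (ch d p).source) (i : Fin d) :
    coordField d p i x =
      VectorField.mpullback (𝓡 d) (𝓡 d) (ch d p) (constField d (stdVec d i)) x := by
  have h : mfderiv (𝓡 d) (𝓡 d) (ch d p) x = tangentCoordChange (𝓡 d) x p x :=
    mfderiv_chartAt_eq_tangentCoordChange (by simpa [extChartAt_source] using hx)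
  have h1 : ∀ v : Model d, tangentCoordChange (𝓡 d) x p x (tangentCoordChange (𝓡 d) p x x v) = v :=
    fun v => (tangentCoordChange_comp (by simp [hx])).trans
      (tangentCoordChange_self (by simpa [extChartAt_source] using hx))
  have h2 : ∀ v : Model d, tangentCoordChange (𝓡 d) p x x (tangentCoordChange (𝓡 d) x p x v) = v :=
    fun v => (tangentCoordChange_comp (by simp [hx])).trans (tangentCoordChange_self (by simp))
  have hi : (tangentCoordChange (𝓡 d) x p x).inverse = tangentCoordChange (𝓡 d) p x x :=
    ContinuousLinearMap.inverse_eq (ContinuousLinearMap.ext h1) (ContinuousLinearMap.ext h2)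
  rw [coordField_eq hx, VectorField.mpullback_apply, h]
  exact (congrArg (fun L : Model d →L[ℝ] Model d => L (stdVec d i)) hi).symm

/-- Coordinate fields are pull-backs of constant fields, which commute, and pull-back is compatible
with the Lie bracket. -/
theorem mlieBracket_coordField {p x : M} (hx : x ∈ (ch d p).source) (i j : Fin d) :
    VectorField.mlieBracket (𝓡 d) (coordField d p i) (coordField d p j) x = 0 := by
  have : IsManifold (𝓡 d) (minSmoothness ℝ 2) M := by
    rw [minSmoothness_of_isRCLikeNormedField]
    exact IsManifold.of_le (n := ∞) (by norm_cast)
  have key : ∀ i, coordField d p i =ᶠ[𝓝 x] VectorField.mpullback (𝓡 d) (𝓡 d) (ch d p)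
      (constField d (stdVec d i)) := fun i =>
    Filter.eventually_of_mem ((ch d p).open_source.mem_nhds hx)
      fun y hy => coordField_eq_mpullback hy i
  have hc : ∀ i, MDifferentiableAt (𝓡 d) (𝓡 d).tangent
      (fun y : Model d => (⟨y, constField d (stdVec d i) y⟩ : TangentBundle (𝓡 d) (Model d)))
      (ch d p x) := fun i =>
    (mdifferentiableAt_totalSpace ..).2 ⟨mdifferentiableAt_id, by
      simpa [constField] using mdifferentiableAt_const⟩
  rw [(key i).mlieBracket_vectorField_eq (key j),
    ← VectorField.mpullback_mlieBracket (n := ∞) (hc i) (hc j)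
      ((contMDiffOn_chart (I := 𝓡 d) (H := Model d) (x := p)).contMDiffAt
        ((ch d p).open_source.mem_nhds hx))
      (by rw [minSmoothness_of_isRCLikeNormedField]; norm_cast)]
  have h0 : VectorField.mlieBracket (𝓡 d) (constField d (stdVec d i))
      (constField d (stdVec d j)) (ch d p x) = 0 := by
    rw [← VectorField.mlieBracketWithin_univ, VectorField.mlieBracketWithin_eq_lieBracketWithin]
    have hf : ∀ v : Model d, fderivWithin ℝ (constField d v : Model d → Model d) Set.univ
        (ch d p x) = 0 := fun v => fderivWithin_const_apply ..
    change fderivWithin ℝ (constField d (stdVec d j) : Model d → Model d) Set.univ (ch d p x) _ -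
      fderivWithin ℝ (constField d (stdVec d i) : Model d → Model d) Set.univ (ch d p x) _ = _
    rw [hf, hf]
    exact sub_self (0 : Model d)
  rw [VectorField.mpullback_apply, h0, map_zero]

/-- Without torsion, ∇_{∂ᵢ}∂ⱼ and ∇_{∂ⱼ}∂ᵢ differ by the bracket [∂ᵢ, ∂ⱼ] = 0, whence the symmetry.
-/
theorem smoothConn_christoffel [T2Space M]
    (hcov : CovariantDerivative.ContMDiffCovariantDerivative cov ∞) (ht : cov.torsion = 0)
    (p : M) : SmoothConn (chTarget d p) (christoffel cov p) where
  smooth := contDiffOn_christoffel cov hcov p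
  symm u hu i j k := by
    have hx : (ch d p).symm u ∈ (ch d p).source := (ch d p).map_target hu
    have h := cov.torsion_eq_zero_iff.1 ht (mdifferentiableAt_coordField hx i)
      (mdifferentiableAt_coordField hx j)
    rw [mlieBracket_coordField hx, sub_eq_zero] at h
    rw [christoffel, christoffel, h]

theorem mvfderiv_comp_chart {p x : M} (hx : x ∈ (ch d p).source) {G : Model d → ℝ}
    (hG : DifferentiableAt ℝ G (ch d p x)) (i : Fin d) :
    mvfderiv (𝓡 d) (fun y => G (ch d p y)) x (coordField d p i x) =
      fderiv ℝ G (ch d p x) (stdVec d i) := by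
  have h1 : HasMFDerivAt (𝓡 d) (𝓡 d) (ch d p) x (tangentCoordChange (𝓡 d) x p x) := by
    have h := (((contMDiffOn_chart (I := 𝓡 d) (n := ∞) (H := Model d) (x := p)).contMDiffAt
      ((ch d p).open_source.mem_nhds hx)).mdifferentiableAt (by simp)).hasMFDerivAt
    rwa [show mfderiv (𝓡 d) (𝓡 d) (chartAt (Model d) p) x = tangentCoordChange (𝓡 d) x p x from
      mfderiv_chartAt_eq_tangentCoordChange (by simpa [extChartAt_source] using hx)] at h
  have h2 := hG.hasFDerivAt.hasMFDerivAt.comp x h1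
  have h3 : tangentCoordChange (𝓡 d) x p x (coordField d p i x) = stdVec d i := by
    rw [coordField_eq hx]
    exact (tangentCoordChange_comp (by simp [hx])).trans
      (tangentCoordChange_self (by simpa [extChartAt_source] using hx))
  have h4 : mfderiv (𝓡 d) 𝓘(ℝ, ℝ) (fun y => G (ch d p y)) x = _ := h2.mfderiv
  rw [mvfderiv, h4]
  exact congrArg (fderiv ℝ G (ch d p x)) h3

/-- Additivity of the covariant derivative asks for differentiable summands, so differentiability of
the partial sums is carried along in the induction. -/
theorem cov_sum {ι : Type*} (s : Finset ι) (g : ι → M → ℝ) (σ : ι → ∀ y : M, TangentSpace (𝓡 d) y)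
    {x : M} (hg : ∀ k, MDifferentiableAt (𝓡 d) 𝓘(ℝ, ℝ) (g k) x)
    (hσ : ∀ k, MDifferentiableAt (𝓡 d) ((𝓡 d).prod 𝓘(ℝ, Model d))
      (fun y => (⟨y, σ k y⟩ : TangentBundle (𝓡 d) M)) x) :
    MDifferentiableAt (𝓡 d) ((𝓡 d).prod 𝓘(ℝ, Model d))
      (fun y => (⟨y, (∑ k ∈ s, g k • σ k) y⟩ : TangentBundle (𝓡 d) M)) x ∧
    ∀ v, cov (∑ k ∈ s, g k • σ k) x v =
      ∑ k ∈ s, (g k x • cov (σ k) x v + mvfderiv (𝓡 d) (g k) x v • σ k x) := by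
  classical
  induction s using Finset.induction_on with
  | empty =>
    refine ⟨(Bundle.contMDiff_zeroSection (n := ∞) ℝ (TangentSpace (𝓡 d) : M → Type _) x).mdifferentiableAt
      (by simp), fun v => ?_⟩
    rw [Finset.sum_empty, Finset.sum_empty, cov.zero]
    rfl
  | insert a s ha ih =>
    have h1 := (hg a).smul_section (hσ a)
    rw [Finset.sum_insert ha]
    refine ⟨mdifferentiableAt_add_section h1 ih.1, fun v => ?_⟩
    rw [cov.isCovariantDerivativeOn.add (s := Set.univ) h1 ih.1,
      cov.isCovariantDerivativeOn.leibniz (s := Set.univ) (hσ a) (hg a), Finset.sum_insert ha]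
    rw [add_apply, ih.2]
    rfl

/-- Near x, the field ∂ⱼ is a combination of the ∂'ₖ with the Jacobian as coefficients. Apply ∇_{∂ᵢ}
by the Leibniz rule, expand ∂ᵢ in the ∂'ᵣ as well, and take the component along ∂'ₗ. -/
theorem christoffelLaw_transMap (p p' : M) :
    ChristoffelLaw (overlap d p p') (transMap d p p') (christoffel cov p) (christoffel cov p') := by
  intro u hu i j l
  obtain ⟨ht, hx'⟩ := mem_overlap.1 hu
  have hx : (ch d p).symm u ∈ (ch d p).source := (ch d p).map_target ht
  have hux : ch d p ((ch d p).symm u) = u := (ch d p).right_inv ht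
  have hux' : ch d p' ((ch d p).symm u) = transMap d p p' u := rfl
  set x := (ch d p).symm u with hxdef
  have hG : ∀ k, DifferentiableAt ℝ (fun v => jacM (transMap d p p') v k j) (ch d p x) := by
    intro k
    rw [hux]
    exact (((smoothChange_transMap p p').smooth_jacM k j).contDiffAt
      ((overlap d p p').isOpen.mem_nhds hu)).differentiableAt (by simp)
  have hg : ∀ k, MDifferentiableAt (𝓡 d) 𝓘(ℝ, ℝ)
      (fun y => jacM (transMap d p p') (ch d p y) k j) x := fun k =>
    (hG k).mdifferentiableAt.comp x
      (((contMDiffOn_chart (I := 𝓡 d) (n := ∞) (H := Model d) (x := p)).contMDiffAt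
        ((ch d p).open_source.mem_nhds hx)).mdifferentiableAt (by simp))
  have hs := cov_sum cov Finset.univ (fun k y => jacM (transMap d p p') (ch d p y) k j)
    (coordField d p') hg (fun k => mdifferentiableAt_coordField hx' k)
  have he : cov (coordField d p j) x = _ := cov.isCovariantDerivativeOn.congr_of_eventuallyEq
    (mdifferentiableAt_coordField hx j) hs.1 Filter.univ_mem (by
      filter_upwards [(ch d p).open_source.mem_nhds hx, (ch d p').open_source.mem_nhds hx']
        with y hy hy'
      rw [coordField_eq_sum hy hy', jac_eq_jacM hy hy']
      simp)
  have h1 := cov_coordField cov hx i j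
  rw [he, hs.2] at h1
  have h2 := congrArg ((trivializationAt (Model d) (TangentSpace (𝓡 d)) p').localFrameCoeff (𝓡 d)
      (EuclideanSpace.basisFun (Fin d) ℝ).toBasis l x) h1
  simp only [map_sum, map_add, map_smul, frameCoeff_coordField hx' hx,
    frameCoeff_coordField hx' hx', jac_self hx', mvfderiv_comp_chart hx (hG _)] at h2
  simp only [coordField_eq_sum hx hx' i, map_sum, map_smul, cov_coordField cov hx',
    frameCoeff_coordField hx' hx', jac_self hx', jac_eq_jacM hx hx', hux, hux'] at h2
  simp only [smul_eq_mul, mul_ite, mul_one, mul_zero, Finset.sum_ite_eq, Finset.mem_univ, if_true,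
    Finset.sum_add_distrib] at h2
  rw [Finset.sum_congr rfl fun k _ => mul_comm _ _, ← h2, add_comm]
  congr 1
  rw [Finset.sum_comm]
  refine Finset.sum_congr rfl fun r _ => ?_
  rw [Finset.mul_sum]
  exact Finset.sum_congr rfl fun s _ => by ring

end Christoffel

/-! ### Geodesics of a manifold -/

section Geodesics

open scoped Topology

variable {d : ℕ} {M : Type*} [TopologicalSpace M] [ChartedSpace (Model d) M]
  [IsManifold (𝓡 d) ∞ M]
  (cov : CovariantDerivative (𝓡 d) (Model d) (TangentSpace (𝓡 d) : M → Type _))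

/-- Change of chart for the velocity of a curve. -/
theorem hasDerivWithinAt_chart_change {p q : M} {γ : ℝ → M} {v : Model d} {s : Set ℝ} {t : ℝ}
    (hts : t ∈ s) (hc : ContinuousWithinAt γ s t) (hp : γ t ∈ (ch d p).source)
    (hq : γ t ∈ (ch d q).source) (h : HasDerivWithinAt (fun τ => ch d p (γ τ)) v s t) :
    HasDerivWithinAt (fun τ => ch d q (γ τ)) (tangentCoordChange (𝓡 d) p q (γ t) v) s t := by
  have hd : DifferentiableAt ℝ (transMap d p q) (ch d p (γ t)) :=
    ((smoothChange_transMap p q).smooth.contDiffAt ((overlap d p q).isOpen.mem_nhds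
      (mem_overlap_of_mem hp hq))).differentiableAt (by simp)
  rw [tangentCoordChange_eq]
  refine (hd.hasFDerivAt.comp_hasDerivWithinAt t h).congr_of_eventuallyEq_of_mem ?_ hts
  filter_upwards [hc.eventually ((ch d p).open_source.mem_nhds hp)] with τ hτ
  simp [transMap, (ch d p).left_inv hτ]

variable {cov}

/-- Continuous induction along [0, 1] on the set where the curves agree together with their
velocities in every chart. Velocities are included so that local uniqueness for the second-order
equation can be restarted at each time. -/
theorem IsGeodesic.eqOn [T2Space M]
    (hcov : CovariantDerivative.ContMDiffCovariantDerivative cov ∞) (ht : cov.torsion = 0)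
    {γ₁ γ₂ : ℝ → M} (h₁ : IsGeodesic cov γ₁) (h₂ : IsGeodesic cov γ₂) {x : M} (hx₁ : γ₁ 0 = x)
    (hx₂ : γ₂ 0 = x) {v : Model d}
    (hv₁ : HasDerivWithinAt (fun τ => ch d x (γ₁ τ)) v (Set.Icc 0 1) 0)
    (hv₂ : HasDerivWithinAt (fun τ => ch d x (γ₂ τ)) v (Set.Icc 0 1) 0) :
    Set.EqOn γ₁ γ₂ (Set.Icc 0 1) := by
  obtain ⟨hc₁, h₁⟩ := h₁
  obtain ⟨hc₂, h₂⟩ := h₂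
  choose w₁ h₁ using h₁
  choose w₂ h₂ using h₂
  have hu : UniqueDiffOn ℝ (Set.Icc (0 : ℝ) 1) := uniqueDiffOn_Icc one_pos
  have h0 : (0 : ℝ) ∈ Set.Icc (0 : ℝ) 1 := by simp
  let s : Set ℝ := {τ | γ₁ τ = γ₂ τ ∧ ∀ q, γ₁ τ ∈ (ch d q).source → w₁ q τ = w₂ q τ}
  have hwc : ∀ (γ : ℝ → M) (w : M → ℝ → Model d) (_ : ∀ p, ∀ t ∈ Set.Icc (0 : ℝ) 1,
      γ t ∈ (ch d p).source → GeodesicAt (christoffel cov p) (fun τ => ch d p (γ τ)) (w p)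
        (Set.Icc 0 1) t) (p : M) (t) (_ : t ∈ Set.Icc (0 : ℝ) 1) (_ : γ t ∈ (ch d p).source),
      ContinuousWithinAt (w p) (Set.Icc 0 1) t := fun γ w h p t ht hp =>
    (h p t ht hp).continuousWithinAt.snd
  suffices Set.Icc 0 1 ⊆ s from fun τ hτ => (this hτ).1
  refine IsClosed.Icc_subset_of_forall_mem_nhdsWithin ?_ ?_ ?_
  -- Closedness: positions and velocities are continuous, and limits in M are unique.
  · refine isClosed_of_closure_subset fun τ hτ => ?_
    have hτ1 : τ ∈ Set.Icc (0 : ℝ) 1 :=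
      isClosed_Icc.closure_subset (closure_mono Set.inter_subset_right hτ)
    have hne : (𝓝[s ∩ Set.Icc 0 1] τ).NeBot := mem_closure_iff_nhdsWithin_neBot.1 hτ
    have hle : 𝓝[s ∩ Set.Icc 0 1] τ ≤ 𝓝[Set.Icc 0 1] τ := nhdsWithin_mono _ Set.inter_subset_right
    have hs : ∀ᶠ t in 𝓝[s ∩ Set.Icc 0 1] τ, t ∈ s :=
      eventually_mem_nhdsWithin.mono fun t ht => ht.1
    have he : γ₁ τ = γ₂ τ := tendsto_nhds_unique_of_eventuallyEq ((hc₁ τ hτ1).mono_left hle)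
      ((hc₂ τ hτ1).mono_left hle) (hs.mono fun t ht => ht.1)
    refine ⟨⟨he, fun q hq => ?_⟩, hτ1⟩
    refine tendsto_nhds_unique_of_eventuallyEq ((hwc γ₁ w₁ h₁ q τ hτ1 hq).mono_left hle)
      ((hwc γ₂ w₂ h₂ q τ hτ1 (he ▸ hq)).mono_left hle) ?_
    filter_upwards [hs, ((hc₁ τ hτ1).mono_left hle).eventually
      ((ch d q).open_source.mem_nhds hq)] with t ht hqt
    exact ht.2 q hqt
  -- At time 0 the velocity is prescribed only in the chart at x; the other charts follow by change
  -- of chart and uniqueness of derivatives within [0, 1].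
  · refine ⟨hx₁.trans hx₂.symm, fun q hq => ?_⟩
    have e₁ := hasDerivWithinAt_chart_change (p := x) (q := q) h0 (hc₁ 0 h0) (by simp [hx₁]) hq hv₁
    have e₂ := hasDerivWithinAt_chart_change (p := x) (q := q) h0 (hc₂ 0 h0) (by simp [hx₂])
      (by rwa [hx₂, ← hx₁]) hv₂
    rw [hx₁] at e₁
    rw [hx₂] at e₂
    exact ((hu 0 h0).eq_deriv _ (h₁ q 0 h0 hq).1 e₁).trans
      ((hu 0 h0).eq_deriv _ (h₂ q 0 h0 (by rwa [hx₂, ← hx₁])).1 e₂).symm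
  -- Continuation to the right: local uniqueness in the chart at the point reached. Agreement of the
  -- curves near a later time then gives equal velocities in every other chart.
  · rintro τ ⟨⟨he, hw⟩, hτ0, hτ1⟩
    have hτ : τ ∈ Set.Icc (0 : ℝ) 1 := ⟨hτ0, hτ1.le⟩
    have hsub : Set.Icc τ 1 ⊆ Set.Icc (0 : ℝ) 1 := Set.Icc_subset_Icc_left hτ0
    have hle : 𝓝[>] τ ≤ 𝓝[Set.Icc 0 1] τ := by
      rw [← nhdsWithin_Ioo_eq_nhdsGT hτ1]
      exact nhdsWithin_mono _ (Set.Ioo_subset_Icc_self.trans hsub)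
    set q := γ₁ τ with hq
    have hs₁ : ∀ᶠ t in 𝓝[Set.Icc 0 1] τ, γ₁ t ∈ (ch d q).source :=
      (hc₁ τ hτ).eventually ((ch d q).open_source.mem_nhds (by simp [q]))
    have hs₂ : ∀ᶠ t in 𝓝[Set.Icc 0 1] τ, γ₂ t ∈ (ch d q).source :=
      (hc₂ τ hτ).eventually ((ch d q).open_source.mem_nhds (by rw [← he]; simp))
    have hg : ∀ (γ : ℝ → M) (w : M → ℝ → Model d) (_ : ∀ p, ∀ t ∈ Set.Icc (0 : ℝ) 1,
        γ t ∈ (ch d p).source → GeodesicAt (christoffel cov p) (fun τ => ch d p (γ τ)) (w p)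
          (Set.Icc 0 1) t) (_ : ∀ᶠ t in 𝓝[Set.Icc 0 1] τ, γ t ∈ (ch d q).source),
        ∀ᶠ t in 𝓝[Set.Icc τ 1] τ, GeodesicAt (christoffel cov q) (fun τ => ch d q (γ τ)) (w q)
          (Set.Icc τ 1) t := by
      intro γ w h hs
      filter_upwards [nhdsWithin_mono _ hsub hs, self_mem_nhdsWithin] with t ht ht'
      exact (h q t (hsub ht') ht).mono hsub
    have key := (smoothConn_christoffel cov hcov ht q).geodesic_eventuallyEq hτ1
      (hg γ₁ w₁ h₁ hs₁) (hg γ₂ w₂ h₂ hs₂) ((ch d q).map_source (by simp [q]))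
      (by rw [← he]) (hw q (by simp [q]))
    have heq : ∀ᶠ t in 𝓝[>] τ, γ₁ t = γ₂ t := by
      filter_upwards [key, hle hs₁, hle hs₂] with t ht ht₁ ht₂
      exact (ch d q).injOn ht₁ ht₂ ht.1
    have hIoo : ∀ᶠ t in 𝓝[>] τ, t ∈ Set.Ioo τ 1 := Ioo_mem_nhdsGT hτ1
    filter_upwards [heq, eventually_eventually_nhdsWithin.2 heq, hIoo] with t ht hte htI
    have ht01 : t ∈ Set.Icc (0 : ℝ) 1 := hsub (Set.Ioo_subset_Icc_self htI)
    refine ⟨ht, fun q' hq' => ?_⟩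
    have hte' : ∀ᶠ t' in 𝓝 t, γ₁ t' = γ₂ t' := by
      rwa [isOpen_Ioi.nhdsWithin_eq htI.1] at hte
    refine (hu t ht01).eq_deriv _ (h₁ q' t ht01 hq').1
      ((h₂ q' t ht01 (ht ▸ hq')).1.congr_of_eventuallyEq_of_mem ?_ ht01)
    filter_upwards [nhdsWithin_le_nhds hte'] with t' ht'
    rw [ht']

/-- A geodesic in a chart, reparametrized. -/
theorem isGeodesic_of_chart {p : M} {c w : ℝ → Model d} {a : ℝ}
    (h : ∀ t ∈ Set.Icc (0 : ℝ) 1, c (a * t) ∈ chTarget d p ∧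
      GeodesicAt (christoffel cov p) c w Set.univ (a * t)) :
    IsGeodesic cov fun τ => (ch d p).symm (c (a * τ)) := by
  have hg : ∀ t ∈ Set.Icc (0 : ℝ) 1, GeodesicAt (christoffel cov p) (fun τ => c (a * τ))
      (fun τ => a • w (a * τ)) Set.univ t := fun t ht => (h t ht).2.comp_mul
  refine ⟨fun t ht => ?_, fun q => ⟨fun τ => WithLp.toLp 2 fun l => ∑ j,
    jacM (transMap d p q) (c (a * τ)) l j * (a • w (a * τ)) j, fun t ht hq => ?_⟩⟩
  · exact ContinuousAt.comp_continuousWithinAt (f := fun τ => c (a * τ))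
      ((ch d p).continuousAt_symm (h t ht).1) ((hg t ht).continuousWithinAt.fst.mono (Set.subset_univ _))
  · exact (GeodesicAt.change (c := fun τ => c (a * τ)) (smoothChange_transMap p q)
      (christoffelLaw_transMap cov p q)
      (mem_overlap.2 ⟨(h t ht).1, hq⟩) (hg t ht)).mono (Set.subset_univ _)

theorem sum_smul_coordField {p x : M} (hx : x ∈ (ch d p).source) (y : Model d) :
    (∑ i, y i • coordField d p i x : TangentSpace (𝓡 d) x) =
      tangentCoordChange (𝓡 d) p x x y := by
  have hy : y = ∑ i, y i • stdVec d i := by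
    simpa [stdVec] using ((EuclideanSpace.basisFun (Fin d) ℝ).sum_repr y).symm
  conv_rhs => rw [hy, map_sum]
  exact Finset.sum_congr rfl fun i _ => by rw [coordField_eq hx, map_smul]; rfl

/-- The curve τ ↦ c(aτ) is a geodesic on [0, 1] with initial velocity a c'(0). So the definition of
`expMap` has a candidate to choose from, and by uniqueness the chosen one ends at the same point. -/
theorem expMap_eq [T2Space M]
    (hcov : CovariantDerivative.ContMDiffCovariantDerivative cov ∞) (ht : cov.torsion = 0)
    {p : M} {u : Model d} {c w : ℝ → Model d} {a : ℝ}
    (h : ∀ t ∈ Set.Icc (0 : ℝ) 1, c (a * t) ∈ chTarget d p ∧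
      GeodesicAt (christoffel cov p) c w Set.univ (a * t)) (hc : c 0 = u) :
    expMap cov ((ch d p).symm u) (∑ i, (a • w 0) i • coordField d p i ((ch d p).symm u)) =
      (ch d p).symm (c a) := by
  have h0 : (0 : ℝ) ∈ Set.Icc (0 : ℝ) 1 := by simp
  have hu : u ∈ (ch d p).target := by
    have := (h 0 h0).1
    rwa [mul_zero, hc] at this
  have hx : (ch d p).symm u ∈ (ch d p).source := (ch d p).map_target hu
  have hg := isGeodesic_of_chart h
  have hd : HasDerivWithinAt (fun τ => ch d ((ch d p).symm u) ((ch d p).symm (c (a * τ))))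
      (∑ i, (a • w 0) i • coordField d p i ((ch d p).symm u) :
        TangentSpace (𝓡 d) ((ch d p).symm u)) (Set.Icc 0 1) 0 := by
    have h1 : HasDerivWithinAt (fun τ => c (a * τ)) (a • w 0) (Set.Icc 0 1) 0 := by
      simpa using (h 0 h0).2.comp_mul.1.mono (Set.subset_univ (Set.Icc (0 : ℝ) 1))
    have h2 : HasDerivWithinAt (fun τ => ch d p ((ch d p).symm (c (a * τ)))) (a • w 0)
        (Set.Icc 0 1) 0 :=
      h1.congr_of_mem (fun τ hτ => (ch d p).right_inv (h τ hτ).1) h0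
    have h3 := hasDerivWithinAt_chart_change (p := p) (q := (ch d p).symm u) h0 (hg.1 0 h0)
      (by simpa [hc] using hx) (by simp [hc]) h2
    rw [sum_smul_coordField hx]
    simpa [hc] using h3
  have hex : ∃ γ : ℝ → M, IsGeodesic cov γ ∧ γ 0 = (ch d p).symm u ∧
      HasDerivWithinAt (fun τ => ch d ((ch d p).symm u) (γ τ))
        (∑ i, (a • w 0) i • coordField d p i ((ch d p).symm u) :
        TangentSpace (𝓡 d) ((ch d p).symm u)) (Set.Icc 0 1) 0 :=
    ⟨_, hg, by simp [hc], hd⟩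
  rw [expMap, dif_pos hex]
  have := hex.choose_spec.1.eqOn hcov ht hg hex.choose_spec.2.1 (by simp [hc])
    hex.choose_spec.2.2 hd (by simp : (1 : ℝ) ∈ Set.Icc (0 : ℝ) 1)
  simpa using this

/-- The jet of the exponential map in a chart. -/
theorem expJet_eq [T2Space M]
    (hcov : CovariantDerivative.ContMDiffCovariantDerivative cov ∞) (ht : cov.torsion = 0)
    (p : M) (u : chTarget d p) (k : Fin d) :
    expJet cov p u k = (smoothConn_christoffel cov hcov ht p).phi k u := by
  refine IsTaylorSeries.taylorSeries_eq
    ((smoothConn_christoffel cov hcov ht p).isTaylorSeries_phi u k fun y => ?_)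
  obtain ⟨c, w, ε, hε, hc, hw, h⟩ :=
    (smoothConn_christoffel cov hcov ht p).exists_geodesic u.2 y
  refine ⟨c, w, Set.Ioo (-ε) ε, isOpen_Ioo, by simp [hε], hc, hw, h, fun a ha => ?_⟩
  -- When |a| < ε all of a · [0, 1] lies in the interval of existence. Thus exp of ay is the
  -- geodesic at time a, for negative a as well.
  have hmem : ∀ t ∈ Set.Icc (0 : ℝ) 1, a * t ∈ Set.Ioo (-ε) ε := by
    intro t ht'
    have h1 : |a * t| ≤ |a| := by
      rw [abs_mul]
      exact mul_le_of_le_one_right (abs_nonneg a) (abs_le.2 ⟨by linarith [ht'.1], ht'.2⟩)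
    exact abs_lt.1 (h1.trans_lt (abs_lt.2 ha))
  have := expMap_eq hcov ht (p := p) (fun t ht' => h _ (hmem t ht')) hc
  rw [hw] at this
  change ch d p (expMap cov _ (∑ i, (a • y) i • _)) k = _
  rw [this, (ch d p).right_inv (h a ha).1]

end Geodesics

/-! ### Sections of `E` with a given jet coordinate -/

section TestSections

open scoped Topology

variable {d : ℕ} {M : Type*} [TopologicalSpace M] [ChartedSpace (Model d) M]
  [IsManifold (𝓡 d) ∞ M]

/-- The section `ρ yᵏ` of `E`, for the jet coordinate `yᵏ` of the chart around `p` and a function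
`ρ` supported in this chart. -/
def coordSection (ρ : M → ℝ) (p : M) (k : Fin d) : FormFam M d 0 :=
  fun p' u _ => ρ ((ch d p').symm u) • linForm (jac d p' p ((ch d p').symm u)) k

/-- Outside the chart around p the Jacobian has no meaning, but such points lie outside the closed
support of ρ, so the section vanishes near them. Inside, the transformation law is the cocycle rule
for Jacobians. -/
theorem isEForm_coordSection {ρ : M → ℝ} (hρ : ContMDiff (𝓡 d) 𝓘(ℝ, ℝ) ∞ ρ) {p : M}
    (hs : tsupport ρ ⊆ (ch d p).source) (k : Fin d) : IsEForm (coordSection ρ p k) where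
  smooth p' I α u hu := by
    have hsymm : ContinuousAt (ch d p').symm u := (ch d p').continuousAt_symm hu
    refine ContDiffAt.contDiffWithinAt ?_
    by_cases hx : (ch d p').symm u ∈ (ch d p).source
    · have hW : (overlap d p' p : Set (Model d)) ∈ 𝓝 u :=
        (overlap d p' p).isOpen.mem_nhds (mem_overlap.2 ⟨hu, hx⟩)
      have h1 : ContDiffAt ℝ ∞ (fun v => ρ ((ch d p').symm v)) u :=
        contMDiffAt_iff_contDiffAt.1 ((hρ _).comp u
          ((contMDiffOn_chart_symm (I := 𝓡 d) (H := Model d) (x := p')).contMDiffAt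
            ((ch d p').open_target.mem_nhds hu)))
      have h2 : ContDiffAt ℝ ∞ (fun v => MvPowerSeries.coeff α
          (linForm (jacM (transMap d p' p) v) k)) u :=
        (SmoothFamOn.linForm (fun k i => (smoothChange_transMap p' p).smooth_jacM k i) k
          α).contDiffAt hW
      refine (h1.mul h2).congr_of_eventuallyEq ?_
      filter_upwards [hW] with v hv
      obtain ⟨hv1, hv2⟩ := mem_overlap.1 hv
      rw [coordSection, MvPowerSeries.coeff_smul, jac_eq_jacM ((ch d p').map_target hv1) hv2,
        (ch d p').right_inv hv1]
    · refine (contDiffAt_const (c := (0 : ℝ))).congr_of_eventuallyEq ?_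
      filter_upwards [hsymm.eventually ((isClosed_tsupport ρ).isOpen_compl.mem_nhds
        fun h => hx (hs h))] with v hv
      rw [coordSection, image_eq_zero_of_notMem_tsupport hv, zero_smul, map_zero]
  alternating p' u hu I σ := by
    rw [Subsingleton.elim (I ∘ σ) I, Subsingleton.elim σ 1]
    simp
  transform p₁ p₂ x h₁ h₂ I := by
    rw [Fintype.sum_unique, Finset.univ_eq_empty, Finset.prod_empty, one_smul, ← linHom_apply]
    simp only [coordSection, (ch d p₁).left_inv h₁, (ch d p₂).left_inv h₂, map_smul]
    by_cases hx : x ∈ (ch d p).source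
    · congr 1
      rw [linForm, linForm, map_sum]
      simp only [map_mul, linHom_C, linHom_X]
      simp only [linForm, Finset.mul_sum]
      rw [Finset.sum_comm]
      refine Finset.sum_congr rfl fun i _ => ?_
      rw [← jac_comp h₁ h₂ hx, map_sum, Finset.sum_mul]
      simp only [map_mul, mul_assoc]
    · rw [image_eq_zero_of_notMem_tsupport fun h => hx (hs h), zero_smul, zero_smul]

theorem linForm_one (k : Fin d) :
    linForm (fun k i => if k = i then 1 else 0) k = (MvPowerSeries.X k : Pow d) := by
  rw [linForm, Finset.sum_eq_single k]
  · simp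
  · intro i _ hi
    simp [hi.symm]
  · simp

/-- Near every point, the jet coordinates of a chart extend to sections of `E`. -/
theorem exists_coordSection [T2Space M] {p : M} {u : Model d} (hu : u ∈ (ch d p).target)
    (k : Fin d) : ∃ (η : FormFam M d 0) (V : Opens (Model d)), IsEForm η ∧ u ∈ V ∧
      V ≤ chTarget d p ∧ ∀ v ∈ V, ∀ I, η p v I = MvPowerSeries.X k := by
  obtain ⟨ρ, hρ, hs, h1⟩ := exists_bump (d := d) ((ch d p).map_target hu)
  have hev : ∀ᶠ v in 𝓝 u, v ∈ (ch d p).target ∧ ρ ((ch d p).symm v) = 1 :=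
    Filter.Eventually.and ((ch d p).open_target.mem_nhds hu)
      (((ch d p).continuousAt_symm hu).eventually h1)
  obtain ⟨V, hV, hVo, huV⟩ := eventually_nhds_iff.1 hev
  refine ⟨coordSection ρ p k, ⟨V, hVo⟩, isEForm_coordSection hρ hs k, huV, fun v hv => (hV v hv).1,
    fun v hv I => ?_⟩
  have hj : jac d p p ((ch d p).symm v) = fun k i => if k = i then 1 else 0 :=
    funext fun k => funext fun i => jac_self ((ch d p).map_target (hV v hv).1) k i
  rw [coordSection, (hV v hv).2, one_smul, hj, linForm_one]

end TestSections

/-! ### The connection form on a manifold -/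

section Main

variable {d : ℕ} {U : Opens (Model d)} {Γ : Chris d}

theorem SmoothConn.mono (h : SmoothConn U Γ) {V : Opens (Model d)} (hV : V ≤ U) :
    SmoothConn V Γ where
  smooth i j k := (h.smooth i j k).mono hV
  symm u hu := h.symm u (hV hu)

/-- The homogeneous parts of a smooth solution are forced by the recursion, and conversely the form
of the exponential map is a solution with these parts. -/
theorem SmoothConn.fedosovStep_eq_iff (h : SmoothConn U Γ) {A : LV1 d}
    (hA : ∀ i k, SmoothFamOn U fun u => A u i k) :
    (∀ u ∈ U, A u = fedosovStep Γ A u) ↔ ∀ u ∈ U, A u = fedosovLocal Γ u := by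
  constructor
  · intro hF u hu
    let B : Matrix (Fin d) (Fin d) (Fam U) := fun i k => Fam.res _ (hA i k)
    have hB : ∀ v : U, ∀ i k, B i k v = A v i k := fun v i k => rfl
    refine h.eq_fedosovLocal hB ?_ ⟨u, hu⟩
    funext i k
    refine Fam.ext' fun v => ?_
    rw [h.step_apply hB, hB, ← hF v v.2]
  · intro hF u hu
    have hB : ∀ v : U, ∀ i k, h.conForm i k v = A v i k := fun v i k => by
      rw [h.conForm_apply, hF v v.2]
    funext i k
    rw [← h.step_apply hB i k ⟨u, hu⟩, h.step_conForm, hB]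

variable {M : Type*} [TopologicalSpace M] [ChartedSpace (Model d) M]
  [IsManifold (𝓡 d) ∞ M]
  {cov : CovariantDerivative (𝓡 d) (Model d) (TangentSpace (𝓡 d) : M → Type _)}

/-- The components of a form on the target of a chart. -/
def IsV1Form.fam {A : V1Fam M d} (hA : IsV1Form A) (p : M) :
    Matrix (Fin d) (Fin d) (Fam (chTarget d p)) :=
  fun i k => Fam.res (fun u => A p u i k) (hA.smooth p i k)

theorem IsV1Form.fam_apply {A : V1Fam M d} (hA : IsV1Form A) (p : M) (u : chTarget d p)
    (i k : Fin d) : hA.fam p i k u = A p u i k := rfl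

variable [T2Space M]

theorem isV1Form_fedosovForm (hcov : CovariantDerivative.ContMDiffCovariantDerivative cov ∞)
    (ht : cov.torsion = 0) : IsV1Form (fedosovForm cov) where
  smooth p i k := (smoothConn_christoffel cov hcov ht p).fedosovLocal_smooth i k
  transform p p' x hx hx' i l := by
    have hle : overlap d p p' ≤ chTarget d p := fun u hu => (mem_overlap.1 hu).1
    have := SmoothChange.fedosovLocal_transform
      ((smoothConn_christoffel cov hcov ht p).mono hle) (smoothConn_christoffel cov hcov ht p')
      (christoffelLaw_transMap cov p p') (smoothChange_transMap p p')
      ⟨ch d p x, mem_overlap_of_mem hx hx'⟩ i l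
    rw [jac_eq_jacM hx hx']
    have hxx : transMap d p p' (ch d p x) = ch d p' x :=
      congrArg (ch d p') ((ch d p).left_inv hx)
    rwa [hxx] at this

/-- The jet of the exponential map is the formal series `phi`, and the form attached to `phi` is the
one from Fedosov's recursion. -/
theorem grothendieckD_eq (hcov : CovariantDerivative.ContMDiffCovariantDerivative cov ∞)
    (ht : cov.torsion = 0) {q : ℕ} (η : FormFam M d q) :
    SameOn (grothendieckD cov η) (connD cov (fedosovForm cov) η) := fun p u hu =>
  (smoothConn_christoffel cov hcov ht p).grothendieckLocal_eq
    (fun v j => expJet_eq hcov ht p v j) (η p) ⟨u, hu⟩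

/-- The operator `-δ + ∇' + A` determines `A`. -/
theorem sameOn_of_connD {A A' : V1Fam M d}
    (h : ∀ η : FormFam M d 0, IsEForm η → SameOn (connD cov A η) (connD cov A' η)) :
    SameOn A A' := by
  intro p u hu
  funext i k
  obtain ⟨η, V, hη, huV, -, hX⟩ := exists_coordSection hu k
  rw [← SmoothConn.connLocal_coord (A := A p) k (hX u huV) i,
    ← SmoothConn.connLocal_coord (A := A' p) k (hX u huV) i]
  have := congrFun (h η hη p u hu) ![i]
  simpa [connD] using this

theorem flatnessEq_iff (hcov : CovariantDerivative.ContMDiffCovariantDerivative cov ∞)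
    (ht : cov.torsion = 0) {A : V1Fam M d} (hA : IsV1Form A) :
    FlatnessEq cov A ↔ ∀ p i j k,
      (smoothConn_christoffel cov hcov ht p).jet.delta (hA.fam p) i j k =
        (smoothConn_christoffel cov hcov ht p).curvTotal (hA.fam p) i j k := by
  constructor
  · intro h p i j k
    refine Fam.ext' fun u => ?_
    rw [SmoothConn.delta_apply _ (hA.fam_apply p),
      SmoothConn.curvTotal_apply _ (hA.fam_apply p)]
    exact congrFun (congrFun (congrFun (h p u u.2) i) j) k
  · intro h p u hu
    funext i j k
    have := congrArg (fun f : Fam (chTarget d p) => f ⟨u, hu⟩) (h p i j k)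
    simp only [SmoothConn.delta_apply _ (hA.fam_apply p),
      SmoothConn.curvTotal_apply _ (hA.fam_apply p)] at this
    exact this

/-- Sections equal to yᵏ near a point detect the k-th component of the curvature, so the square on
0-forms already forces the equation. Conversely, vanishing curvature makes the Dᵢ commute, which
annihilates the square on forms of every degree. -/
theorem isFlat_iff (hcov : CovariantDerivative.ContMDiffCovariantDerivative cov ∞)
    (ht : cov.torsion = 0) {A : V1Fam M d} (hA : IsV1Form A) :
    IsFlat cov A ↔ FlatnessEq cov A := by
  constructor
  · intro h p u hu
    funext i j k
    obtain ⟨η, V, hη, huV, hV, hX⟩ := exists_coordSection hu k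
    have hc := (smoothConn_christoffel cov hcov ht p).mono hV
    let B : Matrix (Fin d) (Fin d) (Fam V) := fun i k =>
      Fam.res (fun u => A p u i k) fun α => (hA.smooth p i k α).mono hV
    have h1 := hc.connLocal_sq_coord (A := A p) (B := B) (fun u i k => rfl) k hX i j ⟨u, huV⟩
    have hB : ∀ v : V, ∀ i k, B i k v = A p v i k := fun v i k => rfl
    have h2 : connLocal (christoffel cov p) (A p) (connLocal (christoffel cov p) (A p) (η p)) u =
      0 := h 0 η hη p u hu
    rw [h2, Fam.sub_apply, SmoothConn.delta_apply _ hB,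
      SmoothConn.curvTotal_apply _ hB] at h1
    exact (sub_eq_zero.1 h1.symm).symm
  · intro h q η hη p u hu
    exact (smoothConn_christoffel cov hcov ht p).connLocal_sq (hA.fam_apply p)
      ((flatnessEq_iff hcov ht hA).1 h p) (hη.smooth p) ⟨u, hu⟩

theorem fedosovEq_iff (hcov : CovariantDerivative.ContMDiffCovariantDerivative cov ∞)
    (ht : cov.torsion = 0) {A : V1Fam M d} (hA : IsV1Form A) :
    FedosovEq cov A ↔ SameOn A (fedosovForm cov) :=
  forall_congr' fun p => (smoothConn_christoffel cov hcov ht p).fedosovStep_eq_iff (hA.smooth p)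

theorem deltaInvZero_fedosovForm (hcov : CovariantDerivative.ContMDiffCovariantDerivative cov ∞)
    (ht : cov.torsion = 0) : DeltaInvZero (fedosovForm cov) := fun p u hu =>
  (SmoothConn.radial_iff (fun v i k =>
    (smoothConn_christoffel cov hcov ht p).conForm_apply i k v)).1
      (smoothConn_christoffel cov hcov ht p).radial_conForm u hu

theorem flatnessEq_fedosovForm (hcov : CovariantDerivative.ContMDiffCovariantDerivative cov ∞)
    (ht : cov.torsion = 0) : FlatnessEq cov (fedosovForm cov) := by
  refine (flatnessEq_iff hcov ht (isV1Form_fedosovForm hcov ht)).2 fun p i j k => ?_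
  have : (isV1Form_fedosovForm hcov ht).fam p =
      (smoothConn_christoffel cov hcov ht p).conForm := by
    funext i k
    exact Fam.ext' fun u => ((smoothConn_christoffel cov hcov ht p).conForm_apply i k u).symm
  rw [this]
  exact (smoothConn_christoffel cov hcov ht p).flat_conForm i j k

/-- The two conditions together imply Fedosov's equation, whose solution is unique. -/
theorem eq_fedosovForm (hcov : CovariantDerivative.ContMDiffCovariantDerivative cov ∞)
    (ht : cov.torsion = 0) {A : V1Fam M d} (hA : IsV1Form A) (h0 : DeltaInvZero A)
    (hF : FlatnessEq cov A) : SameOn A (fedosovForm cov) := fun p u hu => by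
  have hR : SmoothConn.Radial (hA.fam p) :=
    (SmoothConn.radial_iff (hA.fam_apply p)).2 (h0 p)
  exact (smoothConn_christoffel cov hcov ht p).eq_fedosovLocal (hA.fam_apply p)
    ((smoothConn_christoffel cov hcov ht p).step_eq_of_flat hR
      ((flatnessEq_iff hcov ht hA).1 hF p)) ⟨u, hu⟩

theorem isUniversalNoLoop_fedosovForm
    (hcov : CovariantDerivative.ContMDiffCovariantDerivative cov ∞) (ht : cov.torsion = 0) :
    IsUniversalNoLoop noLoopCoeff cov (fedosovForm cov) := fun p u hu i k α =>
  ((smoothConn_christoffel cov hcov ht p).coeff_fedosovLocal i k ⟨u, hu⟩ α).trans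
    (SmoothConn.coeff_ev _ _ _ _ _ _)

end Main

end FedosovGrothendieck

end

/-! ### Assembly of the theorem -/

theorem mainTheorem9 :
    ∃ c : ℕ → (List ℕ →₀ ℝ), (∀ N, c N [] = 0) ∧
      ∀ (d : ℕ) (M : Type*) [TopologicalSpace M] [T2Space M]
        [ChartedSpace (FedosovGrothendieck.Model d) M] [IsManifold (𝓡 d) ∞ M]
        (cov : CovariantDerivative (𝓡 d) (FedosovGrothendieck.Model d)
          (TangentSpace (𝓡 d) : M → Type _)),
        CovariantDerivative.ContMDiffCovariantDerivative cov ∞ → cov.torsion = 0 →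
        ∃ A : FedosovGrothendieck.V1Fam M d, FedosovGrothendieck.IsV1Form A ∧
          -- `D^G = -δ + ∇' + A` on `Ω(M, E)`
          (∀ (q : ℕ) (η : FedosovGrothendieck.FormFam M d q), FedosovGrothendieck.IsEForm η →
            FedosovGrothendieck.SameOn (FedosovGrothendieck.grothendieckD cov η)
              (FedosovGrothendieck.connD cov A η)) ∧
          -- which determines `A`
          (∀ A' : FedosovGrothendieck.V1Fam M d, FedosovGrothendieck.IsV1Form A' →
            (∀ (q : ℕ) (η : FedosovGrothendieck.FormFam M d q), FedosovGrothendieck.IsEForm η →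
              FedosovGrothendieck.SameOn (FedosovGrothendieck.grothendieckD cov η)
                (FedosovGrothendieck.connD cov A' η)) →
            FedosovGrothendieck.SameOn A' A) ∧
          -- the shape of `A`
          FedosovGrothendieck.IsUniversalNoLoop c cov A ∧
          FedosovGrothendieck.DeltaInvZero A ∧
          -- flatness, and its reformulation for an arbitrary `1`-form
          FedosovGrothendieck.IsFlat cov A ∧
          FedosovGrothendieck.FlatnessEq cov A ∧
          (∀ A' : FedosovGrothendieck.V1Fam M d, FedosovGrothendieck.IsV1Form A' →
            (FedosovGrothendieck.IsFlat cov A' ↔ FedosovGrothendieck.FlatnessEq cov A')) ∧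
          -- uniqueness
          (∀ A' : FedosovGrothendieck.V1Fam M d, FedosovGrothendieck.IsV1Form A' →
            FedosovGrothendieck.DeltaInvZero A' → FedosovGrothendieck.FlatnessEq cov A' →
            FedosovGrothendieck.SameOn A' A) ∧
          -- the `1`-form of the Fedosov construction: it is the solution of Fedosov's equation
          (∀ A' : FedosovGrothendieck.V1Fam M d, FedosovGrothendieck.IsV1Form A' →
            (FedosovGrothendieck.FedosovEq cov A' ↔
              FedosovGrothendieck.SameOn A' (FedosovGrothendieck.fedosovForm cov))) ∧
          FedosovGrothendieck.SameOn (FedosovGrothendieck.fedosovForm cov) A ∧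
          -- the two differentials coincide
          (∀ (q : ℕ) (η : FedosovGrothendieck.FormFam M d q), FedosovGrothendieck.IsEForm η →
            FedosovGrothendieck.SameOn (FedosovGrothendieck.fedosovD cov η)
              (FedosovGrothendieck.grothendieckD cov η)) := by
  refine ⟨FedosovGrothendieck.noLoopCoeff, FedosovGrothendieck.noLoopCoeff_nil, ?_⟩
  intro d M _ _ _ _ cov hcov ht
  have hG := fun (q : ℕ) (η : FedosovGrothendieck.FormFam M d q) =>
    FedosovGrothendieck.grothendieckD_eq hcov ht η
  have hF := FedosovGrothendieck.flatnessEq_fedosovForm hcov ht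
  have hV := FedosovGrothendieck.isV1Form_fedosovForm hcov ht
  -- The witness for A is the Fedosov form itself. So A_F = A holds by definition, and the content
  -- lies in the formula for D^G.
  refine ⟨FedosovGrothendieck.fedosovForm cov, hV, fun q η _ => hG q η, fun A' _ h => ?_,
    FedosovGrothendieck.isUniversalNoLoop_fedosovForm hcov ht,
    FedosovGrothendieck.deltaInvZero_fedosovForm hcov ht,
    (FedosovGrothendieck.isFlat_iff hcov ht hV).2 hF, hF,
    fun A' hA' => FedosovGrothendieck.isFlat_iff hcov ht hA',
    fun A' hA' h0 hE => FedosovGrothendieck.eq_fedosovForm hcov ht hA' h0 hE,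
    fun A' hA' => FedosovGrothendieck.fedosovEq_iff hcov ht hA', fun _ _ _ => rfl,
    fun q η _ p u hu => (hG q η p u hu).symm⟩
  exact FedosovGrothendieck.sameOn_of_connD fun η hη p u hu =>
    (h 0 η hη p u hu).symm.trans (hG 0 η p u hu)
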